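/- **Definitions.** An abstract $n$-polytope is a partially ordered set $\mathcal P$ with a strictly monotone rank function with range $\{-1,0,\dots,n\}$, a least and a greatest face, all of whose flags (maximal chains) have $n+2$ elements, such that whenever $F<G$ with $\operatorname{rank} G=\operatorname{rank} F+2$ there are exactly two faces $H$ with $F<H<G$, and such that for all $F\le G$ the flag graph of the section $G/F=\{H: F\le H\le G\}$ is connected (two flags are adjacent if they differ in exactly one face). It is regular if its automorphism group is transitive on flags. For posets $\mathcal K,\mathcal M$, the class $\langle\mathcal K,\mathcal M\rangle$ consists of the regular $(n+1)$-polytopes all of whose facets are isomorphic to $\mathcal K$ and all of whose vertex-figures are isomorphic to $\mathcal M$. A covering is a surjective order-preserving map that preserves rank and takes adjacent flags to adjacent flags. The universal polytope $\{\mathcal K,\mathcal M\}$, if it exists, is a member of $\langle\mathcal K,\mathcal M\rangle$ that covers every member of $\langle\mathcal K,\mathcal M\rangle$. Let $\{4,3,3,3\}$ be the face lattice of the $5$-cube. Let $\{3,4,3,3\}$ be the regular tessellation of Euclidean $4$-space by $24$-cells, placed so that the centres of the tiles form the lattice generated by the unit coordinate vectors and $(\tfrac12,\tfrac12,\tfrac12,\tfrac12)$,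 and let $[3,4,3,3]$ be its symmetry group. For $\mathbf q=(d,0,0,0)$ or $(d,d,0,0)$, let the toroid $\{3,4,3,3\}_{\mathbf q}$ be the quotient of $\{3,4,3,3\}$ by the normal subgroup of $[3,4,3,3]$ generated by the translation by the vector $\mathbf q$. **Theorem.** For every integer $d\ge 2$ the universal regular $6$-polytopes $$\{\{3,4,3,3\}_{(d,0,0,0)},\{4,3,3,3\}\}\quad\text{and}\quad\{\{3,4,3,3\}_{(d,d,0,0)},\{4,3,3,3\}\}$$ exist. -/

import Mathlib

/-! ### Abstract polytopes -/

universe u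

namespace AbstractPolytope

/-- The flag graph of a poset: its vertices are the flags (maximal chains), and two flags are
adjacent when they differ in exactly one face. -/
def flagGraph (P : Type*) [PartialOrder P] : SimpleGraph (Flag P) where
  Adj Φ Ψ := ((Φ : Set P) \ Ψ).encard = 1 ∧ ((Ψ : Set P) \ Φ).encard = 1
  symm := ⟨fun _ _ h => ⟨h.2, h.1⟩⟩
  loopless := ⟨fun Φ h => by simp at h⟩

/-- `P`, with rank function `rk`, is an abstract `n`-polytope. -/
structure IsPolytope (n : ℕ) {P : Type*} [PartialOrder P] (rk : P → ℤ) : Prop where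
  rank_strictMono : StrictMono rk
  rank_range : Set.range rk = Set.Icc (-1) (n : ℤ)
  exists_least : ∃ F : P, ∀ G, F ≤ G
  exists_greatest : ∃ F : P, ∀ G, G ≤ F
  flag_card : ∀ Φ : Flag P, (Φ : Set P).encard = n + 2
  diamond : ∀ F G : P, F < G → rk G = rk F + 2 → (Set.Ioo F G).encard = 2
  strongly_flag_connected : ∀ F G : P, F ≤ G → (flagGraph (Set.Icc F G)).Connected

/-- `P`, with rank function `rk`, is a regular `n`-polytope: an abstract `n`-polytope whose
automorphism group is transitive on flags. -/
structure IsRegularPolytope (n : ℕ) {P : Type*} [PartialOrder P] (rk : P → ℤ) : Prop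
    extends IsPolytope n rk where
  flag_transitive : ∀ Φ Ψ : Flag P, ∃ γ : P ≃o P, γ '' (Φ : Set P) = Ψ

/-- The class `⟨K, M⟩`: regular `(n+1)`-polytopes all of whose facets are isomorphic to `K` and all
of whose vertex-figures are isomorphic to `M` (where `K` and `M` have rank `n`). -/
structure InClass (n : ℕ) (K M : Type*) [LE K] [LE M] {P : Type*} [PartialOrder P]
    (rk : P → ℤ) : Prop where
  regular : IsRegularPolytope (n + 1) rk
  facet : ∀ F : P, rk F = n → Nonempty (Set.Iic F ≃o K)
  vertex_figure : ∀ F : P, rk F = 0 → Nonempty (Set.Ici F ≃o M)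

/-- A covering of `Q` by `P`: a surjective order-preserving map which preserves rank and takes
adjacent flags to adjacent flags. -/
structure IsCovering {P Q : Type*} [PartialOrder P] [PartialOrder Q]
    (rkP : P → ℤ) (rkQ : Q → ℤ) (f : P → Q) : Prop where
  monotone : Monotone f
  surjective : Function.Surjective f
  rank_eq : ∀ F, rkQ (f F) = rkP F
  adjacent : ∀ Φ Ψ : Flag P, (flagGraph P).Adj Φ Ψ →
    ∃ Φ' Ψ' : Flag Q, (Φ' : Set Q) = f '' Φ ∧ (Ψ' : Set Q) = f '' Ψ ∧ (flagGraph Q).Adj Φ' Ψ'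

/-- `P` is the universal polytope `{K, M}`: it belongs to the class `⟨K, M⟩` and covers every
polytope in that class. -/
structure IsUniversal (n : ℕ) (K M : Type*) [LE K] [LE M] {P : Type*} [PartialOrder P]
    (rk : P → ℤ) : Prop where
  inClass : InClass n K M rk
  covers : ∀ (Q : Type u) [PartialOrder Q] (rkQ : Q → ℤ), InClass n K M rkQ →
    ∃ f : P → Q, IsCovering rk rkQ f

/-- The universal regular `(n+1)`-polytope `{K, M}` exists. -/
def UniversalExists (n : ℕ) (K M : Type*) [LE K] [LE M] : Prop :=
  ∃ (P : Type) (_ : PartialOrder P) (rk : P → ℤ), IsUniversal.{u} n K M rk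

/-! ### The poset of a group with distinguished generators -/

/-- For generators `ρ₀, …, ρₙ₋₁` of `Γ`, the subgroup generated by the `ρᵢ` with `i ≠ j - 1`. The
index `j ∈ {0, …, n+1}` is the rank shifted by one: this is the stabilizer of the base face of rank
`j - 1`, and it is all of `⟨ρ₀, …, ρₙ₋₁⟩` for the two improper faces `j = 0` and `j = n + 1`. -/
def faceSubgroup {Γ : Type*} [Group Γ] {n : ℕ} (ρ : Fin n → Γ) (j : Fin (n + 2)) : Subgroup Γ :=
  Subgroup.closure {g | ∃ i : Fin n, (i : ℕ) + 1 ≠ j ∧ ρ i = g}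

/-- The set of faces of `𝒫(Γ)` for a group `Γ` generated by `ρ₀, …, ρₙ₋₁`: the faces of rank `j - 1`
are the left cosets of `faceSubgroup ρ j`. -/
def CosetPoset {Γ : Type*} [Group Γ] {n : ℕ} (ρ : Fin n → Γ) : Type _ :=
  Σ j : Fin (n + 2), Γ ⧸ faceSubgroup ρ j

/-- Incidence in `𝒫(Γ)`: a face is below another if its rank is at most that of the other and the
two cosets intersect. -/
instance {Γ : Type*} [Group Γ] {n : ℕ} (ρ : Fin n → Γ) : LE (CosetPoset ρ) where
  le F G := F.1 ≤ G.1 ∧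
    ∃ g : Γ, (g : Γ ⧸ faceSubgroup ρ F.1) = F.2 ∧ (g : Γ ⧸ faceSubgroup ρ G.1) = G.2

/-- `Γ` acts on `𝒫(Γ)` by left multiplication. -/
instance {Γ : Type*} [Group Γ] {n : ℕ} (ρ : Fin n → Γ) : MulAction Γ (CosetPoset ρ) :=
  inferInstanceAs (MulAction Γ (Σ j : Fin (n + 2), Γ ⧸ faceSubgroup ρ j))

/-- The quotient `P / L` of a poset by a group `L` acting on it: the set of `L`-orbits. -/
def OrbitPoset (L : Type*) [Group L] (P : Type*) [MulAction L P] : Type _ :=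
  MulAction.orbitRel.Quotient L P

/-- One orbit is below another if some member of the first is below some member of the second. -/
instance (L : Type*) [Group L] (P : Type*) [MulAction L P] [LE P] : LE (OrbitPoset L P) where
  le x y := ∃ F G : P, Quotient.mk (MulAction.orbitRel L P) F = x ∧
    Quotient.mk (MulAction.orbitRel L P) G = y ∧ F ≤ G

/-! ### The tessellation `{3,4,3,3}` of Euclidean 4-space and its toroids -/

/-- The reflection of `ℝⁿ` in the hyperplane `a ⬝ᵥ x = c` (the identity if `a = 0`). -/
noncomputable def hyperplaneReflection {n : ℕ} (a : Fin n → ℝ) (c : ℝ) :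
    Equiv.Perm (Fin n → ℝ) :=
  Function.Involutive.toPerm (fun x => x - (2 * (a ⬝ᵥ x - c) / (a ⬝ᵥ a)) • a) <| by
    intro x
    rcases eq_or_ne (a ⬝ᵥ a) 0 with h | h
    · simp [h]
    · have key : a ⬝ᵥ (x - (2 * (a ⬝ᵥ x - c) / (a ⬝ᵥ a)) • a) - c = -(a ⬝ᵥ x - c) := by
        rw [dotProduct_sub, dotProduct_smul, smul_eq_mul, div_mul_cancel₀ _ h]
        ring
      simp only [key]
      rw [sub_sub, ← add_smul]
      rw [show 2 * (a ⬝ᵥ x - c) / (a ⬝ᵥ a) + 2 * -(a ⬝ᵥ x - c) / (a ⬝ᵥ a) = 0 by ring]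
      simp

/-- The reflections `r₀, …, r₄` in the walls of a fundamental simplex for the symmetry group
`[3,4,3,3]` of the tessellation `{3,4,3,3}` of `ℝ⁴` by 24-cells. The walls of `r₀, …, r₃` pass
through the origin, the centre of the base tile; the centres of the tiles form the lattice
generated by the vectors `(±1,0,0,0)`, …, `(0,0,0,±1)` and `(±1/2,±1/2,±1/2,±1/2)`, and `r₄` is the
reflection in the common facet of the tiles centred at the origin and at `(1,0,0,0)`. -/
noncomputable def mirror : Fin 5 → Equiv.Perm (Fin 4 → ℝ) :=
  ![hyperplaneReflection ![0, 1, -1, 0] 0,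
    hyperplaneReflection ![0, 0, 1, -1] 0,
    hyperplaneReflection ![0, 0, 0, 1] 0,
    hyperplaneReflection ![1 / 2, -1 / 2, -1 / 2, -1 / 2] 0,
    hyperplaneReflection ![1, 0, 0, 0] (1 / 2)]

/-- The symmetry group `[3,4,3,3]` of the tessellation `{3,4,3,3}` of `ℝ⁴`. -/
def G3433 : Subgroup (Equiv.Perm (Fin 4 → ℝ)) :=
  Subgroup.closure (Set.range mirror)

/-- The distinguished generators of `[3,4,3,3]`. -/
noncomputable def gen3433 (i : Fin 5) : G3433 :=
  ⟨mirror i, Subgroup.subset_closure ⟨i, rfl⟩⟩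

/-- The tessellation `{3,4,3,3}` of `ℝ⁴`, as the poset `𝒫([3,4,3,3])`. -/
abbrev Tessellation3433 : Type := CosetPoset gen3433

/-- The normal subgroup of `[3,4,3,3]` generated by the translation by the vector `q`. -/
def translationSubgroup (q : Fin 4 → ℝ) : Subgroup G3433 :=
  Subgroup.normalClosure {g | (g : Equiv.Perm (Fin 4 → ℝ)) = Equiv.addRight q}

/-- The toroid `{3,4,3,3}_q` with type vector `q`: the quotient of the tessellation `{3,4,3,3}` by
the normal subgroup generated by the translation by `q`. -/
abbrev Toroid3433 (q : Fin 4 → ℝ) : Type :=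
  OrbitPoset (translationSubgroup q) Tessellation3433

/-! ### The cube -/

/-- The face lattice of the `n`-cube `{4,3,…,3}`. The vertices of the cube are the `0/1`-vectors,
and the vertex sets of its faces (including the empty one) are exactly the intervals of the Boolean
lattice `Fin n → Bool`, ordered by inclusion. -/
abbrev Cube (n : ℕ) : Type := Interval (Fin n → Bool)

end AbstractPolytope

/-! A regular polytope is recovered from its automorphism group and distinguished generators as a
poset of cosets. Every member of ⟨K, M⟩ is covered through one group U: six involutory generators,
all relations of the group A of K among the first five, all relations of the group B of M among the
last five, and commutation of the first with the last. So the universal polytope exists once U is a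
string C-group in which A and B embed (`universalExists_of_amalgam`). For this it is enough to find
one group Δ, an image of U, in which A and B embed and overlap only in the subgroup generated by the
shared generators (`amalgam_isStringCGroup`).

Here Δ comes from hyperbolic geometry. Six reflections of ℝ⁶ preserve a form of signature (5,1). The
first five fix the null vector (0,0,0,0,-1,1) and act on a horosphere as [3,4,3,3]; the last five
fix the last coordinate and act on the hyperplane y₅ = 1 as the group [4,3,3,3] of the cube. All six
preserve the lattice D₆ and its dual D₆*. Let Γ be the stabilizer of two lattices Λ₁, Λ₂ and let K
consist of the elements congruent to the identity on Λ₁ modulo Λ₂; then Δ = Γ/K. The choice (D₆*,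
d·D₆) serves the type vector (d,0,0,0), and (D₆, 2d·D₆*) serves (d,d,0,0).

`universalExists_toroid` isolates what has to be checked. The elements of [3,4,3,3] that become
trivial in Δ are exactly the translations in the normal subgroup of the toroid. The cube group
embeds because its action on the vectors (-eᵢ, 1) is visible modulo Λ₂. An element common to both
images fixes the null vector modulo Λ₂, so on the cube side it fixes the centre of a facet and lies
in the shared [4,3,3].

The intersection properties come from one fact on finite reflection groups: the stabilizer of a
point of the closed chamber is generated by the walls through it (`mem_closure_of_apply_eq`). For
the toroids it is combined with the absence of short translations: an isometry fixing 0 moves x by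
at most 2‖x‖, so a congruence between small displacements is an equality. This is where d ≥ 2
enters. -/

namespace AbstractPolytope

/-! ### Groups generated by a string of involutions -/

section StringGroups

variable {Γ : Type*} [Group Γ] {n : ℕ}

/-- The subgroup generated by the `ρ k` with `k + 1 ∈ S`. -/
def parabolic (ρ : Fin n → Γ) (S : Set ℕ) : Subgroup Γ :=
  Subgroup.closure {g | ∃ i : Fin n, (i : ℕ) + 1 ∈ S ∧ ρ i = g}

theorem faceSubgroup_eq_parabolic (ρ : Fin n → Γ) (j : Fin (n + 2)) :
    faceSubgroup ρ j = parabolic ρ {k | k ≠ (j : ℕ)} := rfl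

theorem parabolic_mono (ρ : Fin n → Γ) {S T : Set ℕ} (h : ∀ k, 0 < k → k ≤ n → k ∈ S → k ∈ T) :
    parabolic ρ S ≤ parabolic ρ T := by
  apply Subgroup.closure_mono
  rintro g ⟨i, hi, rfl⟩
  exact ⟨i, h _ (by omega) (by omega) hi, rfl⟩

theorem mem_parabolic (ρ : Fin n → Γ) {S : Set ℕ} {i : Fin n} (h : (i : ℕ) + 1 ∈ S) :
    ρ i ∈ parabolic ρ S := Subgroup.subset_closure ⟨i, h, rfl⟩

theorem map_parabolic {Δ : Type*} [Group Δ] (f : Γ →* Δ) (ρ : Fin n → Γ) (S : Set ℕ) :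
    (parabolic ρ S).map f = parabolic (fun i => f (ρ i)) S := by
  rw [parabolic, parabolic, MonoidHom.map_closure]
  congr 1
  ext g
  constructor
  · rintro ⟨_, ⟨i, hi, rfl⟩, rfl⟩
    exact ⟨i, hi, rfl⟩
  · rintro ⟨i, hi, rfl⟩
    exact ⟨_, ⟨i, hi, rfl⟩, rfl⟩

/-- `ρ₀, …, ρₙ₋₁` generate `Γ`, are involutions, those that are not neighbours commute, and the
intersection property holds. -/
class IsStringCGroup (ρ : Fin n → Γ) : Prop where
  closure_range : Subgroup.closure (Set.range ρ) = ⊤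
  mul_self : ∀ i, ρ i * ρ i = 1
  ne_one : ∀ i, ρ i ≠ 1
  commute : ∀ i j : Fin n, (i : ℕ) + 2 ≤ j → Commute (ρ i) (ρ j)
  inter : ∀ i j : ℕ, parabolic ρ (Set.Iio j) ⊓ parabolic ρ (Set.Ioi i) ≤ parabolic ρ (Set.Ioo i j)

section

variable (ρ : Fin n → Γ) [hρ : IsStringCGroup ρ]

theorem parabolic_eq_top {S : Set ℕ} (h : ∀ k, 0 < k → k ≤ n → k ∈ S) : parabolic ρ S = ⊤ := by
  rw [eq_top_iff, ← hρ.closure_range]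
  apply Subgroup.closure_mono
  rintro _ ⟨i, rfl⟩
  exact ⟨i, h _ (by omega) (by omega), rfl⟩

theorem commute_of_mem_parabolic {S T : Set ℕ} (hST : ∀ s ∈ S, ∀ t ∈ T, s + 2 ≤ t ∨ t + 2 ≤ s)
    {a b : Γ}
    (ha : a ∈ parabolic ρ S) (hb : b ∈ parabolic ρ T) : Commute a b := by
  have h1 : parabolic ρ S ≤ Subgroup.centralizer (parabolic ρ T : Set Γ) := by
    rw [Subgroup.le_centralizer_iff, parabolic, Subgroup.closure_le]
    rintro _ ⟨t, ht, rfl⟩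
    rw [SetLike.mem_coe, Subgroup.mem_centralizer_iff]
    have : parabolic ρ S ≤ Subgroup.centralizer {ρ t} := by
      rw [parabolic, Subgroup.closure_le]
      rintro _ ⟨s, hs, rfl⟩
      rw [SetLike.mem_coe, Subgroup.mem_centralizer_iff]
      rintro _ rfl
      rcases hST _ hs _ ht with h | h
      · exact (hρ.commute s t (by omega)).eq.symm
      · exact (hρ.commute t s (by omega)).eq
    intro g hg
    exact ((Subgroup.mem_centralizer_iff.1 (this hg)) _ rfl).symm
  exact ((Subgroup.mem_centralizer_iff.1 (h1 ha)) _ hb).symm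

theorem exists_mul_of_mem_parabolic {S T U : Set ℕ} (hU : ∀ k ∈ U, k ∈ S ∨ k ∈ T)
    (hST : ∀ s ∈ S, ∀ t ∈ T, s + 2 ≤ t ∨ t + 2 ≤ s) {g : Γ} (hg : g ∈ parabolic ρ U) :
    ∃ a ∈ parabolic ρ S, ∃ b ∈ parabolic ρ T, Commute a b ∧ g = a * b := by
  have hc : ∀ a ∈ parabolic ρ S, ∀ b ∈ parabolic ρ T, Commute a b := fun a ha b hb =>
    commute_of_mem_parabolic ρ hST ha hb
  suffices ∃ a ∈ parabolic ρ S, ∃ b ∈ parabolic ρ T, g = a * b by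
    obtain ⟨a, ha, b, hb, h⟩ := this
    exact ⟨a, ha, b, hb, hc a ha b hb, h⟩
  induction hg using Subgroup.closure_induction with
  | mem x hx =>
    obtain ⟨i, hi, rfl⟩ := hx
    rcases hU _ hi with h | h
    · exact ⟨ρ i, mem_parabolic ρ h, 1, one_mem _, by simp⟩
    · exact ⟨1, one_mem _, ρ i, mem_parabolic ρ h, by simp⟩
  | one => exact ⟨1, one_mem _, 1, one_mem _, by simp⟩
  | mul x y _ _ hx hy =>
    obtain ⟨a, ha, b, hb, rfl⟩ := hx
    obtain ⟨a', ha', b', hb', rfl⟩ := hy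
    refine ⟨a * a', mul_mem ha ha', b * b', mul_mem hb hb', ?_⟩
    rw [mul_assoc, ← mul_assoc b, ← (hc a' ha' b hb).eq]
    simp only [mul_assoc]
  | inv x _ hx =>
    obtain ⟨a, ha, b, hb, rfl⟩ := hx
    exact ⟨a⁻¹, inv_mem ha, b⁻¹, inv_mem hb, by rw [(hc a ha b hb).eq, mul_inv_rev]⟩

theorem exists_mul_of_mem_parabolic_ne {j : ℕ} {g : Γ} (hg : g ∈ parabolic ρ {k | k ≠ j}) :
    ∃ a ∈ parabolic ρ (Set.Iio j), ∃ b ∈ parabolic ρ (Set.Ioi j), Commute a b ∧ g = a * b := by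
  refine exists_mul_of_mem_parabolic ρ (S := Set.Iio j) (T := Set.Ioi j) (U := {k | k ≠ j})
    (fun k hk => (lt_or_gt_of_ne hk : k < j ∨ k > j)) ?_ hg
  intro s hs t ht
  simp only [Set.mem_Iio, Set.mem_Ioi] at hs ht
  omega

/-- Factor an element of the intersection as ab at i and as cd at j, with i < j. Then c⁻¹a = db⁻¹
involves only indices below j on one side and only indices above i on the other, so the axiom for
intervals places it strictly between. Thus the axiom for intervals controls the common stabilizer of
any two faces of the base flag. -/
theorem parabolic_ne_inf_parabolic_ne (i j : ℕ) :
    parabolic ρ {k | k ≠ i} ⊓ parabolic ρ {k | k ≠ j} ≤ parabolic ρ {k | k ≠ i ∧ k ≠ j} := by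
  wlog h : i ≤ j generalizing i j
  · have := this j i (by omega)
    rw [inf_comm]
    refine this.trans (parabolic_mono ρ ?_)
    rintro k _ _ ⟨h1, h2⟩
    exact ⟨h2, h1⟩
  rcases h.eq_or_lt with rfl | h
  · simp
  rintro x ⟨h1, h2⟩
  obtain ⟨a, ha, b, hb, -, rfl⟩ := exists_mul_of_mem_parabolic_ne ρ h1
  obtain ⟨c, hc, d, hd, -, hx⟩ := exists_mul_of_mem_parabolic_ne ρ h2
  have e : c⁻¹ * a = d * b⁻¹ := by
    rw [eq_mul_inv_iff_mul_eq, mul_assoc, hx, inv_mul_cancel_left]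
  have hm : c⁻¹ * a ∈ parabolic ρ (Set.Ioo i j) := by
    apply hρ.inter i j
    refine Subgroup.mem_inf.2 ⟨mul_mem (inv_mem hc) (parabolic_mono ρ ?_ ha), ?_⟩
    · intro k _ _ hk; simp only [Set.mem_Iio] at *; omega
    · rw [e]
      refine mul_mem (parabolic_mono ρ ?_ hd) (inv_mem hb)
      intro k _ _ hk; simp only [Set.mem_Ioi] at *; omega
  have hx' : a * b = a * (c⁻¹ * a)⁻¹ * d := by rw [hx]; group
  rw [hx']
  refine mul_mem (mul_mem (parabolic_mono ρ ?_ ha) (inv_mem (parabolic_mono ρ ?_ hm)))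
    (parabolic_mono ρ ?_ hd)
  all_goals
    intro k _ _ hk
    simp only [Set.mem_Iio, Set.mem_Ioi, Set.mem_Ioo, Set.mem_ofPred_eq] at *
    omega

/-- This says that `ρ i` really moves the base face of index i + 1. Two applications of the
intersection property to intervals without interior first remove the factor with large indices and
then force `ρ i = 1`. -/
theorem notMem_parabolic_ne (i : Fin n) : ρ i ∉ parabolic ρ {k | k ≠ (i : ℕ) + 1} := by
  intro h
  obtain ⟨a, ha, b, hb, -, hx⟩ := exists_mul_of_mem_parabolic_ne ρ h
  have hempty : ∀ x ∈ parabolic ρ (∅ : Set ℕ), x = 1 := by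
    intro x hx
    simpa [parabolic] using hx
  have hb1 : b = 1 := by
    apply hempty
    have : b ∈ parabolic ρ (Set.Ioo ((i : ℕ) + 1) (i + 2)) := by
      apply hρ.inter
      refine Subgroup.mem_inf.2 ⟨?_, hb⟩
      have : b = a⁻¹ * ρ i := by rw [hx]; group
      rw [this]
      refine mul_mem (inv_mem (parabolic_mono ρ ?_ ha)) (mem_parabolic ρ ?_)
      · intro k _ _ hk; simp only [Set.mem_Iio] at *; omega
      · simp
    refine parabolic_mono ρ ?_ this
    intro k _ _ hk; simp only [Set.mem_Ioo] at *; omega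
  subst hb1
  rw [mul_one] at hx
  subst hx
  apply hρ.ne_one i
  apply hempty
  have : ρ i ∈ parabolic ρ (Set.Ioo (i : ℕ) (i + 1)) := by
    apply hρ.inter
    exact ⟨ha, mem_parabolic ρ (by simp)⟩
  refine parabolic_mono ρ ?_ this
  intro k _ _ hk; simp only [Set.mem_Ioo] at *; omega

end

/-! ### The faces and flags of the coset poset -/

/-- The face of the coset poset that is the coset of `g` at index `j`. -/
def cosetFace (ρ : Fin n → Γ) (j : Fin (n + 2)) (g : Γ) : CosetPoset ρ :=
  Sigma.mk j (g : Γ ⧸ faceSubgroup ρ j)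

theorem exists_eq_cosetFace {ρ : Fin n → Γ} (F : CosetPoset ρ) : ∃ g, F = cosetFace ρ F.1 g := by
  obtain ⟨j, x⟩ := F
  obtain ⟨g, rfl⟩ := QuotientGroup.mk_surjective x
  exact ⟨g, rfl⟩

@[simp] theorem cosetFace_fst (ρ : Fin n → Γ) (j : Fin (n + 2)) (g : Γ) :
    (cosetFace ρ j g).1 = j := rfl

theorem cosetFace_eq_iff {ρ : Fin n → Γ} {j : Fin (n + 2)} {g h : Γ} :
    cosetFace ρ j g = cosetFace ρ j h ↔ g⁻¹ * h ∈ parabolic ρ {k | k ≠ (j : ℕ)} := by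
  rw [← faceSubgroup_eq_parabolic, ← QuotientGroup.eq]
  constructor
  · intro e
    exact eq_of_heq (Sigma.mk.inj_iff.1 e).2
  · intro e
    unfold cosetFace
    rw [e]

theorem cosetFace_mul_of_mem {ρ : Fin n → Γ} {j : Fin (n + 2)} (g : Γ) {h : Γ}
    (hh : h ∈ parabolic ρ {k | k ≠ (j : ℕ)}) : cosetFace ρ j (g * h) = cosetFace ρ j g := by
  rw [eq_comm, cosetFace_eq_iff]
  simpa

theorem le_def {ρ : Fin n → Γ} {F G : CosetPoset ρ} :
    F ≤ G ↔ F.1 ≤ G.1 ∧ ∃ g, cosetFace ρ F.1 g = F ∧ cosetFace ρ G.1 g = G := by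
  obtain ⟨i, x⟩ := F
  obtain ⟨j, y⟩ := G
  apply and_congr_right'
  apply exists_congr
  intro g
  apply and_congr
  · exact ⟨fun e => Sigma.ext rfl (heq_of_eq e), fun e => eq_of_heq (Sigma.mk.inj_iff.1 e).2⟩
  · exact ⟨fun e => Sigma.ext rfl (heq_of_eq e), fun e => eq_of_heq (Sigma.mk.inj_iff.1 e).2⟩

theorem cosetFace_le_cosetFace {ρ : Fin n → Γ} {i j : Fin (n + 2)} (h : i ≤ j) (g : Γ) :
    cosetFace ρ i g ≤ cosetFace ρ j g := le_def.2 ⟨h, g, rfl, rfl⟩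

theorem smul_cosetFace (ρ : Fin n → Γ) (j : Fin (n + 2)) (g h : Γ) :
    g • cosetFace ρ j h = cosetFace ρ j (g * h) := rfl

theorem cosetFace_mul_of_mem_Ioi (ρ : Fin n → Γ) {i j : Fin (n + 2)} (h : i ≤ j) (g : Γ) {b : Γ}
    (hb : b ∈ parabolic ρ (Set.Ioi (j : ℕ))) : cosetFace ρ i (g * b) = cosetFace ρ i g := by
  apply cosetFace_mul_of_mem
  refine parabolic_mono ρ ?_ hb
  intro k _ _ hk
  simp only [Set.mem_Ioi, Set.mem_ofPred_eq] at *
  have : (i : ℕ) ≤ j := h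
  omega

theorem isChain_range_cosetFace (ρ : Fin n → Γ) (g : Γ) :
    IsChain (· ≤ ·) (Set.range fun j => cosetFace ρ j g) := by
  rintro _ ⟨i, rfl⟩ _ ⟨j, rfl⟩ _
  rcases le_total i j with h | h
  · exact Or.inl (cosetFace_le_cosetFace h g)
  · exact Or.inr (cosetFace_le_cosetFace h g)

theorem smul_le_smul_coset (ρ : Fin n → Γ) {g : Γ} {F G : CosetPoset ρ} : g • F ≤ g • G ↔ F ≤ G := by
  have key : ∀ (g : Γ) (F G : CosetPoset ρ), F ≤ G → g • F ≤ g • G := by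
    intro g F G h
    obtain ⟨h1, x, h2, h3⟩ := le_def.1 h
    rw [← h2, ← h3]
    exact cosetFace_le_cosetFace h1 (g * x)
  refine ⟨fun h => ?_, key g F G⟩
  have := key g⁻¹ _ _ h
  rwa [inv_smul_smul, inv_smul_smul] at this

/-- Left multiplication as an automorphism of the coset poset. -/
def cosetAut (ρ : Fin n → Γ) (g : Γ) : CosetPoset ρ ≃o CosetPoset ρ where
  toEquiv := MulAction.toPerm g
  map_rel_iff' := smul_le_smul_coset ρ

@[simp] theorem cosetAut_cosetFace (ρ : Fin n → Γ) (g h : Γ) (j : Fin (n + 2)) :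
    cosetAut ρ g (cosetFace ρ j h) = cosetFace ρ j (g * h) := rfl

/-- The rank function of the coset poset. -/
def cosetRank (ρ : Fin n → Γ) (F : CosetPoset ρ) : ℤ := ((F.1 : ℕ) : ℤ) - 1

section

variable (ρ : Fin n → Γ) [hρ : IsStringCGroup ρ]

/-- A representative of the lower face need only be corrected by generators above index i, because
the part below i also fixes G. Such a correction leaves all faces of index at most i unchanged,
which gives transitivity and the induction along chains. -/
theorem exists_common_of_le {g : Γ} {i : Fin (n + 2)} {G : CosetPoset ρ}
    (h : cosetFace ρ i g ≤ G) :
    ∃ b ∈ parabolic ρ (Set.Ioi (i : ℕ)), G = cosetFace ρ G.1 (g * b) := by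
  obtain ⟨hij, x, hx, hG⟩ := le_def.1 h
  rw [cosetFace_fst] at hx hij
  have hx' := cosetFace_eq_iff.1 hx.symm
  obtain ⟨a, ha, b, hb, hab, e⟩ := exists_mul_of_mem_parabolic_ne ρ hx'
  refine ⟨b, hb, ?_⟩
  rw [← hG, cosetFace_fst, cosetFace_eq_iff]
  have : x⁻¹ * (g * b) = a⁻¹ := by
    have hx2 : x = g * (a * b) := by rw [← e]; group
    rw [hx2, hab.eq]; group
  rw [this]
  refine inv_mem (parabolic_mono ρ ?_ ha)
  intro k _ _ hk
  simp only [Set.mem_Iio, Set.mem_ofPred_eq] at *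
  have : (i : ℕ) ≤ G.1 := hij
  omega

/-! ### The partial order on cosets, its chains and its diamonds. -/

instance : PartialOrder (CosetPoset ρ) where
  le_refl F := le_def.2 ⟨le_rfl, by
    obtain ⟨g, hg⟩ := exists_eq_cosetFace F
    exact ⟨g, hg.symm, hg.symm⟩⟩
  le_trans F G H h1 h2 := by
    obtain ⟨h, x, hF, hG⟩ := le_def.1 h1
    rw [← hG] at h2
    obtain ⟨b, hb, e⟩ := exists_common_of_le ρ h2
    refine le_def.2 ⟨h.trans (le_def.1 h2).1, x * b, ?_, e.symm⟩
    rw [cosetFace_mul_of_mem_Ioi ρ h x hb, hF]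
  le_antisymm F G h1 h2 := by
    obtain ⟨h, x, hF, hG⟩ := le_def.1 h1
    have := le_antisymm h (le_def.1 h2).1
    rw [← hF, ← hG, this]

theorem bot_cosetFace_le (F : CosetPoset ρ) (g : Γ) : cosetFace ρ 0 g ≤ F := by
  obtain ⟨h, hh⟩ := exists_eq_cosetFace F
  refine le_def.2 ⟨Fin.zero_le _, h, ?_, hh.symm⟩
  rw [cosetFace_fst, cosetFace_eq_iff, parabolic_eq_top]
  · trivial
  · intro k hk _
    simp only [Fin.val_zero, Set.mem_ofPred_eq]; omega

theorem le_top_cosetFace (F : CosetPoset ρ) (g : Γ) : F ≤ cosetFace ρ (Fin.last _) g := by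
  obtain ⟨h, hh⟩ := exists_eq_cosetFace F
  refine le_def.2 ⟨Fin.le_last _, h, hh.symm, ?_⟩
  rw [cosetFace_fst, cosetFace_eq_iff, parabolic_eq_top]
  · trivial
  · intro k hk _
    simp only [Fin.val_last, Set.mem_ofPred_eq]; omega

/-- Every chain of the coset poset lies in a translate of the base flag. -/
theorem exists_forall_eq_cosetFace_of_isChain {C : Set (CosetPoset ρ)}
    (hC : IsChain (· ≤ ·) C) : ∃ g, ∀ F ∈ C, F = cosetFace ρ F.1 g := by
  -- Sweep the chain by increasing index. The face of g at index i lies below everything not yet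
  -- treated, so the next correction only uses generators above i and preserves the faces already
  -- represented.
  have key : ∀ k : ℕ, ∃ g, ∃ i : Fin (n + 2),
      (∀ F ∈ C, (F.1 : ℕ) < k → F.1 ≤ i ∧ F = cosetFace ρ F.1 g) ∧
      (∀ F ∈ C, k ≤ (F.1 : ℕ) → cosetFace ρ i g ≤ F) := by
    intro k
    induction k with
    | zero =>
      exact ⟨1, 0, fun F _ h => absurd h (by omega), fun F _ _ => bot_cosetFace_le ρ F 1⟩
    | succ k ih =>
      obtain ⟨g, i, h1, h2⟩ := ih
      by_cases hk : ∃ F ∈ C, (F.1 : ℕ) = k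
      · obtain ⟨F, hFC, hF⟩ := hk
        have hle := h2 F hFC hF.ge
        obtain ⟨b, hb, e⟩ := exists_common_of_le ρ hle
        have hu : ∀ E ∈ C, E.1 = F.1 → E = F := by
          intro E hE hEF
          by_contra hne
          rcases hC hE hFC hne with h | h <;> obtain ⟨_, x, h3, h4⟩ := le_def.1 h <;>
            exact hne (by rw [← h3, ← h4, hEF])
        refine ⟨g * b, F.1, ?_, ?_⟩
        · intro E hE hEk
          rcases Nat.lt_succ_iff_lt_or_eq.1 hEk with h | h
          · obtain ⟨h3, h4⟩ := h1 E hE h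
            refine ⟨Fin.le_def.2 (by omega), ?_⟩
            rw [cosetFace_mul_of_mem_Ioi ρ h3 g hb]
            exact h4
          · have := hu E hE (Fin.ext (by omega))
            subst this
            exact ⟨le_rfl, e⟩
        · intro E hE hEk
          rw [← e]
          have hne : F ≠ E := by rintro rfl; omega
          rcases hC hFC hE hne with h | h
          · exact h
          · have := Fin.le_def.1 (le_def.1 h).1
            omega
      · push Not at hk
        refine ⟨g, i, ?_, ?_⟩
        · intro E hE hEk
          exact h1 E hE (by have := hk E hE; omega)
        · intro E hE hEk
          exact h2 E hE (by omega)
  obtain ⟨g, i, h1, -⟩ := key (n + 2)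
  exact ⟨g, fun F hF => (h1 F hF F.1.2).2⟩

/-- The translate by `g` of the base flag. -/
def cosetFlag (g : Γ) : Flag (CosetPoset ρ) where
  carrier := Set.range fun j => cosetFace ρ j g
  Chain' := isChain_range_cosetFace ρ g
  max_chain' := by
    intro s hs h
    refine h.antisymm ?_
    obtain ⟨x, hx⟩ := exists_forall_eq_cosetFace_of_isChain ρ hs
    intro F hF
    refine ⟨F.1, ?_⟩
    change cosetFace ρ F.1 g = F
    rw [hx F hF]
    exact hx _ (h ⟨F.1, rfl⟩)

@[simp] theorem coe_cosetFlag (g : Γ) :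
    (cosetFlag ρ g : Set (CosetPoset ρ)) = Set.range fun j => cosetFace ρ j g := rfl

theorem exists_eq_cosetFlag (Φ : Flag (CosetPoset ρ)) : ∃ g, Φ = cosetFlag ρ g := by
  obtain ⟨g, hg⟩ := exists_forall_eq_cosetFace_of_isChain ρ Φ.chain_le
  refine ⟨g, Flag.ext (Φ.max_chain' (isChain_range_cosetFace ρ g) ?_)⟩
  intro F hF
  exact ⟨F.1, (hg F hF).symm⟩

theorem strictMono_fst : StrictMono fun F : CosetPoset ρ => F.1 := by
  intro F G h
  have h1 := le_def.1 h.le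
  refine lt_of_le_of_ne h1.1 ?_
  intro e
  obtain ⟨_, x, h3, h4⟩ := h1
  exact h.ne (by rw [← h3, ← h4]; exact congrArg (fun j => cosetFace ρ j x) e)

theorem exists_common_of_le_le {F H G : CosetPoset ρ} (h1 : F ≤ H) (h2 : H ≤ G) :
    ∃ g, F = cosetFace ρ F.1 g ∧ H = cosetFace ρ H.1 g ∧ G = cosetFace ρ G.1 g := by
  have hC : IsChain (· ≤ ·) ({F, H, G} : Set (CosetPoset ρ)) := by
    have h3 := h1.trans h2
    rintro a (rfl | rfl | rfl) b (rfl | rfl | rfl) hab <;> tauto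
  obtain ⟨g, hg⟩ := exists_forall_eq_cosetFace_of_isChain ρ hC
  exact ⟨g, hg F (by simp), hg H (by simp), hg G (by simp)⟩

/-- The common stabilizer of F and G omits exactly the two possible neighbours of `ρ i` in the
string, so its other generators commute with `ρ i`. Modulo the stabilizer of the middle face only 1
and `ρ i` survive, and these give different faces. -/
theorem coset_diamond (F G : CosetPoset ρ) (hFG : F < G)
    (hr : cosetRank ρ G = cosetRank ρ F + 2) : (Set.Ioo F G).encard = 2 := by
  obtain ⟨g, hF, -, hG⟩ := exists_common_of_le_le ρ hFG.le le_rfl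
  have hr' : (G.1 : ℕ) = F.1 + 2 := by simp only [cosetRank] at hr; omega
  have hlt := G.1.2
  let i : Fin n := ⟨F.1, by omega⟩
  let j : Fin (n + 2) := ⟨(F.1 : ℕ) + 1, by omega⟩
  rw [Set.encard_eq_two]
  refine ⟨cosetFace ρ j g, cosetFace ρ j (g * ρ i), ?_, ?_⟩
  · intro e
    rw [cosetFace_eq_iff, inv_mul_cancel_left] at e
    exact notMem_parabolic_ne ρ i e
  have hFj : F.1 ≤ j := Fin.le_def.2 (Nat.le_succ _)
  have hjG : j ≤ G.1 := Fin.le_def.2 (by change (F.1 : ℕ) + 1 ≤ G.1; omega)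
  have hiF : ρ i ∈ parabolic ρ {k | k ≠ (F.1 : ℕ)} := mem_parabolic ρ (by
    change (F.1 : ℕ) + 1 ≠ F.1; omega)
  have hiG : ρ i ∈ parabolic ρ {k | k ≠ (G.1 : ℕ)} := mem_parabolic ρ (by
    change (F.1 : ℕ) + 1 ≠ G.1; omega)
  have mem_of : ∀ x, F = cosetFace ρ F.1 x → G = cosetFace ρ G.1 x →
      cosetFace ρ j x ∈ Set.Ioo F G := by
    intro x h1 h2
    constructor
    · refine lt_of_le_of_ne (by rw [h1]; exact cosetFace_le_cosetFace hFj x) ?_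
      intro e
      have := congrArg (fun F : CosetPoset ρ => (F.1 : ℕ)) e
      change (F.1 : ℕ) = F.1 + 1 at this
      omega
    · refine lt_of_le_of_ne (by rw [h2]; exact cosetFace_le_cosetFace hjG x) ?_
      intro e
      have := congrArg (fun F : CosetPoset ρ => (F.1 : ℕ)) e
      change (F.1 : ℕ) + 1 = G.1 at this
      omega
  apply Set.Subset.antisymm
  · rintro H ⟨h1, h2⟩
    obtain ⟨h, hF', hH, hG'⟩ := exists_common_of_le_le ρ h1.le h2.le
    have hHj : H.1 = j := by
      have a1 : (F.1 : ℕ) < H.1 := strictMono_fst ρ h1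
      have a2 : (H.1 : ℕ) < G.1 := strictMono_fst ρ h2
      apply Fin.ext
      change (H.1 : ℕ) = F.1 + 1
      omega
    rw [hHj] at hH
    have m1 := cosetFace_eq_iff.1 (hF.symm.trans hF')
    have m2 := cosetFace_eq_iff.1 (hG.symm.trans hG')
    have m := parabolic_ne_inf_parabolic_ne ρ _ _ ⟨m1, m2⟩
    have key : ∀ x ∈ parabolic ρ {k | k ≠ (F.1 : ℕ) ∧ k ≠ (G.1 : ℕ)},
        x ∈ parabolic ρ {k | k ≠ (j : ℕ)} ∨ ρ i * x ∈ parabolic ρ {k | k ≠ (j : ℕ)} := by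
      intro x hx
      have step : ∀ k : Fin n, (k : ℕ) + 1 ≠ F.1 ∧ (k : ℕ) + 1 ≠ G.1 → ∀ x,
          (x ∈ parabolic ρ {k | k ≠ (j : ℕ)} ∨ ρ i * x ∈ parabolic ρ {k | k ≠ (j : ℕ)}) →
          (ρ k * x ∈ parabolic ρ {k | k ≠ (j : ℕ)} ∨
            ρ i * (ρ k * x) ∈ parabolic ρ {k | k ≠ (j : ℕ)}) := by
        intro k hk x ih
        by_cases hki : k = i
        · subst hki
          rw [← mul_assoc, hρ.mul_self, one_mul]
          exact ih.symm
        · have hki' : (k : ℕ) ≠ F.1 := fun e => hki (Fin.ext e)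
          have hkj : ρ k ∈ parabolic ρ {k | k ≠ (j : ℕ)} := mem_parabolic ρ (by
            change (k : ℕ) + 1 ≠ F.1 + 1; omega)
          have hcomm : Commute (ρ i) (ρ k) := by
            rcases lt_or_gt_of_ne hki' with h | h
            · exact (hρ.commute k i (by change (k : ℕ) + 2 ≤ F.1; omega)).symm
            · exact hρ.commute i k (by change (F.1 : ℕ) + 2 ≤ k; omega)
          rcases ih with ih | ih
          · exact Or.inl (mul_mem hkj ih)
          · right
            rw [← mul_assoc, hcomm.eq, mul_assoc]
            exact mul_mem hkj ih
      induction hx using Subgroup.closure_induction_left with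
      | one => exact Or.inl (one_mem _)
      | mul_left y hy x hx ih =>
        obtain ⟨k, hk, rfl⟩ := hy
        exact step k hk x ih
      | inv_mul_cancel y hy x hx ih =>
        obtain ⟨k, hk, rfl⟩ := hy
        rw [inv_eq_of_mul_eq_one_left (hρ.mul_self k)]
        exact step k hk x ih
    rw [hH]
    rcases key _ m with h3 | h3
    · left
      rw [eq_comm, cosetFace_eq_iff]
      exact h3
    · right
      rw [Set.mem_singleton_iff, eq_comm, cosetFace_eq_iff]
      have : (ρ i)⁻¹ = ρ i := inv_eq_of_mul_eq_one_left (hρ.mul_self i)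
      rw [mul_inv_rev, this, mul_assoc]
      exact h3
  · rintro H (rfl | rfl)
    · exact mem_of g hF hG
    · refine mem_of _ ?_ ?_
      · rw [cosetFace_mul_of_mem g hiF]; exact hF
      · rw [cosetFace_mul_of_mem g hiG]; exact hG

end

end StringGroups

/-! ### The coset poset is a regular polytope -/

theorem isChain_image_val {P : Type*} [PartialOrder P] {S : Set P} {C : Set S}
    (hC : IsChain (· ≤ ·) C) : IsChain (· ≤ ·) (Subtype.val '' C) := by
  rintro _ ⟨x, hx, rfl⟩ _ ⟨y, hy, rfl⟩ hxy
  exact hC hx hy fun e => hxy (congrArg _ e)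

theorem eq_or_adj_of_sdiff_subset {P : Type*} [PartialOrder P] {Φ Ψ : Flag P} {x y : P}
    (h1 : (Φ : Set P) \ Ψ ⊆ {x}) (h2 : (Ψ : Set P) \ Φ ⊆ {y}) :
    Φ = Ψ ∨ (flagGraph P).Adj Φ Ψ := by
  by_cases h : Φ = Ψ
  · exact Or.inl h
  right
  constructor
  · rcases Set.subset_singleton_iff_eq.1 h1 with e | e
    · exact absurd (Flag.ext (Φ.max_chain' Ψ.chain_le (Set.sdiff_eq_empty.1 e))) h
    · rw [e, Set.encard_singleton]
  · rcases Set.subset_singleton_iff_eq.1 h2 with e | e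
    · exact absurd (Flag.ext (Ψ.max_chain' Φ.chain_le (Set.sdiff_eq_empty.1 e))).symm h
    · rw [e, Set.encard_singleton]

section

variable {Γ : Type*} [Group Γ] {n : ℕ} (ρ : Fin n → Γ) [hρ : IsStringCGroup ρ]

/-- The part of a translate of the base flag that lies in a section. -/
def cosetSectionFlag {F G : CosetPoset ρ} (g : Γ) (hF : F = cosetFace ρ F.1 g)
    (hG : G = cosetFace ρ G.1 g) : Flag (Set.Icc F G) where
  carrier := {x | x.1 = cosetFace ρ x.1.1 g}
  Chain' := by
    intro x hx y hy _
    have hx' : x.1 = cosetFace ρ x.1.1 g := hx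
    have hy' : y.1 = cosetFace ρ y.1.1 g := hy
    rcases le_total x.1.1 y.1.1 with h | h
    · left
      change x.1 ≤ y.1
      rw [hx', hy']
      exact cosetFace_le_cosetFace h g
    · right
      change y.1 ≤ x.1
      rw [hx', hy']
      exact cosetFace_le_cosetFace h g
  max_chain' := by
    intro s hs h
    refine h.antisymm ?_
    obtain ⟨x, hx⟩ := exists_forall_eq_cosetFace_of_isChain ρ
      (isChain_image_val hs)
    intro y hy
    change y.1 = cosetFace ρ y.1.1 g
    have hy' : y.1 = cosetFace ρ y.1.1 x := hx _ ⟨y, hy, rfl⟩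
    have hFy : F.1 ≤ y.1.1 := (le_def.1 y.2.1).1
    have hyG : y.1.1 ≤ G.1 := (le_def.1 y.2.2).1
    have hmem : cosetFace ρ y.1.1 g ∈ Set.Icc F G := by
      constructor
      · exact hF.le.trans (cosetFace_le_cosetFace hFy g)
      · exact (cosetFace_le_cosetFace hyG g).trans hG.ge
    have h2 : (⟨cosetFace ρ y.1.1 g, hmem⟩ : Set.Icc F G) ∈ s := h rfl
    rw [hy']
    exact (hx _ ⟨_, h2, rfl⟩).symm

theorem exists_eq_cosetSectionFlag {F G : CosetPoset ρ} (hFG : F ≤ G) (Φ : Flag (Set.Icc F G)) :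
    ∃ g hF hG, Φ = cosetSectionFlag ρ (F := F) (G := G) g hF hG := by
  obtain ⟨x, hx⟩ := exists_forall_eq_cosetFace_of_isChain ρ
    (isChain_image_val Φ.chain_le)
  have hF : (⟨F, le_rfl, hFG⟩ : Set.Icc F G) ∈ Φ :=
    Flag.mem_iff_forall_le_or_ge.2 fun b _ => Or.inl b.2.1
  have hG : (⟨G, hFG, le_rfl⟩ : Set.Icc F G) ∈ Φ :=
    Flag.mem_iff_forall_le_or_ge.2 fun b _ => Or.inr b.2.2
  refine ⟨x, hx _ ⟨_, hF, rfl⟩, hx _ ⟨_, hG, rfl⟩, ?_⟩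
  refine Flag.ext (Φ.max_chain' (Flag.chain_le _) ?_)
  intro y hy
  exact hx _ ⟨y, hy, rfl⟩

/-- Two flags of the section differ by an element of the common stabilizer of its ends, hence by a
word in generators. Right multiplication by one generator changes at most one face, so the word
traces a walk in the flag graph. -/
theorem coset_strongly_flag_connected (F G : CosetPoset ρ) (hFG : F ≤ G) :
    (flagGraph (Set.Icc F G)).Connected := by
  obtain ⟨g, hF, -, hG⟩ := exists_common_of_le_le ρ hFG le_rfl
  have key : ∀ x ∈ parabolic ρ {k | k ≠ (F.1 : ℕ) ∧ k ≠ (G.1 : ℕ)},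
      ∃ (h1 : F = cosetFace ρ F.1 (g * x)) (h2 : G = cosetFace ρ G.1 (g * x)),
        (flagGraph (Set.Icc F G)).Reachable (cosetSectionFlag ρ g hF hG)
          (cosetSectionFlag ρ (g * x) h1 h2) := by
    have step : ∀ k : Fin n, (k : ℕ) + 1 ≠ F.1 ∧ (k : ℕ) + 1 ≠ G.1 → ∀ (x : Γ)
      (h1 : F = cosetFace ρ F.1 x) (h2 : G = cosetFace ρ G.1 x),
      ∃ (h1' : F = cosetFace ρ F.1 (x * ρ k)) (h2' : G = cosetFace ρ G.1 (x * ρ k)),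
        (flagGraph (Set.Icc F G)).Reachable (cosetSectionFlag ρ x h1 h2)
          (cosetSectionFlag ρ (x * ρ k) h1' h2') := by
      rintro k ⟨hk1, hk2⟩ x h1 h2
      have hne : ∀ j : Fin (n + 2), (k : ℕ) + 1 ≠ j →
          cosetFace ρ j (x * ρ k) = cosetFace ρ j x := fun j hj =>
        cosetFace_mul_of_mem x (mem_parabolic ρ hj)
      refine ⟨by rw [hne _ hk1]; exact h1, by rw [hne _ hk2]; exact h2, ?_⟩
      have hF1 : ∀ z : Γ, (j : Fin (n + 2)) → (F.1 ≤ j ∧ j ≤ G.1) → F = cosetFace ρ F.1 z →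
          G = cosetFace ρ G.1 z → cosetFace ρ j z ∈ Set.Icc F G := by
        intro z j hj e1 e2
        constructor
        · rw [e1]; exact cosetFace_le_cosetFace hj.1 z
        · rw [e2]; exact cosetFace_le_cosetFace hj.2 z
      -- The only face that `ρ k` can move has index k + 1; if that index lies outside the section,
      -- the flag of the section stays the same.
      by_cases hj : F.1 ≤ k.succ.castSucc ∧ k.succ.castSucc ≤ G.1
      · have hval : ((k.succ.castSucc : Fin (n + 2)) : ℕ) = k + 1 := rfl
        suffices h : cosetSectionFlag ρ x h1 h2 = cosetSectionFlag ρ (x * ρ k)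
            (by rw [hne _ hk1]; exact h1) (by rw [hne _ hk2]; exact h2) ∨
            (flagGraph (Set.Icc F G)).Adj (cosetSectionFlag ρ x h1 h2)
              (cosetSectionFlag ρ (x * ρ k) (by rw [hne _ hk1]; exact h1)
                (by rw [hne _ hk2]; exact h2)) by
          rcases h with h | h
          · rw [h]
          · exact h.reachable
        refine eq_or_adj_of_sdiff_subset
          (x := ⟨cosetFace ρ k.succ.castSucc x, hF1 x _ hj h1 h2⟩)
          (y := ⟨cosetFace ρ k.succ.castSucc (x * ρ k), hF1 _ _ hj
            (by rw [hne _ hk1]; exact h1) (by rw [hne _ hk2]; exact h2)⟩) ?_ ?_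
        · rintro y ⟨hy1, hy2⟩
          have hy1' : y.1 = cosetFace ρ y.1.1 x := hy1
          have hy2' : ¬ y.1 = cosetFace ρ y.1.1 (x * ρ k) := hy2
          have : y.1.1 = k.succ.castSucc := by
            by_contra hc
            apply hy2'
            rw [hne]
            · exact hy1'
            · intro e; exact hc (Fin.ext (by rw [hval, e]))
          apply Subtype.ext
          change y.1 = cosetFace ρ k.succ.castSucc x
          rw [← this]
          exact hy1'
        · rintro y ⟨hy1, hy2⟩
          have hy1' : y.1 = cosetFace ρ y.1.1 (x * ρ k) := hy1
          have hy2' : ¬ y.1 = cosetFace ρ y.1.1 x := hy2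
          have : y.1.1 = k.succ.castSucc := by
            by_contra hc
            apply hy2'
            rw [← hne]
            · exact hy1'
            · intro e; exact hc (Fin.ext (by rw [hval, e]))
          apply Subtype.ext
          change y.1 = cosetFace ρ k.succ.castSucc (x * ρ k)
          rw [← this]
          exact hy1'
      · have : cosetSectionFlag ρ x h1 h2 =
            cosetSectionFlag ρ (x * ρ k) (by rw [hne _ hk1]; exact h1)
              (by rw [hne _ hk2]; exact h2) := by
          apply Flag.ext
          ext y
          change y.1 = cosetFace ρ y.1.1 x ↔ y.1 = cosetFace ρ y.1.1 (x * ρ k)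
          rw [hne]
          intro e
          apply hj
          have : y.1.1 = k.succ.castSucc := Fin.ext e.symm
          rw [← this]
          exact ⟨(le_def.1 y.2.1).1, (le_def.1 y.2.2).1⟩
        rw [this]
    intro x hx
    induction hx using Subgroup.closure_induction_right with
    | one =>
      simp only [mul_one]
      exact ⟨hF, hG, SimpleGraph.Reachable.refl _⟩
    | mul_right x hx y hy ih =>
      obtain ⟨k, hk, rfl⟩ := hy
      obtain ⟨h1, h2, h3⟩ := ih
      obtain ⟨h1', h2', h3'⟩ := step k hk _ h1 h2
      simp only [← mul_assoc]
      exact ⟨h1', h2', h3.trans h3'⟩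
    | mul_inv_cancel x hx y hy ih =>
      obtain ⟨k, hk, rfl⟩ := hy
      obtain ⟨h1, h2, h3⟩ := ih
      obtain ⟨h1', h2', h3'⟩ := step k hk _ h1 h2
      simp only [inv_eq_of_mul_eq_one_left (hρ.mul_self k), ← mul_assoc]
      exact ⟨h1', h2', h3.trans h3'⟩
  have hreach : ∀ Φ, (flagGraph (Set.Icc F G)).Reachable (cosetSectionFlag ρ g hF hG) Φ := by
    intro Φ
    obtain ⟨h, h1, h2, rfl⟩ := exists_eq_cosetSectionFlag ρ hFG Φ
    have m1 := cosetFace_eq_iff.1 (hF.symm.trans h1)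
    have m2 := cosetFace_eq_iff.1 (hG.symm.trans h2)
    obtain ⟨_, _, h3⟩ := key _ (parabolic_ne_inf_parabolic_ne ρ _ _ ⟨m1, m2⟩)
    simpa only [mul_inv_cancel_left] using h3
  have : Nonempty (Flag (Set.Icc F G)) := ⟨cosetSectionFlag ρ g hF hG⟩
  exact ⟨fun Φ Ψ => (hreach Φ).symm.trans (hreach Ψ)⟩

theorem isRegularPolytope_coset : IsRegularPolytope n (cosetRank ρ) where
  rank_strictMono F G h := by
    have : (F.1 : ℕ) < G.1 := strictMono_fst ρ h
    simp only [cosetRank]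
    omega
  rank_range := by
    ext r
    simp only [Set.mem_range, Set.mem_Icc, cosetRank]
    constructor
    · rintro ⟨F, rfl⟩
      have := F.1.2
      omega
    · rintro ⟨h1, h2⟩
      refine ⟨cosetFace ρ ⟨(r + 1).toNat, by omega⟩ 1, ?_⟩
      simp only [cosetFace_fst]
      omega
  exists_least := ⟨_, fun F => bot_cosetFace_le ρ F 1⟩
  exists_greatest := ⟨_, fun F => le_top_cosetFace ρ F 1⟩
  flag_card Φ := by
    obtain ⟨g, rfl⟩ := exists_eq_cosetFlag ρ Φ
    rw [coe_cosetFlag, ← Set.image_univ, Function.Injective.encard_image, Set.encard_univ]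
    · simp
    · intro i j h
      exact congrArg (fun F : CosetPoset ρ => F.1) h
  diamond := coset_diamond ρ
  strongly_flag_connected := coset_strongly_flag_connected ρ
  flag_transitive Φ Ψ := by
    obtain ⟨g, rfl⟩ := exists_eq_cosetFlag ρ Φ
    obtain ⟨h, rfl⟩ := exists_eq_cosetFlag ρ Ψ
    refine ⟨cosetAut ρ (h * g⁻¹), ?_⟩
    rw [coe_cosetFlag, coe_cosetFlag, ← Set.range_comp]
    congr 1
    ext j
    simp

/-! ### Sections of the coset poset -/

/-- When c is inside the interval, factor the element at c; since each factor differs from the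
product by an element of a larger parabolic subgroup, the intersection property confines each to its
half of the interval. When c is outside, the extra condition is vacuous. -/
theorem parabolic_Ioo_inf_parabolic_ne (lo hi c : ℕ) :
    parabolic ρ (Set.Ioo lo hi) ⊓ parabolic ρ {k | k ≠ c} ≤
      parabolic ρ {k | k ∈ Set.Ioo lo hi ∧ k ≠ c} := by
  rintro x ⟨hx1, hx2⟩
  by_cases hc : lo < c ∧ c < hi
  · obtain ⟨a, ha, b, hb, -, rfl⟩ := exists_mul_of_mem_parabolic_ne ρ hx2
    have hx1' : a * b ∈ parabolic ρ (Set.Iio hi) := parabolic_mono ρ (fun k _ _ hk => hk.2) hx1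
    have hx1'' : a * b ∈ parabolic ρ (Set.Ioi lo) := parabolic_mono ρ (fun k _ _ hk => hk.1) hx1
    have hb' : b ∈ parabolic ρ (Set.Ioo c hi) := by
      apply hρ.inter
      refine Subgroup.mem_inf.2 ⟨?_, hb⟩
      have : a ∈ parabolic ρ (Set.Iio hi) := parabolic_mono ρ (fun k _ _ hk => lt_trans hk hc.2) ha
      exact (Subgroup.mul_mem_cancel_left _ this).1 hx1'
    have ha' : a ∈ parabolic ρ (Set.Ioo lo c) := by
      apply hρ.inter
      refine Subgroup.mem_inf.2 ⟨ha, ?_⟩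
      have : b ∈ parabolic ρ (Set.Ioi lo) := parabolic_mono ρ (fun k _ _ hk => lt_trans hc.1 hk) hb
      exact (Subgroup.mul_mem_cancel_right _ this).1 hx1''
    refine mul_mem (parabolic_mono ρ ?_ ha') (parabolic_mono ρ ?_ hb')
    all_goals
      intro k _ _ hk
      simp only [Set.mem_Ioo, Set.mem_ofPred_eq] at *
      omega
  · refine parabolic_mono ρ ?_ hx1
    intro k _ _ hk
    simp only [Set.mem_Ioo, Set.mem_ofPred_eq] at *
    omega

end

/-- The offset o is 0 for facets and 1 for vertex-figures; it keeps track of the change of index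
between a section and the whole polytope. -/
theorem map_parabolic_shift {Γ A : Type*} [Group Γ] [Group A] {n m o : ℕ} (ρ : Fin n → Γ)
    (hm : o + m ≤ n) (α : Fin m → A) (φ : A →* Γ)
    (hφ : ∀ i : Fin m, φ (α i) = ρ ⟨i + o, by omega⟩) (S : Set ℕ) :
    (parabolic α S).map φ = parabolic ρ {k | k ∈ Set.Ioo o (o + m + 1) ∧ k - o ∈ S} := by
  rw [map_parabolic]
  unfold parabolic
  congr 1
  ext g
  constructor
  · rintro ⟨i, hi, rfl⟩
    refine ⟨⟨i + o, by omega⟩, ⟨?_, ?_⟩, (hφ i).symm⟩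
    · simp only [Set.mem_Ioo]; omega
    · change (i : ℕ) + o + 1 - o ∈ S
      rwa [show (i : ℕ) + o + 1 - o = i + 1 by omega]
  · rintro ⟨i, ⟨hi1, hi2⟩, rfl⟩
    simp only [Set.mem_Ioo] at hi1
    refine ⟨⟨i - o, by omega⟩, ?_, ?_⟩
    · change (i : ℕ) - o + 1 ∈ S
      rwa [show (i : ℕ) - o + 1 = i + 1 - o by omega]
    · change φ (α _) = _
      rw [hφ]
      congr 1
      apply Fin.ext
      change (i : ℕ) - o + o = i
      omega

/-- The stabilizer of both ends of the section factors as the subgroup of the generators strictly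
between, which is the image of A, times a commuting subgroup that fixes every base face of the
section. Only the first factor acts on the section. -/
theorem nonempty_orderIso_section {Γ A : Type*} [Group Γ] [Group A] {n m o : ℕ} (ρ : Fin n → Γ)
    [hρ : IsStringCGroup ρ] (hm : o + m ≤ n) (α : Fin m → A) (φ : A →* Γ)
    (hφ : ∀ i : Fin m, φ (α i) = ρ ⟨i + o, by omega⟩) (hinj : Function.Injective φ)
    (hα : Subgroup.closure (Set.range α) = ⊤) :
    Nonempty (CosetPoset α ≃o Set.Icc (cosetFace ρ ⟨o, by omega⟩ 1)
      (cosetFace ρ ⟨o + m + 1, by omega⟩ 1)) := by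
  have hrange : ∀ x, x ∈ parabolic ρ (Set.Ioo o (o + m + 1)) → ∃ a, φ a = x := by
    intro x hx
    have := map_parabolic_shift ρ hm α φ hφ Set.univ
    have hx' : x ∈ (parabolic α Set.univ).map φ := by
      rw [this]
      refine parabolic_mono ρ ?_ hx
      intro k _ _ hk
      exact ⟨hk, trivial⟩
    obtain ⟨a, -, h⟩ := hx'
    exact ⟨a, h⟩
  have hmem : ∀ a, φ a ∈ parabolic ρ (Set.Ioo o (o + m + 1)) := by
    intro a
    have ha : a ∈ parabolic α Set.univ := by
      have : (⊤ : Subgroup A) ≤ parabolic α Set.univ := by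
        rw [← hα]
        apply Subgroup.closure_mono
        rintro _ ⟨i, rfl⟩
        exact ⟨i, trivial, rfl⟩
      exact this trivial
    have := Subgroup.mem_map_of_mem φ ha
    rw [map_parabolic_shift ρ hm α φ hφ Set.univ] at this
    exact parabolic_mono ρ (fun k _ _ hk => hk.1) this
  let sh : Fin (m + 2) → Fin (n + 2) := fun j => ⟨j + o, by omega⟩
  have key : ∀ (j : Fin (m + 2)) (a b : A),
      cosetFace ρ (sh j) (φ a) = cosetFace ρ (sh j) (φ b) ↔ cosetFace α j a = cosetFace α j b := by
    intro j a b
    rw [cosetFace_eq_iff, cosetFace_eq_iff, ← map_inv, ← map_mul]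
    have e : (parabolic α {k | k ≠ (j : ℕ)}).map φ =
        parabolic ρ {k | k ∈ Set.Ioo o (o + m + 1) ∧ k ≠ ((sh j : Fin (n + 2)) : ℕ)} := by
      rw [map_parabolic_shift ρ hm α φ hφ]
      congr 1
      ext k
      simp only [Set.mem_ofPred_eq, Set.mem_Ioo, sh]
      omega
    constructor
    · intro h
      have := parabolic_Ioo_inf_parabolic_ne ρ o (o + m + 1) _
        (Subgroup.mem_inf.2 ⟨hmem (a⁻¹ * b), h⟩)
      rw [← e] at this
      obtain ⟨c, hc, hc'⟩ := this
      rwa [← hinj hc']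
    · intro h
      have := Subgroup.mem_map_of_mem φ h
      rw [e] at this
      exact parabolic_mono ρ (fun k _ _ hk => hk.2) this
  -- Adjoining the two ends to the chain forces its common representative into their stabilizer; the
  -- factor outside the interval can then be dropped.
  have common : ∀ C : Set (CosetPoset ρ), IsChain (· ≤ ·) C →
      (∀ F ∈ C, F ∈ Set.Icc (cosetFace ρ ⟨o, by omega⟩ 1) (cosetFace ρ ⟨o + m + 1, by omega⟩ 1)) →
      ∃ a, ∀ F ∈ C, F = cosetFace ρ F.1 (φ a) := by
    intro C hC hCI
    have hle : cosetFace ρ (⟨o, by omega⟩ : Fin (n + 2)) 1 ≤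
        cosetFace ρ (⟨o + m + 1, by omega⟩ : Fin (n + 2)) 1 :=
      cosetFace_le_cosetFace (Fin.le_def.2 (by simp only; omega)) 1
    obtain ⟨h, hh⟩ := exists_forall_eq_cosetFace_of_isChain ρ
      (C := insert (cosetFace ρ ⟨o, by omega⟩ 1) (insert (cosetFace ρ ⟨o + m + 1, by omega⟩ 1) C))
      ((hC.insert fun b hb _ => Or.inr (hCI b hb).2).insert fun b hb _ => Or.inl (by
        rcases hb with rfl | hb
        · exact hle
        · exact (hCI b hb).1))
    have m1 := cosetFace_eq_iff.1 (hh _ (Set.mem_insert _ _))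
    have m2 := cosetFace_eq_iff.1 (hh _ (Set.mem_insert_of_mem _ (Set.mem_insert _ _)))
    have m3 := parabolic_ne_inf_parabolic_ne ρ _ _ ⟨m1, m2⟩
    obtain ⟨p, hp, r, hr, -, e⟩ := exists_mul_of_mem_parabolic ρ
      (S := Set.Ioo o (o + m + 1)) (T := {k | k < o ∨ o + m + 1 < k}) (by
        intro k hk
        simp only [Set.mem_ofPred_eq, Set.mem_Ioo] at *
        omega) (by
        intro s hs t ht
        simp only [Set.mem_ofPred_eq, Set.mem_Ioo] at *
        omega) m3
    rw [inv_one, one_mul] at e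
    obtain ⟨a, rfl⟩ := hrange p hp
    refine ⟨a, fun F hF => ?_⟩
    have hF' := hh F (Set.mem_insert_of_mem _ (Set.mem_insert_of_mem _ hF))
    rw [e, cosetFace_mul_of_mem] at hF'
    · exact hF'
    · refine parabolic_mono ρ ?_ hr
      have h1 : o ≤ (F.1 : ℕ) := (le_def.1 (hCI F hF).1).1
      have h2 : (F.1 : ℕ) ≤ o + m + 1 := (le_def.1 (hCI F hF).2).1
      intro k _ _ hk
      simp only [Set.mem_ofPred_eq] at *
      omega
  have hone : ∀ (a : A) (j : Fin (n + 2)), (j : ℕ) = o ∨ (j : ℕ) = o + m + 1 →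
      cosetFace ρ j (φ a) = cosetFace ρ j 1 := by
    intro a j hj
    have := cosetFace_mul_of_mem (ρ := ρ) (j := j) 1 (h := φ a) ?_
    · rwa [one_mul] at this
    · refine parabolic_mono ρ ?_ (hmem a)
      intro k _ _ hk
      simp only [Set.mem_ofPred_eq, Set.mem_Ioo] at *
      omega
  have hIcc : ∀ (j : Fin (m + 2)) (a : A), cosetFace ρ (sh j) (φ a) ∈
      Set.Icc (cosetFace ρ ⟨o, by omega⟩ 1) (cosetFace ρ ⟨o + m + 1, by omega⟩ 1) := by
    intro j a
    rw [← hone a _ (Or.inl rfl), ← hone a _ (Or.inr rfl)]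
    constructor
    · exact cosetFace_le_cosetFace (Fin.le_def.2 (by simp only [sh]; omega)) _
    · exact cosetFace_le_cosetFace (Fin.le_def.2 (by simp only [sh]; omega)) _
  choose rep hrep using fun F : CosetPoset α => exists_eq_cosetFace F
  let f : CosetPoset α → Set.Icc (cosetFace ρ ⟨o, by omega⟩ 1)
      (cosetFace ρ ⟨o + m + 1, by omega⟩ 1) := fun F => ⟨_, hIcc F.1 (rep F)⟩
  have hf : ∀ j a, (f (cosetFace α j a)).1 = cosetFace ρ (sh j) (φ a) := by
    intro j a
    exact (key j _ a).2 (hrep (cosetFace α j a)).symm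
  have hle : ∀ F G, f F ≤ f G ↔ F ≤ G := by
    intro F G
    obtain ⟨a, ha⟩ := exists_eq_cosetFace F
    obtain ⟨b, hb⟩ := exists_eq_cosetFace G
    generalize F.1 = i at ha
    generalize G.1 = j at hb
    subst ha hb
    rw [← Subtype.coe_le_coe, hf, hf]
    constructor
    · intro h
      obtain ⟨c, hc⟩ := common {cosetFace ρ (sh i) (φ a), cosetFace ρ (sh j) (φ b)}
        (by
          rintro x (rfl | rfl) y (rfl | rfl) hxy
          · exact absurd rfl hxy
          · exact Or.inl h
          · exact Or.inr h
          · exact absurd rfl hxy)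
        (by
          rintro x (rfl | rfl)
          · exact hIcc _ _
          · exact hIcc _ _)
      have h1 := (key _ _ _).1 (hc _ (Set.mem_insert _ _))
      have h2 := (key _ _ _).1 (hc _ (Set.mem_insert_of_mem _ rfl))
      rw [h1, h2]
      refine cosetFace_le_cosetFace ?_ c
      have : (i : ℕ) + o ≤ j + o := (le_def.1 h).1
      exact Fin.le_def.2 (by omega)
    · intro h
      obtain ⟨h1, c, h2, h3⟩ := le_def.1 h
      rw [cosetFace_fst] at h2 h3
      rw [← (key i c a).2 h2, ← (key j c b).2 h3]
      refine cosetFace_le_cosetFace (Fin.le_def.2 ?_) _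
      exact Nat.add_le_add_right h1 o
  have hbij : Function.Bijective f := by
    constructor
    · intro F G h
      obtain ⟨h1, c, h2, h3⟩ := le_def.1 ((hle F G).1 h.le)
      have h4 := (le_def.1 ((hle G F).1 h.ge)).1
      have h5 := le_antisymm h1 h4
      rw [← h2, ← h3, h5]
    · rintro ⟨H, hH⟩
      obtain ⟨a, ha⟩ := common {H} (Set.pairwise_singleton _ _) (by rintro _ rfl; exact hH)
      have h1 : o ≤ (H.1 : ℕ) := (le_def.1 hH.1).1
      have h2 : (H.1 : ℕ) ≤ o + m + 1 := (le_def.1 hH.2).1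
      refine ⟨cosetFace α ⟨H.1 - o, by omega⟩ a, Subtype.ext ?_⟩
      rw [hf]
      refine Eq.trans ?_ (ha H rfl).symm
      congr 1
      apply Fin.ext
      change (H.1 : ℕ) - o + o = H.1
      omega
  exact ⟨{ toEquiv := Equiv.ofBijective f hbij, map_rel_iff' := hle _ _ }⟩

/-! ### Flags and automorphisms of abstract polytopes -/

theorem eq_of_encard_eq_two {X : Type*} {S : Set X} (hS : S.encard = 2) {a b c : X} (ha : a ∈ S)
    (hb : b ∈ S) (hc : c ∈ S) (hab : a ≠ b) (hac : a ≠ c) : b = c := by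
  obtain ⟨x, y, -, rfl⟩ := Set.encard_eq_two.1 hS
  simp only [Set.mem_insert_iff, Set.mem_singleton_iff] at ha hb hc
  grind

/-- The interval has exactly n + 2 elements, so counting upwards from the bottom and downwards from
the top leaves a single possibility. -/
theorem eq_sub_one_of_strictMono {n : ℕ} {g : Fin (n + 2) → ℤ} (hg : StrictMono g)
    (h : ∀ j, g j ∈ Set.Icc (-1) (n : ℤ)) (j : Fin (n + 2)) : g j = (j : ℕ) - 1 := by
  have h1 : ∀ k : ℕ, ∀ hk : k < n + 2, (k : ℤ) - 1 ≤ g ⟨k, hk⟩ := by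
    intro k
    induction k with
    | zero => intro hk; have := (h ⟨0, hk⟩).1; simpa using this
    | succ k ih =>
      intro hk
      have h1 := ih (by omega)
      have h2 := hg (show (⟨k, by omega⟩ : Fin (n + 2)) < ⟨k + 1, hk⟩ from Nat.lt_succ_self k)
      push_cast
      omega
  have h2 : ∀ k : ℕ, ∀ hk : k < n + 2, g ⟨n + 1 - k, by omega⟩ ≤ n - k := by
    intro k
    induction k with
    | zero => intro hk; have := (h ⟨n + 1, by omega⟩).2; simpa using this
    | succ k ih =>
      intro hk
      have h1 := ih (by omega)
      have h2 := hg (show (⟨n + 1 - (k + 1), by omega⟩ : Fin (n + 2)) < ⟨n + 1 - k, by omega⟩ from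
        Fin.lt_def.2 (by simp only; omega))
      have h3 : ((k + 1 : ℕ) : ℤ) = k + 1 := by push_cast; rfl
      rw [h3]
      generalize g ⟨n + 1 - (k + 1), _⟩ = y at h2 ⊢
      generalize g ⟨n + 1 - k, _⟩ = z at h1 h2
      omega
  have h3 := h1 j j.2
  have h4 := h2 (n + 1 - j) (by omega)
  have h5 : (⟨n + 1 - (n + 1 - (j : ℕ)), by omega⟩ : Fin (n + 2)) = j :=
    Fin.ext (by simp only; omega)
  rw [h5] at h4
  have := j.2
  apply le_antisymm
  · omega
  · exact h3

namespace IsPolytope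

section

variable {n : ℕ} {P : Type*} [PartialOrder P] {rk : P → ℤ}

theorem rank_mem (h : IsPolytope n rk) (F : P) : rk F ∈ Set.Icc (-1) (n : ℤ) :=
  h.rank_range ▸ Set.mem_range_self F

theorem eq_of_isChain (h : IsPolytope n rk) {C : Set P} (hC : IsChain (· ≤ ·) C) {F G : P}
    (hF : F ∈ C) (hG : G ∈ C) (e : rk F = rk G) : F = G := by
  by_contra hne
  rcases hC hF hG hne with h1 | h1
  · exact (h.rank_strictMono (lt_of_le_of_ne h1 hne)).ne e
  · exact (h.rank_strictMono (lt_of_le_of_ne h1 (Ne.symm hne))).ne e.symm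

theorem exists_mem_rank_eq (h : IsPolytope n rk) (Φ : Flag P) (j : Fin (n + 2)) :
    ∃ F ∈ Φ, rk F = (j : ℕ) - 1 := by
  have h1 : rk '' (Φ : Set P) = Set.Icc (-1) (n : ℤ) := by
    apply Set.Finite.eq_of_subset_of_encard_le' (Set.finite_Icc _ _)
    · rintro _ ⟨F, -, rfl⟩
      exact h.rank_mem F
    · rw [Set.InjOn.encard_image (fun F hF G hG e => h.eq_of_isChain Φ.chain_le hF hG e),
        h.flag_card]
      have : (Set.Icc (-1) (n : ℤ)).encard = ((Finset.Icc (-1) (n : ℤ)).card : ℕ∞) := by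
        rw [← Set.encard_coe_eq_coe_finsetCard, Finset.coe_Icc]
      rw [this, Int.card_Icc]
      have : ((n : ℤ) + 1 - -1).toNat = n + 2 := by omega
      rw [this]
      norm_cast
  have h2 : ((j : ℕ) : ℤ) - 1 ∈ Set.Icc (-1) (n : ℤ) := by
    have := j.2
    constructor <;> omega
  rw [← h1] at h2
  obtain ⟨F, hF, e⟩ := h2
  exact ⟨F, hF, e⟩

/-- The face of rank `j - 1` of a flag. -/
noncomputable def flagFace (h : IsPolytope n rk) (Φ : Flag P) (j : Fin (n + 2)) : P :=
  (h.exists_mem_rank_eq Φ j).choose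

theorem flagFace_mem (h : IsPolytope n rk) (Φ : Flag P) (j : Fin (n + 2)) :
    h.flagFace Φ j ∈ Φ := (h.exists_mem_rank_eq Φ j).choose_spec.1

theorem rank_flagFace (h : IsPolytope n rk) (Φ : Flag P) (j : Fin (n + 2)) :
    rk (h.flagFace Φ j) = (j : ℕ) - 1 := (h.exists_mem_rank_eq Φ j).choose_spec.2

theorem eq_flagFace (h : IsPolytope n rk) {Φ : Flag P} {j : Fin (n + 2)} {F : P} (hF : F ∈ Φ)
    (e : rk F = (j : ℕ) - 1) : F = h.flagFace Φ j :=
  h.eq_of_isChain Φ.chain_le hF (h.flagFace_mem Φ j) (by rw [e, h.rank_flagFace])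

theorem exists_eq_flagFace (h : IsPolytope n rk) {Φ : Flag P} {F : P} (hF : F ∈ Φ) :
    ∃ j, F = h.flagFace Φ j := by
  obtain ⟨h1, h2⟩ := h.rank_mem F
  refine ⟨⟨(rk F + 1).toNat, by omega⟩, h.eq_flagFace hF ?_⟩
  simp only
  omega

theorem range_flagFace (h : IsPolytope n rk) (Φ : Flag P) : Set.range (h.flagFace Φ) = Φ := by
  ext F
  constructor
  · rintro ⟨j, rfl⟩
    exact h.flagFace_mem Φ j
  · intro hF
    obtain ⟨j, hj⟩ := h.exists_eq_flagFace hF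
    exact ⟨j, hj.symm⟩

theorem flagFace_strictMono (h : IsPolytope n rk) (Φ : Flag P) : StrictMono (h.flagFace Φ) := by
  intro i j hij
  rcases Φ.le_or_le (h.flagFace_mem Φ i) (h.flagFace_mem Φ j) with h1 | h1
  · refine lt_of_le_of_ne h1 fun e => ?_
    have := congrArg rk e
    rw [h.rank_flagFace, h.rank_flagFace] at this
    have : (i : ℕ) < j := hij
    omega
  · have := h.rank_strictMono.monotone h1
    rw [h.rank_flagFace, h.rank_flagFace] at this
    have : (i : ℕ) < j := hij
    omega

/-- The flag with given faces. -/
def flagOfFaces (h : IsPolytope n rk) (f : Fin (n + 2) → P) (hf : Monotone f)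
    (hr : ∀ j, rk (f j) = (j : ℕ) - 1) : Flag P where
  carrier := Set.range f
  Chain' := by
    rintro _ ⟨i, rfl⟩ _ ⟨j, rfl⟩ -
    rcases le_total i j with h | h
    · exact Or.inl (hf h)
    · exact Or.inr (hf h)
  max_chain' := by
    intro s hs hsub
    refine hsub.antisymm fun F hF => ?_
    obtain ⟨h1, h2⟩ := h.rank_mem F
    refine ⟨⟨(rk F + 1).toNat, by omega⟩, h.eq_of_isChain hs (hsub ⟨_, rfl⟩) hF ?_⟩
    rw [hr]
    simp only
    omega

/-- The image of a flag has n + 2 strictly increasing ranks in an interval of n + 2 integers, so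
there is no freedom. -/
theorem rank_map (h : IsPolytope n rk) (γ : P ≃o P) (F : P) : rk (γ F) = rk F := by
  obtain ⟨Φ, hΦ⟩ := Flag.exists_mem F
  obtain ⟨j, rfl⟩ := h.exists_eq_flagFace hΦ
  rw [eq_sub_one_of_strictMono (g := fun j => rk (γ (h.flagFace Φ j))), h.rank_flagFace]
  · exact h.rank_strictMono.comp (γ.strictMono.comp (h.flagFace_strictMono Φ))
  · exact fun j => h.rank_mem _

theorem flag_preconnected (h : IsPolytope n rk) : (flagGraph P).Preconnected := by
  obtain ⟨b, hb⟩ := h.exists_least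
  obtain ⟨t, ht⟩ := h.exists_greatest
  have hc := (h.strongly_flag_connected b t (hb t)).preconnected
  let e : Set.Icc b t ≃o P :=
    { toFun := Subtype.val
      invFun := fun x => ⟨x, hb x, ht x⟩
      left_inv := fun _ => rfl
      right_inv := fun _ => rfl
      map_rel_iff' := Iff.rfl }
  let f : flagGraph (Set.Icc b t) →g flagGraph P :=
    { toFun := Flag.map e
      map_rel' := by
        intro Φ Ψ hadj
        constructor
        · rw [Flag.coe_map, Flag.coe_map, ← Set.image_sdiff e.injective,
            e.injective.encard_image]
          exact hadj.1
        · rw [Flag.coe_map, Flag.coe_map, ← Set.image_sdiff e.injective,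
            e.injective.encard_image]
          exact hadj.2 }
  intro Φ Ψ
  have := (hc ((Flag.map e).symm Φ) ((Flag.map e).symm Ψ)).map f
  change (flagGraph P).Reachable (Flag.map e _) (Flag.map e _) at this
  rwa [Equiv.apply_symm_apply, Equiv.apply_symm_apply] at this

theorem flag_induction (h : IsPolytope n rk) {p : Flag P → Prop} {Φ : Flag P} (hΦ : p Φ)
    (hstep : ∀ Φ Ψ, (flagGraph P).Adj Φ Ψ → p Φ → p Ψ) (Ψ : Flag P) : p Ψ := by
  obtain ⟨w⟩ := h.flag_preconnected Φ Ψ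
  induction w with
  | nil => exact hΦ
  | cons hadj _ ih => exact ih (hstep _ _ hadj hΦ)

theorem flagFace_zero_le (h : IsPolytope n rk) (Φ : Flag P) (F : P) : h.flagFace Φ 0 ≤ F := by
  obtain ⟨b, hb⟩ := h.exists_least
  have : b = h.flagFace Φ 0 := by
    by_contra hne
    have h1 := h.rank_strictMono (lt_of_le_of_ne (hb _) hne)
    rw [h.rank_flagFace] at h1
    have h2 := (h.rank_mem b).1
    simp only [Fin.val_zero] at h1
    omega
  rw [← this]
  exact hb F

theorem le_flagFace_last (h : IsPolytope n rk) (Φ : Flag P) (F : P) :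
    F ≤ h.flagFace Φ (Fin.last _) := by
  obtain ⟨t, ht⟩ := h.exists_greatest
  have : h.flagFace Φ (Fin.last _) = t := by
    by_contra hne
    have h1 := h.rank_strictMono (lt_of_le_of_ne (ht _) hne)
    rw [h.rank_flagFace] at h1
    have h2 := (h.rank_mem t).2
    simp only [Fin.val_last] at h1
    omega
  rw [this]
  exact ht F

/-- Adjacent flags differ in a single proper face. -/
theorem exists_of_adj (h : IsPolytope n rk) {Φ Ψ : Flag P} (hadj : (flagGraph P).Adj Φ Ψ) :
    ∃ i : Fin n, (∀ j : Fin (n + 2), (j : ℕ) ≠ i + 1 → h.flagFace Ψ j = h.flagFace Φ j) ∧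
      h.flagFace Ψ i.succ.castSucc ≠ h.flagFace Φ i.succ.castSucc := by
  obtain ⟨y, hy⟩ := Set.encard_eq_one.1 hadj.2
  have hyΨ : y ∈ (Ψ : Set P) \ Φ := hy ▸ rfl
  obtain ⟨k, rfl⟩ := h.exists_eq_flagFace (Φ := Ψ) hyΨ.1
  have hj : ∀ j, j ≠ k → h.flagFace Ψ j = h.flagFace Φ j := by
    intro j hjk
    by_cases hm : h.flagFace Ψ j ∈ Φ
    · exact h.eq_flagFace hm (h.rank_flagFace Ψ j)
    · have : h.flagFace Ψ j ∈ (Ψ : Set P) \ Φ := ⟨h.flagFace_mem Ψ j, hm⟩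
      rw [hy, Set.mem_singleton_iff] at this
      exact absurd ((h.flagFace_strictMono Ψ).injective this) hjk
  have hk : h.flagFace Ψ k ≠ h.flagFace Φ k := fun e => hyΨ.2 (e ▸ h.flagFace_mem Φ k)
  have hk0 : (k : ℕ) ≠ 0 := by
    intro e
    have : k = 0 := Fin.ext e
    subst this
    exact hk (le_antisymm (h.flagFace_zero_le Ψ _) (h.flagFace_zero_le Φ _))
  have hkl : (k : ℕ) ≠ n + 1 := by
    intro e
    have : k = Fin.last _ := Fin.ext e
    subst this
    exact hk (le_antisymm (h.le_flagFace_last Φ _) (h.le_flagFace_last Ψ _))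
  have hk2 := k.2
  have hki : (⟨k - 1, by omega⟩ : Fin n).succ.castSucc = k := Fin.ext (by
    change (k : ℕ) - 1 + 1 = k; omega)
  refine ⟨⟨k - 1, by omega⟩, ?_, by rwa [hki]⟩
  intro j hjk
  apply hj
  rintro rfl
  simp only at hjk
  omega

theorem flagFace_mem_Ioo (h : IsPolytope n rk) (Φ : Flag P) (i : Fin n) :
    h.flagFace Φ i.succ.castSucc ∈
      Set.Ioo (h.flagFace Φ i.castSucc.castSucc) (h.flagFace Φ i.succ.succ) :=
  ⟨h.flagFace_strictMono Φ (Fin.lt_def.2 (Nat.lt_succ_self _)),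
    h.flagFace_strictMono Φ (Fin.lt_def.2 (Nat.lt_succ_self _))⟩

theorem encard_Ioo_flagFace (h : IsPolytope n rk) (Φ : Flag P) (i : Fin n) :
    (Set.Ioo (h.flagFace Φ i.castSucc.castSucc) (h.flagFace Φ i.succ.succ)).encard = 2 := by
  apply h.diamond
  · exact ((h.flagFace_mem_Ioo Φ i).1.trans (h.flagFace_mem_Ioo Φ i).2)
  · rw [h.rank_flagFace, h.rank_flagFace]
    simp only [Fin.val_succ, Fin.val_castSucc]
    push_cast
    ring

/-- An automorphism that fixes a flag is the identity. -/
theorem eq_one_of_fixes_flag (h : IsPolytope n rk) {γ : P ≃o P} {Φ : Flag P}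
    (hγ : ∀ j, γ (h.flagFace Φ j) = h.flagFace Φ j) : γ = 1 := by
  have key := h.flag_induction (p := fun Φ => ∀ j, γ (h.flagFace Φ j) = h.flagFace Φ j) hγ (by
    intro Φ Ψ hadj hΦ j
    obtain ⟨i, h1, h2⟩ := h.exists_of_adj hadj
    by_cases hj : (j : ℕ) = i + 1
    · have hj' : j = i.succ.castSucc := Fin.ext hj
      subst hj'
      have m1 := h.flagFace_mem_Ioo Φ i
      have m2 := h.flagFace_mem_Ioo Ψ i
      rw [h1 i.castSucc.castSucc (by simp), h1 i.succ.succ (by simp)] at m2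
      refine eq_of_encard_eq_two (h.encard_Ioo_flagFace Φ i) m1 ?_ m2 ?_ h2.symm
      · constructor
        · rw [← hΦ]; exact γ.strictMono m2.1
        · rw [← hΦ i.succ.succ]; exact γ.strictMono m2.2
      · rw [← hΦ]
        exact fun e => h2.symm (γ.injective e)
    · rw [h1 j hj, hΦ])
  ext F
  obtain ⟨Ψ, hΨ⟩ := Flag.exists_mem F
  obtain ⟨j, rfl⟩ := h.exists_eq_flagFace hΨ
  exact key Ψ j

theorem flagFace_map (h : IsPolytope n rk) (γ : P ≃o P) (Φ : Flag P) (j : Fin (n + 2)) :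
    h.flagFace (Flag.map γ Φ) j = γ (h.flagFace Φ j) := by
  symm
  apply h.eq_flagFace
  · exact ⟨_, h.flagFace_mem Φ j, rfl⟩
  · rw [h.rank_map, h.rank_flagFace]

end

end IsPolytope

/-- Distinguished generators of the automorphism group of a regular polytope. -/
theorem IsRegularPolytope.exists_generators {n : ℕ} {P : Type*} [PartialOrder P] {rk : P → ℤ}
    (h : IsRegularPolytope n rk) (Φ : Flag P) (i : Fin n) : ∃ σ : P ≃o P,
      (∀ j : Fin (n + 2), (j : ℕ) ≠ i + 1 → σ (h.flagFace Φ j) = h.flagFace Φ j) ∧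
      σ (h.flagFace Φ i.succ.castSucc) ≠ h.flagFace Φ i.succ.castSucc := by
  have h0 := h.toIsPolytope
  have hd := h0.encard_Ioo_flagFace Φ i
  have hm := h0.flagFace_mem_Ioo Φ i
  -- The diamond condition provides the second face y; exchanging it for the old one gives another
  -- flag, to which flag-transitivity is applied.
  obtain ⟨y, hy, hne⟩ : ∃ y ∈ Set.Ioo (h0.flagFace Φ i.castSucc.castSucc)
      (h0.flagFace Φ i.succ.succ), y ≠ h0.flagFace Φ i.succ.castSucc := by
    obtain ⟨a, b, hab, e⟩ := Set.encard_eq_two.1 hd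
    rw [e] at hm ⊢
    rcases hm with hm | hm
    · exact ⟨b, by simp, by rw [hm]; exact hab.symm⟩
    · rw [Set.mem_singleton_iff] at hm
      exact ⟨a, by simp, by rw [hm]; exact hab⟩
  let f := Function.update (h0.flagFace Φ) i.succ.castSucc y
  have hf1 : f i.succ.castSucc = y := Function.update_self ..
  have hf2 : ∀ j, j ≠ i.succ.castSucc → f j = h0.flagFace Φ j := fun j hj =>
    Function.update_of_ne hj ..
  have hmono : Monotone f := by
    intro a b hab
    by_cases ha : a = i.succ.castSucc
    · by_cases hb : b = i.succ.castSucc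
      · rw [ha, hb]
      · rw [ha, hf1, hf2 b hb]
        refine hy.2.le.trans ((h0.flagFace_strictMono Φ).monotone ?_)
        have h1 : (i : ℕ) + 1 ≤ b := by rw [ha] at hab; exact hab
        have h2 : (b : ℕ) ≠ i + 1 := fun e => hb (Fin.ext e)
        exact Fin.le_def.2 (by simp only [Fin.val_succ]; omega)
    · by_cases hb : b = i.succ.castSucc
      · rw [hb, hf1, hf2 a ha]
        refine ((h0.flagFace_strictMono Φ).monotone ?_).trans hy.1.le
        have h1 : (a : ℕ) ≤ i + 1 := by rw [hb] at hab; exact hab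
        have h2 : (a : ℕ) ≠ i + 1 := fun e => ha (Fin.ext e)
        exact Fin.le_def.2 (by simp only [Fin.val_castSucc]; omega)
      · rw [hf2 a ha, hf2 b hb]
        exact (h0.flagFace_strictMono Φ).monotone hab
  have hrank : ∀ j, rk (f j) = (j : ℕ) - 1 := by
    intro j
    by_cases hj : j = i.succ.castSucc
    · rw [hj, hf1]
      have h1 := h.rank_strictMono hy.1
      have h2 := h.rank_strictMono hy.2
      rw [h0.rank_flagFace] at h1 h2
      simp only [Fin.val_succ, Fin.val_castSucc] at h1 h2 ⊢
      push_cast at *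
      omega
    · rw [hf2 j hj, h0.rank_flagFace]
  obtain ⟨σ, hσ⟩ := h.flag_transitive Φ (h0.flagOfFaces f hmono hrank)
  have hσf : ∀ j, σ (h0.flagFace Φ j) = f j := by
    intro j
    have : σ (h0.flagFace Φ j) ∈ Set.range f := by
      have : σ (h0.flagFace Φ j) ∈ σ '' (Φ : Set P) := ⟨_, h0.flagFace_mem Φ j, rfl⟩
      rw [hσ] at this
      exact this
    obtain ⟨k, hk⟩ := this
    have h1 := congrArg rk hk
    rw [hrank, h0.rank_map, h0.rank_flagFace] at h1
    have : k = j := Fin.ext (by omega)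
    rw [← hk, this]
  refine ⟨σ, fun j hj => ?_, ?_⟩
  · rw [hσf, hf2]
    intro e
    exact hj (congrArg Fin.val e)
  · rw [hσf, hf1]
    exact hne

/-- A group that acts on a regular polytope through the distinguished generators gives a
covering. -/
theorem exists_isCovering {n : ℕ} {Γ : Type*} [Group Γ] (ρ : Fin n → Γ) [hρ : IsStringCGroup ρ]
    {Q : Type*} [PartialOrder Q] {rk : Q → ℤ} (h : IsPolytope n rk) (Φ : Flag Q)
    (σ : Fin n → (Q ≃o Q))
    (hσ1 : ∀ (i : Fin n) (j : Fin (n + 2)), (j : ℕ) ≠ i + 1 →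
      σ i (h.flagFace Φ j) = h.flagFace Φ j)
    (hσ2 : ∀ i : Fin n, σ i (h.flagFace Φ i.succ.castSucc) ≠ h.flagFace Φ i.succ.castSucc)
    (φ : Γ →* (Q ≃o Q)) (hφ : ∀ i, φ (ρ i) = σ i) :
    ∃ f : CosetPoset ρ → Q, IsCovering (cosetRank ρ) rk f := by
  -- This makes the map sending the coset of g at index j to the image of the base face under `φ g`
  -- independent of the representative.
  have hfix : ∀ (j : Fin (n + 2)), ∀ x ∈ parabolic ρ {k | k ≠ (j : ℕ)},
      φ x (h.flagFace Φ j) = h.flagFace Φ j := by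
    intro j x hx
    induction hx using Subgroup.closure_induction with
    | mem x hx =>
      obtain ⟨i, hi, rfl⟩ := hx
      rw [hφ]
      exact hσ1 i j (Ne.symm hi)
    | one => rw [map_one]; rfl
    | mul x y _ _ hx hy => rw [map_mul, RelIso.mul_apply, hy, hx]
    | inv x _ hx =>
      rw [map_inv]
      nth_rw 1 [← hx]
      exact (φ x).symm_apply_apply _
  choose rep hrep using fun F : CosetPoset ρ => exists_eq_cosetFace F
  let f : CosetPoset ρ → Q := fun F => φ (rep F) (h.flagFace Φ F.1)
  have hf : ∀ j g, f (cosetFace ρ j g) = φ g (h.flagFace Φ j) := by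
    intro j g
    have h1 := cosetFace_eq_iff.1 (hrep (cosetFace ρ j g)).symm
    have h2 := hfix j _ h1
    rw [map_mul, map_inv, RelIso.mul_apply] at h2
    change φ (rep (cosetFace ρ j g)) (h.flagFace Φ j) = _
    nth_rw 1 [← h2]
    exact (φ (rep (cosetFace ρ j g))).apply_symm_apply _
  have hflag : ∀ g, f '' (cosetFlag ρ g : Set (CosetPoset ρ)) = Flag.map (φ g) Φ := by
    intro g
    rw [coe_cosetFlag, ← Set.range_comp, Flag.coe_map, ← h.range_flagFace Φ, ← Set.range_comp]
    congr 1
    ext j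
    exact hf j g
  have hadj : ∀ g i, (flagGraph Q).Adj (Flag.map (φ g) Φ) (Flag.map (φ (g * ρ i)) Φ) := by
    intro g i
    have hne : Flag.map (φ g) Φ ≠ Flag.map (φ (g * ρ i)) Φ := by
      intro e
      have := congrArg (fun Ψ => h.flagFace Ψ i.succ.castSucc) e
      simp only [h.flagFace_map, map_mul, hφ, RelIso.mul_apply] at this
      exact hσ2 i ((φ g).injective this).symm
    have hj : ∀ j : Fin (n + 2), (j : ℕ) ≠ i + 1 →
        h.flagFace (Flag.map (φ (g * ρ i)) Φ) j = h.flagFace (Flag.map (φ g) Φ) j := by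
      intro j hj
      simp only [h.flagFace_map, map_mul, hφ, RelIso.mul_apply]
      rw [hσ1 i j hj]
    refine (eq_or_adj_of_sdiff_subset (x := h.flagFace (Flag.map (φ g) Φ) i.succ.castSucc)
      (y := h.flagFace (Flag.map (φ (g * ρ i)) Φ) i.succ.castSucc) ?_ ?_).resolve_left hne
    · rintro x ⟨hx1, hx2⟩
      obtain ⟨j, rfl⟩ := h.exists_eq_flagFace (Φ := Flag.map (φ g) Φ) hx1
      by_cases e : (j : ℕ) = i + 1
      · have : j = i.succ.castSucc := Fin.ext e
        rw [this]; rfl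
      · rw [← hj j e] at hx2
        exact absurd (h.flagFace_mem _ j) hx2
    · rintro x ⟨hx1, hx2⟩
      obtain ⟨j, rfl⟩ := h.exists_eq_flagFace (Φ := Flag.map (φ (g * ρ i)) Φ) hx1
      by_cases e : (j : ℕ) = i + 1
      · have : j = i.succ.castSucc := Fin.ext e
        rw [this]; rfl
      · rw [hj j e] at hx2
        exact absurd (h.flagFace_mem _ j) hx2
  -- The flag graph is connected, and by the diamond condition a flag has only one neighbour
  -- differing from it at a given rank; for the translate by `φ g` this neighbour is the translate
  -- by `φ (g * ρ i)`.
  have hsurj : ∀ Ψ : Flag Q, ∃ g, Ψ = Flag.map (φ g) Φ := by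
    refine h.flag_induction (p := fun Ψ => ∃ g, Ψ = Flag.map (φ g) Φ) (Φ := Φ) ?_ ?_
    · refine ⟨1, Flag.ext ?_⟩
      rw [map_one, Flag.coe_map]
      exact (Set.image_id _).symm
    · rintro _ Ψ hA ⟨g, rfl⟩
      obtain ⟨i, h1, h2⟩ := h.exists_of_adj hA
      refine ⟨g * ρ i, Flag.ext ?_⟩
      have key : ∀ j, h.flagFace Ψ j = h.flagFace (Flag.map (φ (g * ρ i)) Φ) j := by
        obtain ⟨i', h1', h2'⟩ := h.exists_of_adj (hadj g i)
        have hii : i' = i := by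
          by_contra hne
          apply h2'
          simp only [h.flagFace_map, map_mul, hφ, RelIso.mul_apply]
          rw [hσ1]
          intro e
          apply hne
          apply Fin.ext
          simp only [Fin.val_succ, Fin.val_castSucc] at e
          omega
        subst hii
        intro j
        by_cases hj : (j : ℕ) = i' + 1
        · have hj' : j = i'.succ.castSucc := Fin.ext hj
          subst hj'
          have m1 := h.flagFace_mem_Ioo (Flag.map (φ g) Φ) i'
          have m2 := h.flagFace_mem_Ioo Ψ i'
          have m3 := h.flagFace_mem_Ioo (Flag.map (φ (g * ρ i')) Φ) i'
          rw [h1 i'.castSucc.castSucc (by simp), h1 i'.succ.succ (by simp)] at m2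
          rw [h1' i'.castSucc.castSucc (by simp), h1' i'.succ.succ (by simp)] at m3
          exact eq_of_encard_eq_two (h.encard_Ioo_flagFace _ i') m1 m2 m3 h2.symm h2'.symm
        · rw [h1 j hj, h1' j hj]
      rw [← h.range_flagFace Ψ, ← h.range_flagFace (Flag.map (φ (g * ρ i)) Φ)]
      congr 1
      ext j
      exact key j
  refine ⟨f, ?_, ?_, ?_, ?_⟩
  · intro F G hFG
    obtain ⟨h1, g, h2, h3⟩ := le_def.1 hFG
    rw [← h2, ← h3, hf, hf]
    exact (φ g).monotone ((h.flagFace_strictMono Φ).monotone h1)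
  · intro F
    obtain ⟨Ψ, hΨ⟩ := Flag.exists_mem F
    obtain ⟨g, rfl⟩ := hsurj Ψ
    obtain ⟨j, rfl⟩ := h.exists_eq_flagFace hΨ
    exact ⟨cosetFace ρ j g, by rw [hf, h.flagFace_map]⟩
  · intro F
    obtain ⟨g, hg⟩ := exists_eq_cosetFace F
    change rk (φ (rep F) (h.flagFace Φ F.1)) = _
    rw [h.rank_map, h.rank_flagFace]
    rfl
  · intro Φ₁ Φ₂ hA
    have hP := (isRegularPolytope_coset ρ).toIsPolytope
    obtain ⟨g, rfl⟩ := exists_eq_cosetFlag ρ Φ₁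
    obtain ⟨x, rfl⟩ := exists_eq_cosetFlag ρ Φ₂
    obtain ⟨i, h1, h2⟩ := hP.exists_of_adj hA
    have hff : ∀ g j, hP.flagFace (cosetFlag ρ g) j = cosetFace ρ j g := by
      intro g j
      exact (hP.eq_flagFace (Φ := cosetFlag ρ g) ⟨j, rfl⟩ rfl).symm
    simp only [hff] at h1 h2
    -- The same uniqueness in the source: a flag adjacent to that of g at rank i is the flag of `g *
    -- ρ i`.
    have hx : ∀ j, cosetFace ρ j x = cosetFace ρ j (g * ρ i) := by
      intro j
      have hne : ∀ j : Fin (n + 2), (j : ℕ) ≠ i + 1 →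
          cosetFace ρ j (g * ρ i) = cosetFace ρ j g := fun j hj =>
        cosetFace_mul_of_mem g (mem_parabolic ρ (Ne.symm hj))
      by_cases hj : (j : ℕ) = i + 1
      · have hj' : j = i.succ.castSucc := Fin.ext hj
        subst hj'
        have m1 := hP.flagFace_mem_Ioo (cosetFlag ρ g) i
        have m2 := hP.flagFace_mem_Ioo (cosetFlag ρ x) i
        have m3 := hP.flagFace_mem_Ioo (cosetFlag ρ (g * ρ i)) i
        have hc := hP.encard_Ioo_flagFace (cosetFlag ρ g) i
        simp only [hff] at m1 m2 m3 hc
        rw [h1 i.castSucc.castSucc (by simp), h1 i.succ.succ (by simp)] at m2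
        rw [hne i.castSucc.castSucc (by simp), hne i.succ.succ (by simp)] at m3
        refine eq_of_encard_eq_two hc m1 m2 m3 h2.symm ?_
        intro e
        rw [cosetFace_eq_iff, inv_mul_cancel_left] at e
        exact notMem_parabolic_ne ρ i e
      · rw [h1 j hj, hne j hj]
    have hx' : cosetFlag ρ x = cosetFlag ρ (g * ρ i) := by
      apply Flag.ext
      rw [coe_cosetFlag, coe_cosetFlag]
      congr 1
      ext j
      exact hx j
    rw [hx']
    exact ⟨_, _, (hflag g).symm, (hflag _).symm, hadj g i⟩

/-! ### Words in the distinguished generators -/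

/-- An order isomorphism restricts to subsets that correspond to each other. -/
def restrictOrderIso {P Q : Type*} [PartialOrder P] [PartialOrder Q] (e : P ≃o Q) {S : Set P}
    {T : Set Q} (h : ∀ x, x ∈ S ↔ e x ∈ T) : S ≃o T where
  toEquiv := e.toEquiv.subtypeEquiv h
  map_rel_iff' := e.map_rel_iff

theorem exists_monoidHom_of_lift {ι A Γ : Type*} [Group A] [Group Γ] (α : ι → A) (γ : ι → Γ)
    (hα : Subgroup.closure (Set.range α) = ⊤)
    (h : ∀ w : FreeGroup ι, FreeGroup.lift α w = 1 → FreeGroup.lift γ w = 1) :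
    ∃ φ : A →* Γ, ∀ i, φ (α i) = γ i := by
  have hs : Function.Surjective (FreeGroup.lift α) := by
    rw [← MonoidHom.range_eq_top, FreeGroup.range_lift_eq_closure, hα]
  refine ⟨(FreeGroup.lift α).liftOfSurjective hs ⟨FreeGroup.lift γ, fun w hw => h w hw⟩, fun i => ?_⟩
  have := MonoidHom.liftOfRightInverse_comp_apply (FreeGroup.lift α) _
    (Function.rightInverse_surjInv hs) ⟨FreeGroup.lift γ, fun w hw => h w hw⟩ (FreeGroup.of i)
  simpa using this

/-- Transported to the coset poset, each `σ i` has the same effect on the base flag as left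
multiplication by `α i`, so by rigidity it is that multiplication on the whole section. A word that
is trivial in A therefore fixes the section pointwise. -/
theorem lift_apply_eq_of_lift_eq_one {n m o : ℕ} {Q : Type*} [PartialOrder Q] {rk : Q → ℤ}
    (h : IsPolytope n rk) (Φ : Flag Q) (ho : o + m ≤ n) {A : Type*} [Group A] (α : Fin m → A)
    [hα : IsStringCGroup α]
    (e : Set.Icc (h.flagFace Φ ⟨o, by omega⟩) (h.flagFace Φ ⟨o + m + 1, by omega⟩) ≃o CosetPoset α)
    (σ : Fin m → (Q ≃o Q))
    (hσ1 : ∀ (i : Fin m) (j : Fin (n + 2)), (j : ℕ) ≠ i + o + 1 →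
      σ i (h.flagFace Φ j) = h.flagFace Φ j)
    (hσ2 : ∀ i : Fin m, σ i (h.flagFace Φ ⟨i + o + 1, by omega⟩) ≠
      h.flagFace Φ ⟨i + o + 1, by omega⟩)
    (w : FreeGroup (Fin m)) (hw : FreeGroup.lift α w = 1) :
    ∀ x ∈ Set.Icc (h.flagFace Φ ⟨o, by omega⟩) (h.flagFace Φ ⟨o + m + 1, by omega⟩),
      FreeGroup.lift σ w x = x := by
  set S := Set.Icc (h.flagFace Φ ⟨o, by omega⟩) (h.flagFace Φ ⟨o + m + 1, by omega⟩) with hS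
  have hmono := h.flagFace_strictMono Φ
  let s : Fin (m + 2) → S := fun j => ⟨h.flagFace Φ ⟨j + o, by omega⟩,
    hmono.monotone (Fin.le_def.2 (by simp only; omega)),
    hmono.monotone (Fin.le_def.2 (by simp only; omega))⟩
  have hs : StrictMono s := by
    intro i j hij
    exact hmono (Fin.lt_def.2 (by have : (i : ℕ) < j := hij; simp only; omega))
  obtain ⟨a, ha⟩ := exists_forall_eq_cosetFace_of_isChain α (C := Set.range fun j => e (s j)) (by
    rintro _ ⟨i, rfl⟩ _ ⟨j, rfl⟩ -
    rcases le_total i j with hij | hij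
    · exact Or.inl (e.monotone (hs.monotone hij))
    · exact Or.inr (e.monotone (hs.monotone hij)))
  have hidx : ∀ j, (e (s j)).1 = j := by
    intro j
    have := eq_sub_one_of_strictMono (n := m) (g := fun j => cosetRank α (e (s j)))
      (fun i j hij => (isRegularPolytope_coset α).rank_strictMono (e.strictMono (hs hij)))
      (fun j => (isRegularPolytope_coset α).rank_mem _) j
    simp only [cosetRank] at this
    exact Fin.ext (by omega)
  -- An arbitrary isomorphism need not respect base flags; a translation corrects it.
  let e' := e.trans (cosetAut α a⁻¹)
  have he' : ∀ j, e' (s j) = cosetFace α j 1 := by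
    intro j
    have h1 := ha _ ⟨j, rfl⟩
    simp only [hidx] at h1
    change cosetAut α a⁻¹ (e (s j)) = _
    rw [h1, cosetAut_cosetFace, inv_mul_cancel]
  have hmulσ : ∀ i, ∀ x ∈ S, ∃ hx : σ i x ∈ S, ∀ hx' : x ∈ S,
      e' ⟨σ i x, hx⟩ = α i • e' ⟨x, hx'⟩ := by
    intro i
    have hlo := hσ1 i ⟨o, by omega⟩ (by simp only; omega)
    have hhi := hσ1 i ⟨o + m + 1, by omega⟩ (by simp only; omega)
    have hSS : ∀ x, x ∈ S ↔ σ i x ∈ S := by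
      intro x
      rw [hS, Set.mem_Icc, Set.mem_Icc]
      rw [← (σ i).le_iff_le (x := h.flagFace Φ _), hlo, ← (σ i).le_iff_le (y := h.flagFace Φ _), hhi]
    have hσs : ∀ j : Fin (m + 2), (j : ℕ) ≠ i + 1 → restrictOrderIso (σ i) hSS (s j) = s j := by
      intro j hj
      exact Subtype.ext (hσ1 i _ (by simp only; omega))
    have hσs' : restrictOrderIso (σ i) hSS (s i.succ.castSucc) ≠ s i.succ.castSucc := by
      intro e
      have h1 := congrArg Subtype.val e
      apply hσ2 i
      have h2 : (⟨(i.succ.castSucc : Fin (m + 2)) + o, by omega⟩ : Fin (n + 2)) =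
          ⟨i + o + 1, by omega⟩ := Fin.ext (by
        simp only [Fin.val_succ, Fin.val_castSucc]; omega)
      change σ i (h.flagFace Φ _) = h.flagFace Φ _ at h1
      rwa [h2] at h1
    let τ : CosetPoset α ≃o CosetPoset α := (e'.symm.trans (restrictOrderIso (σ i) hSS)).trans e'
    have hτ : ∀ x, τ (e' x) = e' (restrictOrderIso (σ i) hSS x) := by
      intro x
      change e' (restrictOrderIso (σ i) hSS (e'.symm (e' x))) = _
      rw [OrderIso.symm_apply_apply]
    have hP := (isRegularPolytope_coset α).toIsPolytope
    have hff : ∀ g j, hP.flagFace (cosetFlag α g) j = cosetFace α j g := by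
      intro g j
      exact (hP.eq_flagFace (Φ := cosetFlag α g) ⟨j, rfl⟩ rfl).symm
    have hτj : ∀ j, τ (cosetFace α j 1) = cosetFace α j (α i) := by
      intro j
      have hne : ∀ j : Fin (m + 2), (j : ℕ) ≠ i + 1 →
          τ (cosetFace α j 1) = cosetFace α j 1 ∧ cosetFace α j (α i) = cosetFace α j 1 := by
        intro j hj
        constructor
        · rw [← he', hτ, hσs j hj]
        · have := cosetFace_mul_of_mem (ρ := α) (j := j) 1 (mem_parabolic α (Ne.symm hj))
          rwa [one_mul] at this
      by_cases hj : (j : ℕ) = i + 1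
      · have hj' : j = i.succ.castSucc := Fin.ext hj
        subst hj'
        have m1 := hP.flagFace_mem_Ioo (cosetFlag α 1) i
        have m3 := hP.flagFace_mem_Ioo (cosetFlag α (α i)) i
        have hc := hP.encard_Ioo_flagFace (cosetFlag α 1) i
        simp only [hff] at m1 m3 hc
        rw [(hne i.castSucc.castSucc (by simp)).2, (hne i.succ.succ (by simp)).2] at m3
        refine eq_of_encard_eq_two hc m1 ?_ m3 ?_ ?_
        · constructor
          · rw [← (hne i.castSucc.castSucc (by simp)).1]
            exact τ.strictMono m1.1
          · rw [← (hne i.succ.succ (by simp)).1]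
            exact τ.strictMono m1.2
        · rw [← he', hτ]
          exact fun e => hσs' (e'.injective e).symm
        · intro e
          rw [cosetFace_eq_iff, inv_one, one_mul] at e
          exact notMem_parabolic_ne α i e
      · rw [(hne j hj).1, (hne j hj).2]
    -- Both automorphisms replace the base flag by the same neighbour, so their quotient fixes a
    -- flag and is trivial.
    have hone : τ.trans (cosetAut α (α i)⁻¹) = 1 := by
      refine hP.eq_one_of_fixes_flag (Φ := cosetFlag α 1) ?_
      intro j
      rw [hff]
      change cosetAut α (α i)⁻¹ (τ (cosetFace α j 1)) = _
      rw [hτj, cosetAut_cosetFace, inv_mul_cancel]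
    intro x hx
    refine ⟨(hSS x).1 hx, fun hx' => ?_⟩
    have h1 : cosetAut α (α i)⁻¹ (τ (e' ⟨x, hx'⟩)) = e' ⟨x, hx'⟩ :=
      DFunLike.congr_fun hone (e' ⟨x, hx'⟩)
    rw [hτ] at h1
    change (α i)⁻¹ • e' ⟨σ i x, _⟩ = _ at h1
    rw [← h1, smul_inv_smul]
  have hinv : ∀ (γ : Q ≃o Q) (c : A), (∀ x ∈ S, ∃ hx : γ x ∈ S, ∀ hx' : x ∈ S,
      e' ⟨γ x, hx⟩ = c • e' ⟨x, hx'⟩) → ∀ x ∈ S, ∃ hx : γ⁻¹ x ∈ S, ∀ hx' : x ∈ S,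
      e' ⟨γ⁻¹ x, hx⟩ = c⁻¹ • e' ⟨x, hx'⟩ := by
    intro γ c hγ x hx
    obtain ⟨y, hy⟩ := e'.surjective (c⁻¹ • e' ⟨x, hx⟩)
    obtain ⟨h1, h2⟩ := hγ y.1 y.2
    have h3 := h2 y.2
    rw [hy, smul_inv_smul] at h3
    have h4 : γ y.1 = x := congrArg Subtype.val (e'.injective h3)
    have h5 : γ⁻¹ x = y.1 := by rw [← h4]; exact γ.symm_apply_apply _
    refine ⟨h5 ▸ y.2, fun hx' => ?_⟩
    rw [← hy]
    congr 1
    exact Subtype.ext h5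
  have key : ∀ w : FreeGroup (Fin m), ∀ x ∈ S, ∃ hx : FreeGroup.lift σ w x ∈ S, ∀ hx' : x ∈ S,
      e' ⟨FreeGroup.lift σ w x, hx⟩ = FreeGroup.lift α w • e' ⟨x, hx'⟩ := by
    intro w
    induction w using FreeGroup.induction_on with
    | C1 =>
      intro x hx
      simp only [map_one, one_smul]
      exact ⟨hx, fun _ => rfl⟩
    | of i => simpa only [FreeGroup.lift_apply_of] using hmulσ i
    | inv_of i hi => simpa only [map_inv, FreeGroup.lift_apply_of] using hinv _ _ (hmulσ i)
    | mul v w hv hw =>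
      intro x hx
      obtain ⟨h1, h2⟩ := hw x hx
      obtain ⟨h3, h4⟩ := hv _ h1
      simp only [map_mul, RelIso.mul_apply, mul_smul]
      refine ⟨h3, fun hx' => ?_⟩
      rw [h4 h1, h2 hx']
  intro x hx
  obtain ⟨h1, h2⟩ := key w x hx
  have := h2 hx
  rw [hw, one_smul] at this
  exact congrArg Subtype.val (e'.injective this)

/-! ### Amalgamation of two string groups -/

/-- The relators of the amalgamation: the relations among the first `n` generators are those of `α`,
the relations among the last `n` generators are those of `β`, and the first and the last generator
commute. -/
def amalgamRels {A B : Type*} [Group A] [Group B] {n : ℕ} (α : Fin n → A) (β : Fin n → B) :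
    Set (FreeGroup (Fin (n + 1))) :=
  {w | ∃ v, FreeGroup.lift α v = 1 ∧ FreeGroup.map Fin.castSucc v = w} ∪
  {w | ∃ v, FreeGroup.lift β v = 1 ∧ FreeGroup.map Fin.succ v = w} ∪
  {FreeGroup.of 0 * FreeGroup.of (Fin.last n) * (FreeGroup.of 0)⁻¹ * (FreeGroup.of (Fin.last n))⁻¹}

/-- The generators of the amalgamation of two string groups. -/
def amalgamGen {A B : Type*} [Group A] [Group B] {n : ℕ} (α : Fin n → A) (β : Fin n → B)
    (i : Fin (n + 1)) : PresentedGroup (amalgamRels α β) := PresentedGroup.of i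

section

variable {A B : Type*} [Group A] [Group B] {n : ℕ} (α : Fin n → A) (β : Fin n → B)

theorem exists_amalgam_hom {X : Type*} [Group X] (σ : Fin (n + 1) → X)
    (h1 : ∀ v, FreeGroup.lift α v = 1 → FreeGroup.lift (fun i => σ (Fin.castSucc i)) v = 1)
    (h2 : ∀ v, FreeGroup.lift β v = 1 → FreeGroup.lift (fun i => σ (Fin.succ i)) v = 1)
    (h3 : Commute (σ 0) (σ (Fin.last n))) :
    ∃ φ : PresentedGroup (amalgamRels α β) →* X, ∀ i, φ (amalgamGen α β i) = σ i := by
  have hr : ∀ r ∈ amalgamRels α β, FreeGroup.lift σ r = 1 := by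
    have hmap : ∀ (f : Fin n → Fin (n + 1)) (v : FreeGroup (Fin n)),
        FreeGroup.lift σ (FreeGroup.map f v) = FreeGroup.lift (fun i => σ (f i)) v := by
      intro f v
      have : (FreeGroup.lift σ).comp (FreeGroup.map f) = FreeGroup.lift (fun i => σ (f i)) := by
        ext i
        simp
      exact DFunLike.congr_fun this v
    rintro r ((⟨v, hv, rfl⟩ | ⟨v, hv, rfl⟩) | rfl)
    · rw [hmap]; exact h1 v hv
    · rw [hmap]; exact h2 v hv
    · simp only [map_mul, map_inv, FreeGroup.lift_apply_of]
      rw [h3.eq]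
      group
  exact ⟨PresentedGroup.toGroup hr, fun i => PresentedGroup.toGroup.of hr⟩

theorem exists_left_amalgam_hom (hα : Subgroup.closure (Set.range α) = ⊤) :
    ∃ φ : A →* PresentedGroup (amalgamRels α β),
      ∀ i : Fin n, φ (α i) = amalgamGen α β i.castSucc := by
  apply exists_monoidHom_of_lift _ _ hα
  intro w hw
  have h1 : (FreeGroup.lift fun i : Fin n => amalgamGen α β i.castSucc) =
      (PresentedGroup.mk (amalgamRels α β)).comp (FreeGroup.map Fin.castSucc) := by
    ext i
    simp only [FreeGroup.lift_apply_of, MonoidHom.comp_apply, FreeGroup.map.of]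
    rfl
  rw [h1, MonoidHom.comp_apply]
  exact PresentedGroup.one_of_mem (Or.inl (Or.inl ⟨w, hw, rfl⟩))

theorem exists_right_amalgam_hom (hβ : Subgroup.closure (Set.range β) = ⊤) :
    ∃ φ : B →* PresentedGroup (amalgamRels α β),
      ∀ i : Fin n, φ (β i) = amalgamGen α β i.succ := by
  apply exists_monoidHom_of_lift _ _ hβ
  intro w hw
  have h1 : (FreeGroup.lift fun i : Fin n => amalgamGen α β i.succ) =
      (PresentedGroup.mk (amalgamRels α β)).comp (FreeGroup.map Fin.succ) := by
    ext i
    simp only [FreeGroup.lift_apply_of, MonoidHom.comp_apply, FreeGroup.map.of]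
    rfl
  rw [h1, MonoidHom.comp_apply]
  exact PresentedGroup.one_of_mem (Or.inl (Or.inr ⟨w, hw, rfl⟩))

theorem commute_amalgamGen : Commute (amalgamGen α β 0) (amalgamGen α β (Fin.last n)) := by
  have := PresentedGroup.one_of_mem (rels := amalgamRels α β)
    (x := FreeGroup.of 0 * FreeGroup.of (Fin.last n) * (FreeGroup.of 0)⁻¹ *
      (FreeGroup.of (Fin.last n))⁻¹) (Or.inr rfl)
  simp only [map_mul, map_inv] at this
  exact mul_inv_eq_iff_eq_mul.1 (mul_inv_eq_one.1 this)

end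

/-- A group in which `A` and `B` embed compatibly, with the smallest possible intersection, forces
the amalgamation to have the intersection property. -/
theorem amalgam_isStringCGroup {A B Δ : Type*} [Group A] [Group B] [Group Δ] {n : ℕ} (hn : 0 < n)
    (α : Fin n → A) (β : Fin n → B) [hβ : IsStringCGroup β]
    (hα : Subgroup.closure (Set.range α) = ⊤) (hα1 : ∀ i, α i * α i = 1) (hα2 : ∀ i, α i ≠ 1)
    (hα3 : ∀ i j : Fin n, (i : ℕ) + 2 ≤ j → Commute (α i) (α j))
    (hα4 : ∀ j, j ≤ n → parabolic α (Set.Iio j) ⊓ parabolic α (Set.Ioi 1) ≤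
      parabolic α (Set.Ioo 1 j))
    (δ : Fin (n + 1) → Δ) (hδ : Commute (δ 0) (δ (Fin.last n)))
    (fA : A →* Δ) (hfA : ∀ i, fA (α i) = δ i.castSucc) (hfA' : Function.Injective fA)
    (fB : B →* Δ) (hfB : ∀ i, fB (β i) = δ i.succ) (hfB' : Function.Injective fB)
    (hAB : ∀ a b, fA a = fB b → a ∈ parabolic α (Set.Ioi 1)) :
    IsStringCGroup (amalgamGen α β) ∧ IsStringCGroup α ∧
    (∃ φ : A →* PresentedGroup (amalgamRels α β), Function.Injective φ ∧
      ∀ i : Fin n, φ (α i) = amalgamGen α β i.castSucc) ∧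
    (∃ φ : B →* PresentedGroup (amalgamRels α β), Function.Injective φ ∧
      ∀ i : Fin n, φ (β i) = amalgamGen α β i.succ) := by
  have hword : ∀ {X : Type _} [Group X] (ξ : Fin n → X) (f : X →* Δ) (η : Fin n → Δ),
      (∀ i, f (ξ i) = η i) → ∀ v, FreeGroup.lift ξ v = 1 → FreeGroup.lift η v = 1 := by
    intro X _ ξ f η hf v hv
    have : FreeGroup.lift η = f.comp (FreeGroup.lift ξ) := by
      ext i
      simp [hf]
    rw [this, MonoidHom.comp_apply, hv, map_one]
  obtain ⟨π, hπ⟩ := exists_amalgam_hom α β δ (hword α fA _ hfA) (by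
    intro v hv
    have : FreeGroup.lift (fun i : Fin n => δ i.succ) = fB.comp (FreeGroup.lift β) := by
      ext i
      simp [hfB]
    rw [this, MonoidHom.comp_apply, hv, map_one]) hδ
  obtain ⟨φA, hφA⟩ := exists_left_amalgam_hom α β hα
  obtain ⟨φB, hφB⟩ := exists_right_amalgam_hom α β hβ.closure_range
  have hπA : ∀ a, π (φA a) = fA a := by
    intro a
    have ha : a ∈ Subgroup.closure (Set.range α) := hα ▸ trivial
    have : Set.EqOn (π.comp φA) fA (Subgroup.closure (Set.range α)) := by
      apply MonoidHom.eqOn_closure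
      rintro _ ⟨i, rfl⟩
      rw [MonoidHom.comp_apply, hφA, hπ, hfA]
    exact this ha
  have hπB : ∀ b, π (φB b) = fB b := by
    intro b
    have hb : b ∈ Subgroup.closure (Set.range β) := hβ.closure_range ▸ trivial
    have : Set.EqOn (π.comp φB) fB (Subgroup.closure (Set.range β)) := by
      apply MonoidHom.eqOn_closure
      rintro _ ⟨i, rfl⟩
      rw [MonoidHom.comp_apply, hφB, hπ, hfB]
    exact this hb
  have hAinj : Function.Injective φA := by
    intro a b h
    apply hfA'
    rw [← hπA, ← hπA, h]
  have hBinj : Function.Injective φB := by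
    intro a b h
    apply hfB'
    rw [← hπB, ← hπB, h]
  have shA := map_parabolic_shift (o := 0) (amalgamGen α β) (by omega) α φA (fun i => hφA i)
  have shB := map_parabolic_shift (o := 1) (amalgamGen α β) (by omega) β φB (fun i => hφB i)
  -- If i = 0 or j > n + 1, one of the two subgroups already lies in the target. Otherwise the first
  -- comes from A and the second from B.
  have hinter : ∀ i j : ℕ, parabolic (amalgamGen α β) (Set.Iio j) ⊓
      parabolic (amalgamGen α β) (Set.Ioi i) ≤ parabolic (amalgamGen α β) (Set.Ioo i j) := by
    rintro i j x ⟨hx1, hx2⟩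
    rcases Nat.eq_zero_or_pos i with rfl | hi
    · refine parabolic_mono _ ?_ hx1
      intro k hk _ hkj
      exact ⟨hk, hkj⟩
    rcases Nat.lt_or_ge (n + 1) j with hj | hj
    · refine parabolic_mono _ ?_ hx2
      intro k _ hk hki
      exact ⟨hki, lt_of_le_of_lt hk hj⟩
    have h1 : x ∈ (parabolic α (Set.Iio j)).map φA := by
      rw [shA]
      refine parabolic_mono _ ?_ hx1
      intro k hk _ hkj
      simp only [Set.mem_Iio, Set.mem_Ioo, Set.mem_ofPred_eq] at *
      omega
    have h2 : x ∈ (parabolic β (Set.Ioi (i - 1))).map φB := by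
      rw [shB]
      refine parabolic_mono _ ?_ hx2
      intro k hk _ hkj
      simp only [Set.mem_Ioi, Set.mem_Ioo, Set.mem_ofPred_eq] at *
      omega
    obtain ⟨a, ha, rfl⟩ := h1
    obtain ⟨b, hb, hab⟩ := h2
    -- The small overlap in Δ puts a in the subgroup generated by the shared generators. The weak
    -- intersection property of α then bounds its indices by j, so that it can be carried over to B,
    -- where the full intersection property is available.
    have ha1 : a ∈ parabolic α (Set.Ioi 1) := hAB a b (by rw [← hπA, ← hπB, hab])
    have ha2 : a ∈ parabolic α (Set.Ioo 1 j) := by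
      rcases Nat.lt_or_ge n j with hj' | hj'
      · refine parabolic_mono _ ?_ ha1
        intro k _ hk hki
        exact ⟨hki, by omega⟩
      · exact hα4 j hj' (Subgroup.mem_inf.2 ⟨ha, ha1⟩)
    have ha3 : φA a ∈ (parabolic β (Set.Iio (j - 1))).map φB := by
      have := Subgroup.mem_map_of_mem φA ha2
      rw [shA] at this
      rw [shB]
      refine parabolic_mono _ ?_ this
      intro k hk _ hkj
      simp only [Set.mem_Iio, Set.mem_Ioo, Set.mem_ofPred_eq] at *
      omega
    obtain ⟨b', hb', hab'⟩ := ha3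
    have hbb : b' = b := hBinj (hab'.trans hab.symm)
    subst hbb
    have h3 := hβ.inter _ _ (Subgroup.mem_inf.2 ⟨hb', hb⟩)
    have h4 := Subgroup.mem_map_of_mem φB h3
    rw [shB, hab] at h4
    refine parabolic_mono _ ?_ h4
    intro k hk _ hkj
    simp only [Set.mem_Ioo, Set.mem_ofPred_eq] at *
    omega
  have hcases : ∀ i : Fin (n + 1), (∃ k : Fin n, i = k.castSucc) ∨ (∃ k : Fin n, i = k.succ) := by
    intro i
    by_cases hi : (i : ℕ) < n
    · exact Or.inl ⟨⟨i, hi⟩, rfl⟩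
    · refine Or.inr ⟨⟨i - 1, by omega⟩, Fin.ext ?_⟩
      simp only [Fin.val_succ]
      omega
  refine ⟨⟨PresentedGroup.closure_range_of _, ?_, ?_, ?_, hinter⟩, ⟨hα, hα1, hα2, hα3, ?_⟩,
    ⟨φA, hAinj, hφA⟩, ⟨φB, hBinj, hφB⟩⟩
  · intro i
    rcases hcases i with ⟨k, rfl⟩ | ⟨k, rfl⟩
    · rw [← hφA, ← map_mul, hα1, map_one]
    · rw [← hφB, ← map_mul, hβ.mul_self, map_one]
  · intro i
    rcases hcases i with ⟨k, rfl⟩ | ⟨k, rfl⟩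
    · rw [← hφA]
      exact fun e => hα2 k (hAinj (by rw [e, map_one]))
    · rw [← hφB]
      exact fun e => hβ.ne_one k (hBinj (by rw [e, map_one]))
  · intro i j hij
    by_cases hj : (j : ℕ) < n
    · have := (hα3 ⟨i, by omega⟩ ⟨j, hj⟩ hij).map φA
      rwa [hφA, hφA] at this
    by_cases hi : (i : ℕ) = 0
    · have h1 : i = 0 := Fin.ext hi
      have h2 : j = Fin.last n := Fin.ext (by simp only [Fin.val_last]; omega)
      rw [h1, h2]
      exact commute_amalgamGen α β
    · have := (hβ.commute ⟨i - 1, by omega⟩ ⟨j - 1, by omega⟩ (by simp only; omega)).map φB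
      rw [hφB, hφB] at this
      have h1 : (⟨i - 1, by omega⟩ : Fin n).succ = i :=
        Fin.ext (by simp only [Fin.val_succ]; omega)
      have h2 : (⟨j - 1, by omega⟩ : Fin n).succ = j :=
        Fin.ext (by simp only [Fin.val_succ]; omega)
      rwa [h1, h2] at this
  -- The full intersection property of α is inherited from the amalgamation through the embedding of
  -- A. The bound is cut at n + 1 because the generators of A end there.
  · rintro i j a ⟨h1, h2⟩
    have h1' := Subgroup.mem_map_of_mem φA h1
    have h2' := Subgroup.mem_map_of_mem φA h2
    rw [shA] at h1' h2'
    have h3 : φA a ∈ parabolic (amalgamGen α β) (Set.Ioo i (min j (n + 1))) := by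
      apply hinter
      refine Subgroup.mem_inf.2 ⟨parabolic_mono _ ?_ h1', parabolic_mono _ ?_ h2'⟩
      · intro k hk _ hkj
        simp only [Set.mem_Iio, Set.mem_Ioo, Set.mem_ofPred_eq] at *
        omega
      · intro k hk _ hkj
        simp only [Set.mem_Ioi, Set.mem_Ioo, Set.mem_ofPred_eq] at *
        omega
    have h4 : φA a ∈ (parabolic α (Set.Ioo i j)).map φA := by
      rw [shA]
      refine parabolic_mono _ ?_ h3
      intro k hk _ hkj
      simp only [Set.mem_Ioo, Set.mem_ofPred_eq] at *
      omega
    obtain ⟨a', ha', e⟩ := h4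
    rwa [← hAinj e]

/-! ### Existence of the universal polytope -/

/-- The image under `σ i` of its own face lies in a diamond whose ends and original middle face are
fixed by `σ k`; the other middle face is then fixed as well. So both products agree on the base
flag, and rigidity applies. -/
theorem IsPolytope.commute_of_generators {n : ℕ} {P : Type*} [PartialOrder P] {rk : P → ℤ}
    (h : IsPolytope n rk) (Φ : Flag P) (σ : Fin n → (P ≃o P))
    (hσ1 : ∀ (i : Fin n) (j : Fin (n + 2)), (j : ℕ) ≠ i + 1 →
      σ i (h.flagFace Φ j) = h.flagFace Φ j)
    {i k : Fin n} (hik : (i : ℕ) + 2 ≤ k) : Commute (σ i) (σ k) := by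
  have hfix : ∀ (i k : Fin n), (i : ℕ) + 2 ≤ k ∨ (k : ℕ) + 2 ≤ i →
      σ k (σ i (h.flagFace Φ i.succ.castSucc)) = σ i (h.flagFace Φ i.succ.castSucc) := by
    intro i k hik
    have m0 := h.flagFace_mem_Ioo Φ i
    have e1 : σ i (h.flagFace Φ i.castSucc.castSucc) = h.flagFace Φ i.castSucc.castSucc :=
      hσ1 _ _ (by simp)
    have e2 : σ i (h.flagFace Φ i.succ.succ) = h.flagFace Φ i.succ.succ := hσ1 _ _ (by simp)
    have e3 : σ k (h.flagFace Φ i.castSucc.castSucc) = h.flagFace Φ i.castSucc.castSucc :=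
      hσ1 _ _ (by simp only [Fin.val_castSucc]; omega)
    have e4 : σ k (h.flagFace Φ i.succ.succ) = h.flagFace Φ i.succ.succ :=
      hσ1 _ _ (by simp only [Fin.val_succ]; omega)
    have e5 : σ k (h.flagFace Φ i.succ.castSucc) = h.flagFace Φ i.succ.castSucc :=
      hσ1 _ _ (by simp only [Fin.val_succ, Fin.val_castSucc]; omega)
    have m1 : σ i (h.flagFace Φ i.succ.castSucc) ∈ Set.Ioo (h.flagFace Φ i.castSucc.castSucc)
        (h.flagFace Φ i.succ.succ) := by
      constructor
      · rw [← e1]; exact (σ i).strictMono m0.1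
      · rw [← e2]; exact (σ i).strictMono m0.2
    by_cases hne : σ i (h.flagFace Φ i.succ.castSucc) = h.flagFace Φ i.succ.castSucc
    · rw [hne, e5]
    refine eq_of_encard_eq_two (h.encard_Ioo_flagFace Φ i) m0 ?_ m1 ?_ (Ne.symm hne)
    · constructor
      · rw [← e3]; exact (σ k).strictMono m1.1
      · rw [← e4]; exact (σ k).strictMono m1.2
    · exact fun e => hne ((σ k).injective (e5.trans e)).symm
  have key : (σ k * σ i)⁻¹ * (σ i * σ k) = 1 := by
    refine h.eq_one_of_fixes_flag (Φ := Φ) ?_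
    intro j
    have hc : σ i (σ k (h.flagFace Φ j)) = σ k (σ i (h.flagFace Φ j)) := by
      by_cases hi : (j : ℕ) = i + 1
      · have hj : j = i.succ.castSucc := Fin.ext hi
        subst hj
        rw [hfix i k (Or.inl hik), hσ1 k]
        simp only [Fin.val_succ, Fin.val_castSucc]; omega
      · by_cases hk : (j : ℕ) = k + 1
        · have hj : j = k.succ.castSucc := Fin.ext hk
          subst hj
          rw [hfix k i (Or.inr hik), hσ1 i]
          simp only [Fin.val_succ, Fin.val_castSucc]; omega
        · rw [hσ1 k j hk, hσ1 i j hi, hσ1 k j hk]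
    rw [RelIso.mul_apply, RelIso.mul_apply, hc]
    exact (σ k * σ i).symm_apply_apply _
  exact (inv_mul_eq_one.1 key).symm

/-- The universal polytope `{K, M}` exists if the groups `A` of `K` and `B` of `M` embed compatibly
into some group, with the smallest possible intersection. -/
theorem universalExists_of_amalgam {A B : Type} {Δ : Type*} [Group A] [Group B] [Group Δ] {n : ℕ}
    (hn : 2 ≤ n) (α : Fin n → A) (β : Fin n → B) [hβ : IsStringCGroup β]
    {K M : Type*} [LE K] [LE M] (eK : K ≃o CosetPoset α) (eM : M ≃o CosetPoset β)
    (hα : Subgroup.closure (Set.range α) = ⊤) (hα1 : ∀ i, α i * α i = 1) (hα2 : ∀ i, α i ≠ 1)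
    (hα3 : ∀ i j : Fin n, (i : ℕ) + 2 ≤ j → Commute (α i) (α j))
    (hα4 : ∀ j, j ≤ n → parabolic α (Set.Iio j) ⊓ parabolic α (Set.Ioi 1) ≤
      parabolic α (Set.Ioo 1 j))
    (δ : Fin (n + 1) → Δ) (hδ : Commute (δ 0) (δ (Fin.last n)))
    (fA : A →* Δ) (hfA : ∀ i, fA (α i) = δ i.castSucc) (hfA' : Function.Injective fA)
    (fB : B →* Δ) (hfB : ∀ i, fB (β i) = δ i.succ) (hfB' : Function.Injective fB)
    (hAB : ∀ a b, fA a = fB b → a ∈ parabolic α (Set.Ioi 1)) :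
    UniversalExists.{u} n K M := by
  obtain ⟨hΓ, hA, ⟨φA, hφA, hφA'⟩, ⟨φB, hφB, hφB'⟩⟩ := amalgam_isStringCGroup (by omega) α β hα hα1
    hα2 hα3 hα4 δ hδ fA hfA hfA' fB hfB hfB' hAB
  set ρ := amalgamGen α β with hρdef
  have hP := isRegularPolytope_coset ρ
  refine ⟨CosetPoset ρ, inferInstance, cosetRank ρ, ⟨⟨hP, ?_, ?_⟩, ?_⟩⟩
  · intro F hF
    obtain ⟨g, hg⟩ := exists_eq_cosetFace F
    have hF1 : F.1 = ⟨0 + n + 1, by omega⟩ := Fin.ext (by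
      simp only [cosetRank] at hF; simp only; omega)
    rw [hF1] at hg
    obtain ⟨e⟩ := nonempty_orderIso_section (o := 0) ρ (by omega) α φA (fun i => hφA' i) hφA hα
    refine ⟨(restrictOrderIso (cosetAut ρ g⁻¹) (T := Set.Icc (cosetFace ρ ⟨0, by omega⟩ 1)
      (cosetFace ρ ⟨0 + n + 1, by omega⟩ 1)) ?_).trans (e.symm.trans eK.symm)⟩
    intro x
    have h1 : cosetFace ρ (⟨0 + n + 1, by omega⟩ : Fin (n + 1 + 2)) 1 = cosetAut ρ g⁻¹ F := by
      rw [hg, cosetAut_cosetFace, inv_mul_cancel]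
    rw [h1, Set.mem_Iic, Set.mem_Icc, (cosetAut ρ g⁻¹).le_iff_le]
    exact ⟨fun h => ⟨bot_cosetFace_le ρ _ 1, h⟩, fun h => h.2⟩
  · intro F hF
    obtain ⟨g, hg⟩ := exists_eq_cosetFace F
    have hF1 : F.1 = ⟨1, by omega⟩ := Fin.ext (by
      simp only [cosetRank] at hF; simp only; omega)
    rw [hF1] at hg
    obtain ⟨e⟩ := nonempty_orderIso_section (o := 1) ρ (by omega) β φB (fun i => hφB' i) hφB
      hβ.closure_range
    refine ⟨(restrictOrderIso (cosetAut ρ g⁻¹) (T := Set.Icc (cosetFace ρ ⟨1, by omega⟩ 1)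
      (cosetFace ρ ⟨1 + n + 1, by omega⟩ 1)) ?_).trans (e.symm.trans eM.symm)⟩
    intro x
    have h1 : cosetFace ρ (⟨1, by omega⟩ : Fin (n + 1 + 2)) 1 = cosetAut ρ g⁻¹ F := by
      rw [hg, cosetAut_cosetFace, inv_mul_cancel]
    have h2 : (⟨1 + n + 1, by omega⟩ : Fin (n + 1 + 2)) = Fin.last _ :=
      Fin.ext (by simp only [Fin.val_last]; omega)
    rw [h1, h2, Set.mem_Ici, Set.mem_Icc, (cosetAut ρ g⁻¹).le_iff_le]
    exact ⟨fun h => ⟨h, le_top_cosetFace ρ _ 1⟩, fun h => h.1⟩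
  · intro Q _ rkQ hQ
    have h := hQ.regular.toIsPolytope
    obtain ⟨Φ⟩ : Nonempty (Flag Q) := inferInstance
    choose σ hσ1 hσ2 using hQ.regular.exists_generators Φ
    -- A relation of α fixes the base facet pointwise, and the greatest face is fixed by every
    -- automorphism; the whole base flag is fixed, hence the relation holds among the `σ i`. The
    -- vertex-figure is dual, with the least face.
    have hfacet : ∀ v, FreeGroup.lift α v = 1 →
        FreeGroup.lift (fun i : Fin n => σ i.castSucc) v = 1 := by
      intro v hv
      obtain ⟨e⟩ := hQ.facet (h.flagFace Φ ⟨0 + n + 1, by omega⟩) (by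
        rw [h.rank_flagFace]; simp)
      have hset : Set.Icc (h.flagFace Φ ⟨0, by omega⟩) (h.flagFace Φ ⟨0 + n + 1, by omega⟩) =
          Set.Iic (h.flagFace Φ ⟨0 + n + 1, by omega⟩) := by
        ext x
        exact ⟨fun hx => hx.2, fun hx => ⟨h.flagFace_zero_le Φ x, hx⟩⟩
      have key := lift_apply_eq_of_lift_eq_one (o := 0) h Φ (by omega) α
        ((OrderIso.setCongr _ _ hset).trans (e.trans eK)) (fun i : Fin n => σ i.castSucc)
        (fun i j hj => hσ1 _ _ hj) (fun i => hσ2 i.castSucc) v hv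
      refine h.eq_one_of_fixes_flag (Φ := Φ) ?_
      intro j
      by_cases hj : (j : ℕ) ≤ n + 1
      · apply key
        rw [hset]
        exact (h.flagFace_strictMono Φ).monotone (Fin.le_def.2 (by simp only; omega))
      · have : j = Fin.last _ := Fin.ext (by simp only [Fin.val_last]; omega)
        subst this
        apply le_antisymm (h.le_flagFace_last Φ _)
        have := (FreeGroup.lift (fun i : Fin n => σ i.castSucc) v).monotone
          (h.le_flagFace_last Φ ((FreeGroup.lift (fun i : Fin n => σ i.castSucc) v).symm
            (h.flagFace Φ (Fin.last _))))
        rwa [OrderIso.apply_symm_apply] at this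
    have hvertex : ∀ v, FreeGroup.lift β v = 1 →
        FreeGroup.lift (fun i : Fin n => σ i.succ) v = 1 := by
      intro v hv
      obtain ⟨e⟩ := hQ.vertex_figure (h.flagFace Φ ⟨1, by omega⟩) (by
        rw [h.rank_flagFace]; simp)
      have hlast : (⟨1 + n + 1, by omega⟩ : Fin (n + 1 + 2)) = Fin.last _ :=
        Fin.ext (by simp only [Fin.val_last]; omega)
      have hset : Set.Icc (h.flagFace Φ ⟨1, by omega⟩) (h.flagFace Φ ⟨1 + n + 1, by omega⟩) =
          Set.Ici (h.flagFace Φ ⟨1, by omega⟩) := by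
        ext x
        rw [hlast]
        exact ⟨fun hx => hx.1, fun hx => ⟨hx, h.le_flagFace_last Φ x⟩⟩
      have key := lift_apply_eq_of_lift_eq_one (o := 1) h Φ (by omega) β
        ((OrderIso.setCongr _ _ hset).trans (e.trans eM)) (fun i : Fin n => σ i.succ)
        (fun i j hj => hσ1 _ _ hj) (fun i => hσ2 i.succ) v hv
      refine h.eq_one_of_fixes_flag (Φ := Φ) ?_
      intro j
      by_cases hj : 1 ≤ (j : ℕ)
      · apply key
        rw [hset]
        exact (h.flagFace_strictMono Φ).monotone (Fin.le_def.2 (by simp only; omega))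
      · have : j = 0 := Fin.ext (by simp only [Fin.val_zero]; omega)
        subst this
        refine le_antisymm ?_ (h.flagFace_zero_le Φ _)
        have := (FreeGroup.lift (fun i : Fin n => σ i.succ) v).monotone
          (h.flagFace_zero_le Φ ((FreeGroup.lift (fun i : Fin n => σ i.succ) v).symm
            (h.flagFace Φ 0)))
        rwa [OrderIso.apply_symm_apply] at this
    obtain ⟨φ, hφ⟩ := exists_amalgam_hom α β σ hfacet hvertex
      (h.commute_of_generators Φ σ hσ1 (by simp only [Fin.val_zero, Fin.val_last]; omega))
    exact exists_isCovering ρ h Φ σ hσ1 hσ2 φ hφ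

/-! ### Finite reflection groups -/

theorem hyperplaneReflection_apply {n : ℕ} (a : Fin n → ℝ) (c : ℝ) (x : Fin n → ℝ) :
    hyperplaneReflection a c x = x - (2 * (a ⬝ᵥ x - c) / (a ⬝ᵥ a)) • a := rfl

theorem hyperplaneReflection_mul_self {n : ℕ} (a : Fin n → ℝ) (c : ℝ) :
    hyperplaneReflection a c * hyperplaneReflection a c = 1 := by
  ext x : 1
  exact Function.Involutive.toPerm_involutive _ x

/-- A permutation of `ℝⁿ` is a linear isometry. -/
structure IsLinearIsometry {n : ℕ} (g : Equiv.Perm (Fin n → ℝ)) : Prop where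
  map_add_smul : ∀ x y (c : ℝ), g (x + c • y) = g x + c • g y
  map_dotProduct : ∀ x y, g x ⬝ᵥ g y = x ⬝ᵥ y

namespace IsLinearIsometry

variable {n : ℕ} {g h : Equiv.Perm (Fin n → ℝ)}

theorem one : IsLinearIsometry (1 : Equiv.Perm (Fin n → ℝ)) := ⟨fun _ _ _ => rfl, fun _ _ => rfl⟩

theorem mul (hg : IsLinearIsometry g) (hh : IsLinearIsometry h) : IsLinearIsometry (g * h) :=
  ⟨fun x y c => by simp only [Equiv.Perm.mul_apply, hh.map_add_smul, hg.map_add_smul],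
    fun x y => by simp only [Equiv.Perm.mul_apply, hh.map_dotProduct, hg.map_dotProduct]⟩

theorem inv (hg : IsLinearIsometry g) : IsLinearIsometry g⁻¹ := by
  constructor
  · intro x y c
    apply g.injective
    rw [hg.map_add_smul]
    simp
  · intro x y
    rw [← hg.map_dotProduct]
    simp

theorem map_zero (hg : IsLinearIsometry g) : g 0 = 0 := by
  have := hg.map_add_smul 0 0 1
  simpa using this

theorem map_smul (hg : IsLinearIsometry g) (c : ℝ) (x : Fin n → ℝ) : g (c • x) = c • g x := by
  have := hg.map_add_smul 0 x c
  simpa [hg.map_zero] using this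

theorem map_neg (hg : IsLinearIsometry g) (x : Fin n → ℝ) : g (-x) = -g x := by
  have := hg.map_smul (-1) x
  simpa using this

theorem map_sub_smul (hg : IsLinearIsometry g) (x y : Fin n → ℝ) (c : ℝ) :
    g (x - c • y) = g x - c • g y := by
  have := hg.map_add_smul x y (-c)
  simpa [sub_eq_add_neg] using this

theorem hyperplaneReflection (a : Fin n → ℝ) :
    IsLinearIsometry (hyperplaneReflection a 0) := by
  constructor
  · intro x y c
    simp only [hyperplaneReflection_apply, dotProduct_add, dotProduct_smul, sub_zero, smul_eq_mul]
    module
  · intro x y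
    simp only [hyperplaneReflection_apply, sub_zero]
    rcases eq_or_ne (a ⬝ᵥ a) 0 with h | h
    · simp [h]
    · simp only [sub_dotProduct, dotProduct_sub, smul_dotProduct, dotProduct_smul, smul_eq_mul,
        dotProduct_comm x a]
      field_simp
      ring

theorem of_mem_closure {S : Set (Equiv.Perm (Fin n → ℝ))} (hS : ∀ s ∈ S, IsLinearIsometry s)
    (hg : g ∈ Subgroup.closure S) : IsLinearIsometry g := by
  induction hg using Subgroup.closure_induction with
  | mem x hx => exact hS x hx
  | one => exact one
  | mul x y _ _ hx hy => exact hx.mul hy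
  | inv x _ hx => exact hx.inv

/-- Conjugating a reflection by a linear isometry. -/
theorem mul_hyperplaneReflection (hg : IsLinearIsometry g) (a : Fin n → ℝ) :
    g * AbstractPolytope.hyperplaneReflection a 0 =
      AbstractPolytope.hyperplaneReflection (g a) 0 * g := by
  ext x : 1
  simp only [Equiv.Perm.mul_apply, hyperplaneReflection_apply, hg.map_sub_smul, hg.map_dotProduct]

end IsLinearIsometry

theorem hyperplaneReflection_self {n : ℕ} {a : Fin n → ℝ} (ha : a ⬝ᵥ a ≠ 0) :
    hyperplaneReflection a 0 a = -a := by
  rw [hyperplaneReflection_apply, sub_zero, mul_div_assoc, div_self ha, mul_one, two_smul]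
  abel

theorem hyperplaneReflection_eq_self {n : ℕ} {a x : Fin n → ℝ} (h : a ⬝ᵥ x = 0) :
    hyperplaneReflection a 0 x = x := by
  rw [hyperplaneReflection_apply, h]
  simp

theorem hyperplaneReflection_ne_one {n : ℕ} {a : Fin n → ℝ} (ha : a ⬝ᵥ a ≠ 0) :
    hyperplaneReflection a 0 ≠ 1 := by
  intro h
  have h1 : hyperplaneReflection a 0 a = a := by rw [h]; rfl
  rw [hyperplaneReflection_self ha, neg_eq_iff_add_eq_zero, ← two_smul ℝ, smul_eq_zero] at h1
  rcases h1 with h1 | h1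
  · norm_num at h1
  · simp [h1] at ha

theorem commute_hyperplaneReflection {n : ℕ} {a b : Fin n → ℝ} (h : a ⬝ᵥ b = 0) (c d : ℝ) :
    Commute (hyperplaneReflection a c) (hyperplaneReflection b d) := by
  ext x : 1
  have h' : b ⬝ᵥ a = 0 := by rw [dotProduct_comm, h]
  simp only [Equiv.Perm.mul_apply, hyperplaneReflection_apply, dotProduct_sub, dotProduct_smul, h,
    h', smul_eq_mul, mul_zero, sub_zero]
  abel

/-- In a finite reflection group, the stabilizer of a point of the closed fundamental chamber is
generated by the reflections in the walls through that point. -/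
theorem mem_closure_of_apply_eq {n m : ℕ} (a : Fin m → Fin n → ℝ) (R : Set (Fin n → ℝ))
    (pos : (Fin n → ℝ) → Prop) (ha0 : ∀ i, a i ⬝ᵥ a i ≠ 0) (haR : ∀ i, a i ∈ R)
    (hR : ∀ i, ∀ x ∈ R, hyperplaneReflection (a i) 0 x ∈ R)
    (hapos : ∀ i, pos (a i))
    (hsimple : ∀ i, ∀ x ∈ R, pos x → x ≠ a i → pos (hyperplaneReflection (a i) 0 x))
    (p : Fin n → ℝ) (hp : ∀ x ∈ R, pos x → 0 ≤ x ⬝ᵥ p) (g : Equiv.Perm (Fin n → ℝ))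
    (hg : g ∈ Subgroup.closure (Set.range fun i => hyperplaneReflection (a i) 0)) (hgp : g p = p) :
    g ∈ Subgroup.closure {s | ∃ i, a i ⬝ᵥ p = 0 ∧ hyperplaneReflection (a i) 0 = s} := by
  let s : Fin m → Equiv.Perm (Fin n → ℝ) := fun i => hyperplaneReflection (a i) 0
  let π : List (Fin m) → Equiv.Perm (Fin n → ℝ) := fun l => (l.map s).prod
  have hπcons : ∀ i l, π (i :: l) = s i * π l := fun i l => by simp [π]
  have hπsnoc : ∀ i l, π (l ++ [i]) = π l * s i := fun i l => by simp [π]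
  have hs2 : ∀ i, s i * s i = 1 := fun i => hyperplaneReflection_mul_self _ _
  have hlin : ∀ l, IsLinearIsometry (π l) := by
    intro l
    induction l with
    | nil => exact IsLinearIsometry.one
    | cons i l ih => rw [hπcons]; exact (IsLinearIsometry.hyperplaneReflection _).mul ih
  have hπR : ∀ l, ∀ x ∈ R, π l x ∈ R := by
    intro l x hx
    induction l with
    | nil => exact hx
    | cons i l ih => rw [hπcons]; exact hR i _ ih
  -- This is the exchange condition. Apply the letters of the word to `a i` from the right until the
  -- image stops being positive; a simple reflection does this only to its own root, so just before
  -- that letter j the image is `a j`. Conjugation then turns `s i` into `s j`, which cancels the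
  -- letter.
  have hdel : ∀ l i, ¬ pos (π l (a i)) → ∃ l', l'.length < l.length ∧ π l * s i = π l' := by
    intro l i
    induction l with
    | nil => intro h; exact absurd (hapos i) h
    | cons j l ih =>
      intro h
      by_cases h1 : pos (π l (a i))
      · have h2 : π l (a i) = a j := by
          by_contra hne
          apply h
          rw [hπcons]
          exact hsimple j _ (hπR l _ (haR i)) h1 hne
        refine ⟨l, by simp, ?_⟩
        have h3 : π l * s i = s j * π l := by
          have := (hlin l).mul_hyperplaneReflection (a i)
          rw [h2] at this
          exact this
        rw [hπcons, mul_assoc, h3, ← mul_assoc, hs2, one_mul]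
      · obtain ⟨l', h2, h3⟩ := ih h1
        refine ⟨j :: l', by simpa using h2, ?_⟩
        rw [hπcons, hπcons, mul_assoc, h3]
  have hword : ∃ l, g = π l := by
    clear hgp
    induction hg using Subgroup.closure_induction_left with
    | one => exact ⟨[], rfl⟩
    | mul_left y hy x hx ih =>
      obtain ⟨i, rfl⟩ := hy
      obtain ⟨l, rfl⟩ := ih
      exact ⟨i :: l, (hπcons i l).symm⟩
    | inv_mul_cancel y hy x hx ih =>
      obtain ⟨i, rfl⟩ := hy
      obtain ⟨l, rfl⟩ := ih
      refine ⟨i :: l, ?_⟩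
      rw [hπcons]
      exact congrArg (· * π l) (inv_eq_of_mul_eq_one_left (hs2 i))
  obtain ⟨l, rfl⟩ := hword
  clear hg
  induction hl : l.length using Nat.strong_induction_on generalizing l with
  | _ N ih =>
    rcases List.eq_nil_or_concat l with rfl | ⟨l₀, i, rfl⟩
    · exact one_mem _
    rw [List.concat_eq_append] at *
    rw [List.length_append, List.length_singleton] at hl
    -- In the positive case, the inner product of the image root with p is nonnegative but equals
    -- minus that of `a i` with p. Both vanish, so the last letter fixes p and can be split off. In
    -- the other case the word can be shortened.
    by_cases h1 : pos (π l₀ (a i))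
    · rw [hπsnoc] at hgp ⊢
      have h2 := hp _ (hπR l₀ _ (haR i)) h1
      have h3 := hp _ (haR i) (hapos i)
      have h4 : π l₀ (a i) ⬝ᵥ p = - (a i ⬝ᵥ p) := by
        conv_lhs => rw [← hgp]
        rw [Equiv.Perm.mul_apply, (hlin l₀).map_dotProduct,
          ← (IsLinearIsometry.hyperplaneReflection (a i)).map_dotProduct (a i) p,
          hyperplaneReflection_self (ha0 i), neg_dotProduct, neg_neg]
      have h5 : a i ⬝ᵥ p = 0 := by linarith
      have h6 : s i p = p := hyperplaneReflection_eq_self h5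
      rw [Equiv.Perm.mul_apply, h6] at hgp
      exact mul_mem (ih l₀.length (by omega) l₀ hgp rfl) (Subgroup.subset_closure ⟨i, h5, rfl⟩)
    · obtain ⟨l', h2, h3⟩ := hdel l₀ i h1
      rw [hπsnoc, h3] at hgp ⊢
      exact ih l'.length (by omega) l' hgp rfl

/-- The image of `z` under the reflection in the hyperplane orthogonal to `a`, provided that it is
integral. -/
def intReflection {n : ℕ} (a z : Fin n → ℤ) : Fin n → ℤ :=
  z - (2 * (a ⬝ᵥ z) / (a ⬝ᵥ a)) • a

/-- The real vector with given integral coordinates. -/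
def castVec {n : ℕ} (z : Fin n → ℤ) : Fin n → ℝ := fun k => z k

theorem castVec_dotProduct {n : ℕ} (a b : Fin n → ℤ) :
    castVec a ⬝ᵥ castVec b = ((a ⬝ᵥ b : ℤ) : ℝ) := by
  simp [castVec, dotProduct]

/-- A root system in `ℤⁿ`, given by the predicate `P`, with simple roots `a`, positive system
defined by `c`, and dominant vectors `ω` dual to the simple roots. -/
structure IsRootDatum {n m : ℕ} (a : Fin m → Fin n → ℤ) (P : (Fin n → ℤ) → Prop) (c : Fin n → ℤ)
    (ω : Fin m → Fin n → ℤ) : Prop where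
  root : ∀ i, P (a i)
  root_pos : ∀ i, 0 < a i ⬝ᵥ c
  norm_pos : ∀ i, 0 < a i ⬝ᵥ a i
  dvd : ∀ z, P z → ∀ i, a i ⬝ᵥ a i ∣ 2 * (a i ⬝ᵥ z)
  closed : ∀ z, P z → ∀ i, P (intReflection (a i) z)
  simple : ∀ z, P z → 0 < z ⬝ᵥ c → ∀ i, z ≠ a i → 0 < intReflection (a i) z ⬝ᵥ c
  dominant : ∀ z, P z → 0 < z ⬝ᵥ c → ∀ i, 0 ≤ z ⬝ᵥ ω i
  dual : ∀ i j, a i ⬝ᵥ ω j = 0 ↔ i ≠ j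

theorem hyperplaneReflection_castVec {n : ℕ} {a z : Fin n → ℤ} (ha : 0 < a ⬝ᵥ a)
    (h : a ⬝ᵥ a ∣ 2 * (a ⬝ᵥ z)) {t : ℝ} (ht : 0 < t) :
    hyperplaneReflection (t • castVec a) 0 (t • castVec z) = t • castVec (intReflection a z) := by
  obtain ⟨k, hk⟩ := h
  have ha' : ((a ⬝ᵥ a : ℤ) : ℝ) ≠ 0 := by exact_mod_cast ha.ne'
  have hk' : 2 * ((a ⬝ᵥ z : ℤ) : ℝ) = ((a ⬝ᵥ a : ℤ) : ℝ) * k := by exact_mod_cast hk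
  have e : 2 * (t • castVec a ⬝ᵥ t • castVec z) / (t • castVec a ⬝ᵥ t • castVec a) = k := by
    simp only [smul_dotProduct, dotProduct_smul, smul_eq_mul, castVec_dotProduct]
    field_simp
    linarith
  rw [hyperplaneReflection_apply, sub_zero, e, intReflection, hk, Int.mul_ediv_cancel_left _ ha.ne']
  ext j
  simp only [castVec, Pi.sub_apply, Pi.smul_apply, smul_eq_mul]
  push_cast
  ring

namespace IsRootDatum

variable {n m : ℕ} {a : Fin m → Fin n → ℤ} {P : (Fin n → ℤ) → Prop} {c : Fin n → ℤ}
  {ω : Fin m → Fin n → ℤ}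

/-- The factor t allows integral data, on which all conditions are decidable, to describe mirrors
given by half-integral normal vectors. -/
theorem mem_closure (h : IsRootDatum a P c ω) {t : ℝ} (ht : 0 < t) (p : Fin n → ℝ)
    (hp : ∀ z, P z → 0 < z ⬝ᵥ c → 0 ≤ castVec z ⬝ᵥ p) (g : Equiv.Perm (Fin n → ℝ))
    (hg : g ∈ Subgroup.closure (Set.range fun i => hyperplaneReflection (t • castVec (a i)) 0))
    (hgp : g p = p) :
    g ∈ Subgroup.closure
      {s | ∃ i, castVec (a i) ⬝ᵥ p = 0 ∧ hyperplaneReflection (t • castVec (a i)) 0 = s} := by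
  have hdot : ∀ z : Fin n → ℤ, t • castVec z ⬝ᵥ castVec c = t * ((z ⬝ᵥ c : ℤ) : ℝ) := by
    intro z
    rw [smul_dotProduct, castVec_dotProduct, smul_eq_mul]
  have hdot' : ∀ z : Fin n → ℤ, 0 < t • castVec z ⬝ᵥ castVec c ↔ 0 < z ⬝ᵥ c := by
    intro z
    rw [hdot, mul_pos_iff_of_pos_left ht, Int.cast_pos]
  have := mem_closure_of_apply_eq (fun i => t • castVec (a i))
    {x | ∃ z, P z ∧ x = t • castVec z} (fun x => 0 < x ⬝ᵥ castVec c) ?_ ?_ ?_ ?_ ?_ p ?_ g hg hgp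
  · convert this using 5 with s
    ext i
    rw [smul_dotProduct, smul_eq_mul, mul_eq_zero]
    simp [ht.ne']
  · intro i
    simp only [smul_dotProduct, dotProduct_smul, smul_eq_mul, castVec_dotProduct]
    have : (0 : ℝ) < ((a i ⬝ᵥ a i : ℤ) : ℝ) := by exact_mod_cast h.norm_pos i
    positivity
  · exact fun i => ⟨a i, h.root i, rfl⟩
  · rintro i _ ⟨z, hz, rfl⟩
    exact ⟨_, h.closed z hz i, hyperplaneReflection_castVec (h.norm_pos i) (h.dvd z hz i) ht⟩
  · intro i
    simp only [hdot']
    exact h.root_pos i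
  · rintro i _ ⟨z, hz, rfl⟩ h1 h2
    simp only [hdot'] at h1
    simp only [hyperplaneReflection_castVec (h.norm_pos i) (h.dvd z hz i) ht, hdot']
    exact h.simple z hz h1 i fun e => h2 (by rw [e])
  · rintro _ ⟨z, hz, rfl⟩ h1
    simp only [hdot'] at h1
    rw [smul_dotProduct]
    exact mul_nonneg ht.le (hp z hz h1)

/-- Let p be the sum of the dominant vectors whose indices are missing from S ∩ T. An element of
both subgroups fixes each summand, hence p. Since the summands are dominant, the walls through p are
exactly those with index in S ∩ T, and the stabilizer theorem finishes. -/
theorem parabolic_inf (h : IsRootDatum a P c ω) {t : ℝ} (ht : 0 < t) (S T : Set ℕ) :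
    parabolic (fun i => hyperplaneReflection (t • castVec (a i)) 0) S ⊓
      parabolic (fun i => hyperplaneReflection (t • castVec (a i)) 0) T ≤
      parabolic (fun i => hyperplaneReflection (t • castVec (a i)) 0) (S ∩ T) := by
  classical
  have hfix : ∀ (S : Set ℕ) (g : Equiv.Perm (Fin n → ℝ)),
      g ∈ parabolic (fun i => hyperplaneReflection (t • castVec (a i)) 0) S →
      ∀ i : Fin m, (i : ℕ) + 1 ∉ S → g (castVec (ω i)) = castVec (ω i) := by
    intro S g hg i hi
    induction hg using Subgroup.closure_induction with
    | mem x hx =>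
      obtain ⟨j, hj, rfl⟩ := hx
      apply hyperplaneReflection_eq_self
      rw [smul_dotProduct, castVec_dotProduct, (h.dual j i).2 (by rintro rfl; exact hi hj)]
      simp
    | one => rfl
    | mul x y _ _ hx hy => rw [Equiv.Perm.mul_apply, hy, hx]
    | inv x _ hx => rw [Equiv.Perm.inv_eq_iff_eq, hx]
  rintro g ⟨hgS, hgT⟩
  have hgS' := hfix S g hgS
  have hgT' := hfix T g hgT
  have hlin : IsLinearIsometry g := by
    refine IsLinearIsometry.of_mem_closure ?_ hgS
    rintro _ ⟨i, -, rfl⟩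
    exact IsLinearIsometry.hyperplaneReflection _
  let I : Finset (Fin m) := Finset.univ.filter fun i : Fin m => (i : ℕ) + 1 ∉ S ∩ T
  let p : Fin n → ℝ := ∑ i ∈ I, castVec (ω i)
  have hgp : g p = p := by
    have key : ∀ s : Finset (Fin m), (∀ i ∈ s, (i : ℕ) + 1 ∉ S ∩ T) →
        g (∑ i ∈ s, castVec (ω i)) = ∑ i ∈ s, castVec (ω i) := by
      intro s
      induction s using Finset.induction_on with
      | empty => intro _; simpa using hlin.map_zero
      | insert i s hi ih =>
        intro hs
        rw [Finset.sum_insert hi]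
        have h1 := hlin.map_add_smul (castVec (ω i)) (∑ i ∈ s, castVec (ω i)) 1
        rw [one_smul, one_smul, ih fun j hj => hs j (Finset.mem_insert_of_mem hj)] at h1
        rw [h1]
        congr 1
        have h2 := hs i (Finset.mem_insert_self i s)
        by_cases h3 : (i : ℕ) + 1 ∈ S
        · exact hgT' i fun h4 => h2 ⟨h3, h4⟩
        · exact hgS' i h3
    exact key _ fun i hi => (Finset.mem_filter.1 hi).2
  have hdotp : ∀ z : Fin n → ℤ, castVec z ⬝ᵥ p =
      ∑ i ∈ I, ((z ⬝ᵥ ω i : ℤ) : ℝ) := by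
    intro z
    simp only [p, dotProduct_sum, castVec_dotProduct]
  refine Subgroup.closure_mono ?_ (h.mem_closure ht p ?_ g (Subgroup.closure_mono ?_ hgS) hgp)
  · rintro s ⟨i, hi, rfl⟩
    refine ⟨i, ?_, rfl⟩
    by_contra hiST
    rw [hdotp] at hi
    have h1 := (Finset.sum_eq_zero_iff_of_nonneg (fun j _ => by
      exact_mod_cast h.dominant _ (h.root i) (h.root_pos i) j)).1 hi i (by simpa [I] using hiST)
    exact ((h.dual i i).1 (by exact_mod_cast h1)) rfl
  · intro z hz hzc
    rw [hdotp]
    exact Finset.sum_nonneg fun j _ => by exact_mod_cast h.dominant z hz hzc j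
  · rintro _ ⟨i, -, rfl⟩
    exact ⟨i, rfl⟩

end IsRootDatum

/-! ### The symmetry group of the cube -/

/-- The simple roots of the symmetry group of the `5`-cube. -/
def cubeRoot : Fin 5 → Fin 5 → ℤ :=
  ![![1, 0, 0, 0, 0], ![-1, 1, 0, 0, 0], ![0, -1, 1, 0, 0], ![0, 0, -1, 1, 0], ![0, 0, 0, -1, 1]]

/-- The dominant vectors dual to the simple roots: the centres of the faces of the base flag of the
`5`-cube with vertices `(±1, …, ±1)`. -/
def cubeWeight : Fin 5 → Fin 5 → ℤ :=
  ![![1, 1, 1, 1, 1], ![0, 1, 1, 1, 1], ![0, 0, 1, 1, 1], ![0, 0, 0, 1, 1], ![0, 0, 0, 0, 1]]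

/-- The roots of the symmetry group of the `5`-cube. -/
def IsCubeRoot (z : Fin 5 → ℤ) : Prop :=
  (∀ k, -1 ≤ z k ∧ z k ≤ 1) ∧ (z ⬝ᵥ z = 1 ∨ z ⬝ᵥ z = 2)

instance : DecidablePred IsCubeRoot := fun z => by unfold IsCubeRoot; infer_instance

-- Coordinates of roots are -1, 0 or 1, so 3⁵ cases remain. The vector (1,2,3,4,5) lies in the
-- interior of the fundamental chamber and therefore selects the positive roots.
set_option maxRecDepth 100000 in
theorem cubeRoot_check : ∀ a b c d e : Fin 3,
    let z : Fin 5 → ℤ := ![(a : ℤ) - 1, (b : ℤ) - 1, (c : ℤ) - 1, (d : ℤ) - 1, (e : ℤ) - 1]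
    (z ⬝ᵥ z = 1 ∨ z ⬝ᵥ z = 2) → ∀ i, cubeRoot i ⬝ᵥ cubeRoot i ∣ 2 * (cubeRoot i ⬝ᵥ z) ∧
      IsCubeRoot (intReflection (cubeRoot i) z) ∧
      (0 < z ⬝ᵥ ![1, 2, 3, 4, 5] →
        (z ≠ cubeRoot i → 0 < intReflection (cubeRoot i) z ⬝ᵥ ![1, 2, 3, 4, 5]) ∧
        0 ≤ z ⬝ᵥ cubeWeight i) := by
  decide

theorem cube_isRootDatum : IsRootDatum cubeRoot IsCubeRoot ![1, 2, 3, 4, 5] cubeWeight := by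
  have key : ∀ z, IsCubeRoot z → ∀ i, cubeRoot i ⬝ᵥ cubeRoot i ∣ 2 * (cubeRoot i ⬝ᵥ z) ∧
      IsCubeRoot (intReflection (cubeRoot i) z) ∧
      (0 < z ⬝ᵥ ![1, 2, 3, 4, 5] →
        (z ≠ cubeRoot i → 0 < intReflection (cubeRoot i) z ⬝ᵥ ![1, 2, 3, 4, 5]) ∧
        0 ≤ z ⬝ᵥ cubeWeight i) := by
    intro z ⟨hz1, hz2⟩
    have hf : ∀ k, ∃ f : Fin 3, z k = (f : ℤ) - 1 := by
      intro k
      obtain ⟨h1, h2⟩ := hz1 k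
      refine ⟨⟨(z k + 1).toNat, by omega⟩, ?_⟩
      simp only
      omega
    choose f hf using hf
    have hz : z = ![(f 0 : ℤ) - 1, (f 1 : ℤ) - 1, (f 2 : ℤ) - 1, (f 3 : ℤ) - 1, (f 4 : ℤ) - 1] := by
      ext k
      fin_cases k <;> exact hf _
    rw [hz] at hz2 ⊢
    exact cubeRoot_check _ _ _ _ _ hz2
  exact
    { root := by decide
      root_pos := by decide
      norm_pos := by decide
      dvd := fun z hz i => (key z hz i).1
      closed := fun z hz i => (key z hz i).2.1
      simple := fun z hz hc i => ((key z hz i).2.2 hc).1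
      dominant := fun z hz hc i => ((key z hz i).2.2 hc).2
      dual := by decide }

/-- The reflections in the walls of the fundamental chamber of the symmetry group of the cube. -/
noncomputable def cubeMirror (i : Fin 5) : Equiv.Perm (Fin 5 → ℝ) :=
  hyperplaneReflection ((1 : ℝ) • castVec (cubeRoot i)) 0

/-- The symmetry group `[4,3,3,3]` of the `5`-cube. -/
def cubeGroup : Subgroup (Equiv.Perm (Fin 5 → ℝ)) := Subgroup.closure (Set.range cubeMirror)

/-- The distinguished generators of the symmetry group of the `5`-cube. -/
noncomputable def cubeGen (i : Fin 5) : cubeGroup :=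
  ⟨cubeMirror i, Subgroup.subset_closure ⟨i, rfl⟩⟩

theorem closure_range_codRestrict {G : Type*} [Group G] {ι : Type*} (s : ι → G) :
    Subgroup.closure (Set.range fun i =>
      (⟨s i, Subgroup.subset_closure ⟨i, rfl⟩⟩ : Subgroup.closure (Set.range s))) = ⊤ := by
  rw [← Subgroup.closure_closure_coe_preimage (k := Set.range s)]
  congr 1
  ext x
  constructor
  · rintro ⟨i, rfl⟩
    exact ⟨i, rfl⟩
  · rintro ⟨i, hi⟩
    exact ⟨i, Subtype.ext hi⟩

theorem cubeMirror_norm_ne (i : Fin 5) :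
    (1 : ℝ) • castVec (cubeRoot i) ⬝ᵥ (1 : ℝ) • castVec (cubeRoot i) ≠ 0 := by
  rw [one_smul, castVec_dotProduct]
  exact_mod_cast (cube_isRootDatum.norm_pos i).ne'

instance : IsStringCGroup cubeGen where
  closure_range := closure_range_codRestrict cubeMirror
  mul_self i := Subtype.ext (hyperplaneReflection_mul_self _ _)
  ne_one i h := hyperplaneReflection_ne_one (cubeMirror_norm_ne i) (congrArg Subtype.val h)
  commute i j hij := by
    apply Subtype.ext
    refine (commute_hyperplaneReflection ?_ 0 0).eq
    rw [one_smul, one_smul, castVec_dotProduct]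
    have : ∀ i j : Fin 5, (i : ℕ) + 2 ≤ j → cubeRoot i ⬝ᵥ cubeRoot j = 0 := by decide
    exact_mod_cast this i j hij
  inter i j := by
    have hmap := map_parabolic cubeGroup.subtype cubeGen
    rintro g ⟨h1, h2⟩
    have h1' := Subgroup.mem_map_of_mem cubeGroup.subtype h1
    have h2' := Subgroup.mem_map_of_mem cubeGroup.subtype h2
    rw [hmap] at h1' h2'
    have h3 := cube_isRootDatum.parabolic_inf one_pos _ _ (Subgroup.mem_inf.2 ⟨h1', h2'⟩)
    have h4 : (g : Equiv.Perm (Fin 5 → ℝ)) ∈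
        (parabolic cubeGen (Set.Ioo i j)).map cubeGroup.subtype := by
      rw [hmap]
      refine parabolic_mono _ ?_ h3
      intro k _ _ hk
      exact ⟨hk.2, hk.1⟩
    obtain ⟨g', hg', e⟩ := h4
    rwa [← Subtype.ext e]

theorem cubeMirror_mul_self (i : Fin 5) : cubeMirror i * cubeMirror i = 1 :=
  hyperplaneReflection_mul_self _ _

theorem cubeMirror_apply (i : Fin 5) (x : Fin 5 → ℝ) : cubeMirror i x =
    ![![-x 0, x 1, x 2, x 3, x 4], ![x 1, x 0, x 2, x 3, x 4], ![x 0, x 2, x 1, x 3, x 4],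
      ![x 0, x 1, x 3, x 2, x 4], ![x 0, x 1, x 2, x 4, x 3]] i := by
  rw [cubeMirror, hyperplaneReflection_apply]
  ext k
  fin_cases i <;> fin_cases k <;>
    simp [castVec, cubeRoot, dotProduct, Fin.sum_univ_five] <;> ring

/-! ### Signed permutations and transport to the fundamental chamber. -/

/-- The elements of the symmetry group of the cube are signed permutations. -/
theorem cubeGroup_signed {g : Equiv.Perm (Fin 5 → ℝ)} (hg : g ∈ cubeGroup) (k : Fin 5) :
    ∃ l, (∀ x, g x k = x l) ∨ (∀ x, g x k = -x l) := by
  revert k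
  have step : ∀ i k, ∃ l, (∀ x, cubeMirror i x k = x l) ∨ (∀ x, cubeMirror i x k = -x l) := by
    intro i k
    simp only [cubeMirror_apply]
    fin_cases i <;> fin_cases k <;> first
      | exact ⟨0, Or.inl fun x => rfl⟩
      | exact ⟨1, Or.inl fun x => rfl⟩
      | exact ⟨2, Or.inl fun x => rfl⟩
      | exact ⟨3, Or.inl fun x => rfl⟩
      | exact ⟨4, Or.inl fun x => rfl⟩
      | exact ⟨0, Or.inr fun x => rfl⟩
  have step' : ∀ (i : Fin 5) (g : Equiv.Perm (Fin 5 → ℝ)),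
      (∀ k, ∃ l, (∀ x, g x k = x l) ∨ (∀ x, g x k = -x l)) →
      ∀ k, ∃ l, (∀ x, (cubeMirror i * g) x k = x l) ∨ (∀ x, (cubeMirror i * g) x k = -x l) := by
    intro i g h k
    obtain ⟨l, hl⟩ := step i k
    obtain ⟨l', hl'⟩ := h l
    refine ⟨l', ?_⟩
    simp only [Equiv.Perm.mul_apply]
    rcases hl with hl | hl <;> rcases hl' with hl' | hl' <;> simp [hl, hl']
  induction hg using Subgroup.closure_induction_left with
  | one => exact fun k => ⟨k, Or.inl fun x => rfl⟩
  | mul_left y hy x hx ih =>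
    obtain ⟨i, rfl⟩ := hy
    exact step' i x ih
  | inv_mul_cancel y hy x hx ih =>
    obtain ⟨i, rfl⟩ := hy
    rw [inv_eq_of_mul_eq_one_left (cubeMirror_mul_self i)]
    exact step' i x ih

theorem cubeGroup_isLinearIsometry {g : Equiv.Perm (Fin 5 → ℝ)} (hg : g ∈ cubeGroup) :
    IsLinearIsometry g := by
  refine IsLinearIsometry.of_mem_closure ?_ hg
  rintro _ ⟨i, rfl⟩
  exact IsLinearIsometry.hyperplaneReflection _

theorem exists_castVec_of_mem_cubeGroup {g : Equiv.Perm (Fin 5 → ℝ)} (hg : g ∈ cubeGroup)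
    (z : Fin 5 → ℤ) : ∃ y : Fin 5 → ℤ, g (castVec z) = castVec y := by
  have : ∀ k, ∃ y : ℤ, g (castVec z) k = y := by
    intro k
    obtain ⟨l, hl | hl⟩ := cubeGroup_signed hg k
    · exact ⟨z l, hl _⟩
    · exact ⟨-z l, by rw [hl]; simp [castVec]⟩
  choose y hy using this
  exact ⟨y, funext hy⟩

/-- Every integral vector is equivalent to one in the closed fundamental chamber. -/
theorem exists_cubeGroup_dominant (z : Fin 5 → ℤ) : ∃ g ∈ cubeGroup,
    ∀ i, 0 ≤ castVec (cubeRoot i) ⬝ᵥ g (castVec z) := by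
  let c : Fin 5 → ℤ := ![1, 2, 3, 4, 5]
  -- Maximize the inner product with an interior vector c of the chamber over the orbit; it is
  -- bounded because the group preserves norms. If a wall inequality failed, the reflection in that
  -- wall would increase it.
  obtain ⟨ub, ⟨g, hg, y, hy, rfl⟩, hmax⟩ := Int.exists_greatest_of_bdd
    (P := fun k => ∃ g ∈ cubeGroup, ∃ y : Fin 5 → ℤ, g (castVec z) = castVec y ∧ y ⬝ᵥ c = k)
    ⟨z ⬝ᵥ z + c ⬝ᵥ c, by
      rintro k ⟨g, hg, y, hy, rfl⟩
      have h1 : y ⬝ᵥ y = z ⬝ᵥ z := by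
        have := (cubeGroup_isLinearIsometry hg).map_dotProduct (castVec z) (castVec z)
        rw [hy, castVec_dotProduct, castVec_dotProduct] at this
        exact_mod_cast this
      rw [← h1]
      simp only [dotProduct, Fin.sum_univ_five]
      nlinarith [sq_nonneg (y 0 - c 0), sq_nonneg (y 1 - c 1), sq_nonneg (y 2 - c 2),
        sq_nonneg (y 3 - c 3), sq_nonneg (y 4 - c 4), sq_nonneg (y 0), sq_nonneg (y 1),
        sq_nonneg (y 2), sq_nonneg (y 3), sq_nonneg (y 4), sq_nonneg (c 0), sq_nonneg (c 1),
        sq_nonneg (c 2), sq_nonneg (c 3), sq_nonneg (c 4)]⟩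
    ⟨z ⬝ᵥ c, 1, one_mem _, z, rfl, rfl⟩
  refine ⟨g, hg, fun i => ?_⟩
  by_contra hneg
  push Not at hneg
  have hg' : cubeMirror i * g ∈ cubeGroup := mul_mem (cubeGen i).2 hg
  obtain ⟨y', hy'⟩ := exists_castVec_of_mem_cubeGroup hg' z
  have hle := hmax _ ⟨_, hg', y', hy', rfl⟩
  have h1 : castVec y' ⬝ᵥ castVec c ≤ castVec y ⬝ᵥ castVec c := by
    rw [castVec_dotProduct, castVec_dotProduct]
    exact_mod_cast hle
  rw [← hy', ← hy, Equiv.Perm.mul_apply, cubeMirror, hyperplaneReflection_apply, one_smul,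
    sub_zero, sub_dotProduct, smul_dotProduct, smul_eq_mul] at h1
  have h2 : 0 < castVec (cubeRoot i) ⬝ᵥ castVec (cubeRoot i) := by
    rw [castVec_dotProduct]
    exact_mod_cast cube_isRootDatum.norm_pos i
  have h3 : 0 < castVec (cubeRoot i) ⬝ᵥ castVec c := by
    rw [castVec_dotProduct]
    exact_mod_cast cube_isRootDatum.root_pos i
  have h4 : 2 * (castVec (cubeRoot i) ⬝ᵥ g (castVec z)) /
      (castVec (cubeRoot i) ⬝ᵥ castVec (cubeRoot i)) < 0 := div_neg_of_neg_of_pos (by linarith) h2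
  have h5 := mul_neg_of_neg_of_pos h4 h3
  linarith

/-! ### The face lattice of the cube as a coset poset -/

/-- The centre of the face with index `j` of the base flag of the `5`-cube. -/
def cubeCentre (j : Fin 7) : Fin 5 → ℤ := fun k => if (k : ℕ) + 1 < j then 0 else 1

/-- Index 0 stands for the empty face, which has no centre; its vector by the formula is the same as
that of the base vertex, so it is excluded here and below. -/
theorem cubeRoot_dotProduct_cubeCentre : ∀ (i : Fin 5) (j : Fin 7), j ≠ 0 →
    (cubeRoot i ⬝ᵥ cubeCentre j = 0 ↔ (i : ℕ) + 1 ≠ j) := by decide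

theorem cubeCentre_eq : ∀ j : Fin 7, cubeCentre j = 0 ∨ ∃ i, cubeCentre j = cubeWeight i := by
  decide

theorem cubeCentre_norm : ∀ j : Fin 7, j ≠ 0 → cubeCentre j ⬝ᵥ cubeCentre j = 6 - (j : ℕ) := by
  decide

theorem cubeCentre_le : ∀ i j : Fin 7, i ≠ 0 → j ≠ 0 →
    (∀ k, cubeCentre j k = 0 ∨ cubeCentre j k = cubeCentre i k) → i ≤ j := by decide

theorem cubeCentre_of_le {i j : Fin 7} (hij : i ≤ j) (k : Fin 5) :
    (cubeCentre i k = 0 ∧ cubeCentre j k = 0) ∨ (cubeCentre i k = 1 ∧ cubeCentre j k = 0) ∨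
      (cubeCentre i k = 1 ∧ cubeCentre j k = 1) := by
  have : (i : ℕ) ≤ j := hij
  simp only [cubeCentre]
  split_ifs <;> simp
  omega

theorem cubeRoot_dotProduct (z : Fin 5 → ℤ) (i : Fin 5) : cubeRoot i ⬝ᵥ z =
    ![z 0, z 1 - z 0, z 2 - z 1, z 3 - z 2, z 4 - z 3] i := by
  fin_cases i <;> simp [cubeRoot, dotProduct, Fin.sum_univ_five] <;> ring

/-- Dominance means 0 ≤ z₀ ≤ z₁ ≤ ⋯ ≤ z₄, so z is a run of zeros followed by a run of ones. -/
theorem exists_eq_cubeCentre (z : Fin 5 → ℤ) (hz : ∀ k, -1 ≤ z k ∧ z k ≤ 1)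
    (hd : ∀ i, 0 ≤ cubeRoot i ⬝ᵥ z) : ∃ j, j ≠ 0 ∧ z = cubeCentre j := by
  simp only [cubeRoot_dotProduct] at hd
  have h0 := hd 0
  have h1 := hd 1
  have h2 := hd 2
  have h3 := hd 3
  have h4 := hd 4
  have b4 := (hz 4).2
  simp at h0 h1 h2 h3 h4
  have hj : ∃ j : Fin 7, j ≠ 0 ∧ (z 0 = cubeCentre j 0 ∧ z 1 = cubeCentre j 1 ∧
      z 2 = cubeCentre j 2 ∧ z 3 = cubeCentre j 3 ∧ z 4 = cubeCentre j 4) := by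
    by_cases c0 : z 0 = 1
    · exact ⟨1, by decide, by simp [cubeCentre]; omega⟩
    by_cases c1 : z 1 = 1
    · exact ⟨2, by decide, by simp [cubeCentre]; omega⟩
    by_cases c2 : z 2 = 1
    · exact ⟨3, by decide, by simp [cubeCentre]; omega⟩
    by_cases c3 : z 3 = 1
    · exact ⟨4, by decide, by simp [cubeCentre]; omega⟩
    by_cases c4 : z 4 = 1
    · exact ⟨5, by decide, by simp [cubeCentre]; omega⟩
    · exact ⟨6, by decide, by simp [cubeCentre]; omega⟩
  obtain ⟨j, hj0, e0, e1, e2, e3, e4⟩ := hj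
  refine ⟨j, hj0, ?_⟩
  ext k
  fin_cases k <;> assumption

/-- The stabilizer in the cube group of the centre of a face of the base flag. -/
theorem cubeGroup_apply_cubeCentre_eq_iff {j : Fin 7} (hj : j ≠ 0) (g h : cubeGroup) :
    g.1 (castVec (cubeCentre j)) = h.1 (castVec (cubeCentre j)) ↔
      cosetFace cubeGen j g = cosetFace cubeGen j h := by
  rw [cosetFace_eq_iff]
  have hmap := map_parabolic cubeGroup.subtype cubeGen {k | k ≠ (j : ℕ)}
  have h1 : g.1 (castVec (cubeCentre j)) = h.1 (castVec (cubeCentre j)) ↔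
      (g⁻¹ * h).1 (castVec (cubeCentre j)) = castVec (cubeCentre j) := by
    change _ ↔ g.1⁻¹ (h.1 _) = _
    rw [Equiv.Perm.inv_eq_iff_eq, eq_comm]
  rw [h1]
  generalize g⁻¹ * h = x
  constructor
  · intro hx
    -- Each centre is zero or one of the dominant vectors, so it lies in the closed chamber and its
    -- stabilizer is generated by the walls through it.
    have h2 := cube_isRootDatum.mem_closure one_pos (castVec (cubeCentre j)) (by
      intro z hz hc
      rw [castVec_dotProduct]
      rcases cubeCentre_eq j with e | ⟨i, e⟩
      · simp [e]
      · rw [e]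
        exact_mod_cast cube_isRootDatum.dominant z hz hc i) x.1 x.2 hx
    have h3 : x.1 ∈ (parabolic cubeGen {k | k ≠ (j : ℕ)}).map cubeGroup.subtype := by
      rw [hmap]
      refine Subgroup.closure_mono ?_ h2
      rintro _ ⟨i, hi, rfl⟩
      rw [castVec_dotProduct] at hi
      exact ⟨i, (cubeRoot_dotProduct_cubeCentre i j hj).1 (by exact_mod_cast hi), rfl⟩
    obtain ⟨y, hy, e⟩ := h3
    rwa [← Subtype.ext e]
  · intro hx
    have h3 := Subgroup.mem_map_of_mem cubeGroup.subtype hx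
    rw [hmap] at h3
    change x.1 ∈ _ at h3
    generalize x.1 = y at h3
    induction h3 using Subgroup.closure_induction with
    | mem y hy =>
      obtain ⟨i, hi, rfl⟩ := hy
      apply hyperplaneReflection_eq_self
      rw [one_smul, castVec_dotProduct, (cubeRoot_dotProduct_cubeCentre i j hj).2 hi, Int.cast_zero]
    | one => rfl
    | mul x y _ _ hx hy => rw [Equiv.Perm.mul_apply, hy, hx]
    | inv x _ hx => rw [Equiv.Perm.inv_eq_iff_eq, hx]

/-- The cube group is transitive on pairs of incident faces. -/
theorem exists_cubeGroup_apply_eq (z z' : Fin 5 → ℤ) (hz : ∀ k, -1 ≤ z k ∧ z k ≤ 1)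
    (hz' : ∀ k, z' k = 0 ∨ z' k = z k) : ∃ g ∈ cubeGroup, ∃ i j : Fin 7, i ≠ 0 ∧ j ≠ 0 ∧ i ≤ j ∧
      castVec z = g (castVec (cubeCentre i)) ∧ castVec z' = g (castVec (cubeCentre j)) := by
  -- Moving the sum into the chamber moves both vectors there at once: a coordinate 0, 1 or 2 of the
  -- sum can only come from the pair (0,0), (1,0) or (1,1), and both entries are monotone in the
  -- sum.
  obtain ⟨g, hg, hd⟩ := exists_cubeGroup_dominant (z + z')
  have hs : ∀ k, ∃ y y' : ℤ, g (castVec z) k = y ∧ g (castVec z') k = y' ∧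
      g (castVec (z + z')) k = ((y + y' : ℤ) : ℝ) ∧ (-1 ≤ y ∧ y ≤ 1) ∧ (y' = 0 ∨ y' = y) := by
    intro k
    obtain ⟨l, hl | hl⟩ := cubeGroup_signed hg k
    · refine ⟨z l, z' l, hl _, hl _, ?_, hz l, hz' l⟩
      rw [hl]
      simp [castVec]
    · refine ⟨-z l, -z' l, by rw [hl]; simp [castVec], by rw [hl]; simp [castVec], ?_, ?_, ?_⟩
      · rw [hl]
        simp [castVec]
        ring
      · have := hz l
        omega
      · have := hz' l
        omega
  choose y y' hy hy' hyy hb hb' using hs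
  have ey : g (castVec z) = castVec y := funext hy
  have ez : g (castVec z') = castVec y' := funext hy'
  have eyy : g (castVec (z + z')) = castVec (y + y') := funext hyy
  have hd' : ∀ i, 0 ≤ cubeRoot i ⬝ᵥ (y + y') := by
    intro i
    have := hd i
    rw [eyy, castVec_dotProduct] at this
    exact_mod_cast this
  simp only [cubeRoot_dotProduct] at hd'
  have h0 := hd' 0
  have h1 := hd' 1
  have h2 := hd' 2
  have h3 := hd' 3
  have h4 := hd' 4
  simp at h0 h1 h2 h3 h4
  have b0 := hb 0
  have b1 := hb 1
  have b2 := hb 2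
  have b3 := hb 3
  have b4 := hb 4
  have b0' := hb' 0
  have b1' := hb' 1
  have b2' := hb' 2
  have b3' := hb' 3
  have b4' := hb' 4
  obtain ⟨i, hi, ei⟩ := exists_eq_cubeCentre y hb (by
    intro i
    rw [cubeRoot_dotProduct]
    fin_cases i <;> simp <;> omega)
  obtain ⟨j, hj, ej⟩ := exists_eq_cubeCentre y' (by
    intro k
    have h1 := hb k
    have h2 := hb' k
    omega) (by
    intro i
    rw [cubeRoot_dotProduct]
    fin_cases i <;> simp <;> omega)
  refine ⟨g⁻¹, inv_mem hg, i, j, hi, hj, ?_, ?_, ?_⟩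
  · apply cubeCentre_le i j hi hj
    intro k
    rw [← ei, ← ej]
    exact hb' k
  · rw [← ei, eq_comm, Equiv.Perm.inv_eq_iff_eq, ey]
  · rw [← ej, eq_comm, Equiv.Perm.inv_eq_iff_eq, ez]

/-! ### Faces of the cube as sign vectors. -/

/-- The face of the cube with vertices `(±1, …, ±1)` that corresponds to the sign pattern of a
vector. -/
noncomputable def signFace (x : Fin 5 → ℝ) : NonemptyInterval (Fin 5 → Bool) where
  fst k := decide (0 < x k)
  snd k := decide (0 ≤ x k)
  fst_le_snd k := by
    simp only [Bool.le_iff_imp, decide_eq_true_eq]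
    exact le_of_lt

theorem signFace_le_iff {x y : Fin 5 → ℝ} :
    signFace x ≤ signFace y ↔ ∀ k, (0 < y k → 0 < x k) ∧ (0 ≤ x k → 0 ≤ y k) := by
  rw [NonemptyInterval.le_def, Pi.le_def, Pi.le_def, ← forall_and]
  simp only [signFace, Bool.le_iff_imp, decide_eq_true_eq]

theorem exists_castVec_cubeCentre (g : cubeGroup) (j : Fin 7) : ∃ z : Fin 5 → ℤ,
    g.1 (castVec (cubeCentre j)) = castVec z ∧ ∀ k, -1 ≤ z k ∧ z k ≤ 1 := by
  have : ∀ k, ∃ y : ℤ, g.1 (castVec (cubeCentre j)) k = y ∧ -1 ≤ y ∧ y ≤ 1 := by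
    intro k
    have hc : ∀ l, cubeCentre j l = 0 ∨ cubeCentre j l = 1 := by
      intro l
      simp only [cubeCentre]
      split_ifs <;> simp
    obtain ⟨l, hl | hl⟩ := cubeGroup_signed g.2 k
    · refine ⟨cubeCentre j l, hl _, ?_⟩
      have := hc l
      omega
    · refine ⟨-cubeCentre j l, by rw [hl]; simp [castVec], ?_⟩
      have := hc l
      omega
  choose z hz using this
  exact ⟨z, funext fun k => (hz k).1, fun k => (hz k).2⟩

/-- The squared norm of the centre at index j is 6 - j; it is invariant under the group and
determines the index. -/
theorem eq_of_apply_cubeCentre_eq {g h : Equiv.Perm (Fin 5 → ℝ)} (hg : g ∈ cubeGroup)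
    (hh : h ∈ cubeGroup) {i j : Fin 7} (hi : i ≠ 0) (hj : j ≠ 0)
    (e : g (castVec (cubeCentre i)) = h (castVec (cubeCentre j))) : i = j := by
  have h1 := (cubeGroup_isLinearIsometry hg).map_dotProduct (castVec (cubeCentre i))
    (castVec (cubeCentre i))
  have h2 := (cubeGroup_isLinearIsometry hh).map_dotProduct (castVec (cubeCentre j))
    (castVec (cubeCentre j))
  rw [e, h2, castVec_dotProduct, castVec_dotProduct, cubeCentre_norm i hi, cubeCentre_norm j hj]
    at h1
  have h3 : (6 : ℤ) - (j : ℕ) = 6 - (i : ℕ) := by exact_mod_cast h1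
  exact Fin.ext (by omega)

/-- A nonempty face corresponds to its centre, a vector with entries in {-1, 0, 1}. One face
contains another when its centre arises from the other by replacing entries with 0, and transitivity
of the group on such pairs supplies the common representative that incidence of cosets asks for. -/
theorem nonempty_cube_orderIso : Nonempty (Cube 5 ≃o CosetPoset cubeGen) := by
  classical
  choose rep hrep using fun F : CosetPoset cubeGen => exists_eq_cosetFace F
  let f : CosetPoset cubeGen → Cube 5 := fun F =>
    if F.1 = 0 then ⊥ else
      ((signFace ((rep F).1 (castVec (cubeCentre F.1))) : NonemptyInterval (Fin 5 → Bool)) : Cube 5)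
  have hf0 : ∀ g, f (cosetFace cubeGen 0 g) = ⊥ := fun g => if_pos rfl
  have hf : ∀ (j : Fin 7) (g : cubeGroup), j ≠ 0 → f (cosetFace cubeGen j g) =
      ((signFace (g.1 (castVec (cubeCentre j))) : NonemptyInterval (Fin 5 → Bool)) : Cube 5) := by
    intro j g hj
    have h1 : f (cosetFace cubeGen j g) = ((signFace ((rep (cosetFace cubeGen j g)).1
        (castVec (cubeCentre j))) : NonemptyInterval (Fin 5 → Bool)) : Cube 5) := if_neg hj
    rw [h1, (cubeGroup_apply_cubeCentre_eq_iff hj _ g).2 (hrep (cosetFace cubeGen j g)).symm]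
  have hle : ∀ F G, f F ≤ f G ↔ F ≤ G := by
    intro F G
    constructor
    · obtain ⟨g, hg⟩ := exists_eq_cosetFace F
      obtain ⟨h, hh⟩ := exists_eq_cosetFace G
      generalize F.1 = i at hg
      generalize G.1 = j at hh
      subst hg hh
      intro hFG
      by_cases hi : i = 0
      · subst hi
        exact bot_cosetFace_le _ _ _
      by_cases hj : j = 0
      · subst hj
        rw [hf0, hf i g hi] at hFG
        exact absurd hFG (WithBot.not_coe_le_bot _)
      rw [hf i g hi, hf j h hj, Interval.coe_le_coe, signFace_le_iff] at hFG
      obtain ⟨z, hz, hzb⟩ := exists_castVec_cubeCentre g i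
      obtain ⟨z', hz', hzb'⟩ := exists_castVec_cubeCentre h j
      obtain ⟨x, hx, i', j', hi', hj', hij, e1, e2⟩ := exists_cubeGroup_apply_eq z z' hzb (by
        intro k
        have h1 := hFG k
        rw [hz, hz'] at h1
        simp only [castVec, Int.cast_pos, Int.cast_nonneg_iff] at h1
        have h2 := hzb k
        have h3 := hzb' k
        omega)
      have ei : i = i' := eq_of_apply_cubeCentre_eq g.2 hx hi hi' (hz.trans e1)
      have ej : j = j' := eq_of_apply_cubeCentre_eq h.2 hx hj hj' (hz'.trans e2)
      subst ei ej
      rw [(cubeGroup_apply_cubeCentre_eq_iff hi g ⟨x, hx⟩).1 (hz.trans e1),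
        (cubeGroup_apply_cubeCentre_eq_iff hj h ⟨x, hx⟩).1 (hz'.trans e2)]
      exact cosetFace_le_cosetFace hij _
    · intro hFG
      obtain ⟨hij, g, h1, h2⟩ := le_def.1 hFG
      generalize F.1 = i at h1 hij
      generalize G.1 = j at h2 hij
      subst h1 h2
      by_cases hi : i = 0
      · subst hi
        rw [hf0]
        exact bot_le
      have hj : j ≠ 0 := by
        rintro rfl
        exact hi (Fin.le_zero_iff.1 hij)
      rw [hf i g hi, hf j g hj, Interval.coe_le_coe, signFace_le_iff]
      intro k
      obtain ⟨l, hl | hl⟩ := cubeGroup_signed g.2 k <;> rw [hl, hl] <;>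
        rcases cubeCentre_of_le hij l with ⟨e1, e2⟩ | ⟨e1, e2⟩ | ⟨e1, e2⟩ <;>
        simp [castVec, e1, e2]
  have hbij : Function.Bijective f := by
    constructor
    · intro F G h
      exact le_antisymm ((hle F G).1 h.le) ((hle G F).1 h.ge)
    · intro I
      induction I using Interval.recBotCoe with
      | bot => exact ⟨cosetFace cubeGen 0 1, hf0 1⟩
      | coe J =>
        -- The centre of the face: 0 in the directions in which the interval is free, and the
        -- constant sign elsewhere.
        let z : Fin 5 → ℤ := fun k => if J.fst k then 1 else if J.snd k then 0 else -1
        obtain ⟨g, hg, i, j, hi, -, -, e, -⟩ := exists_cubeGroup_apply_eq z z (by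
          intro k
          simp only [z]
          split_ifs <;> simp) (fun k => Or.inr rfl)
        refine ⟨cosetFace cubeGen i ⟨g, hg⟩, ?_⟩
        rw [hf i _ hi, ← e]
        congr 1
        apply NonemptyInterval.ext
        apply Prod.ext
        · ext k
          change decide (0 < (((if J.fst k = true then 1 else if J.snd k = true then 0 else -1 : ℤ)) :
            ℝ)) = J.fst k
          cases J.fst k <;> cases J.snd k <;> simp
        · ext k
          have h1 : J.fst k ≤ J.snd k := J.fst_le_snd k
          change decide (0 ≤ (((if J.fst k = true then 1 else if J.snd k = true then 0 else -1 : ℤ)) :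
            ℝ)) = J.snd k
          revert h1
          cases J.fst k <;> cases J.snd k <;> simp
  exact ⟨OrderIso.symm { toEquiv := Equiv.ofBijective f hbij, map_rel_iff' := hle _ _ }⟩

/-! ### Quotients of coset posets by normal subgroups -/

/-- The quotient of the poset `𝒫(Γ)` by a normal subgroup `T` is the poset `𝒫(Γ / T)`. -/
theorem nonempty_orbitPoset_orderIso {Γ : Type*} [Group Γ] {n : ℕ} (ρ : Fin n → Γ)
    (T : Subgroup Γ) [T.Normal] :
    Nonempty (OrbitPoset T (CosetPoset ρ) ≃o CosetPoset fun i => (ρ i : Γ ⧸ T)) := by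
  set σ : Fin n → Γ ⧸ T := fun i => (ρ i : Γ ⧸ T) with hσ
  choose rep hrep using fun F : CosetPoset ρ => exists_eq_cosetFace F
  have hmap : ∀ S, (parabolic ρ S).map (QuotientGroup.mk' T) = parabolic σ S :=
    map_parabolic (QuotientGroup.mk' T) ρ
  have hiff : ∀ (j : Fin (n + 2)) (g h : Γ), cosetFace σ j (g : Γ ⧸ T) = cosetFace σ j (h : Γ ⧸ T) ↔
      ∃ t : T, t • cosetFace ρ j h = cosetFace ρ j g := by
    intro j g h
    rw [cosetFace_eq_iff, ← hmap]
    constructor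
    · rintro ⟨p, hp, e⟩
      have e' : (p : Γ ⧸ T) = ((g⁻¹ * h : Γ) : Γ ⧸ T) := e
      rw [QuotientGroup.eq] at e'
      -- The discrepancy between p and g⁻¹h lies in T; as T is normal, conjugation moves it to the
      -- left, where T acts.
      refine ⟨⟨(g * p) * (p⁻¹ * (g⁻¹ * h))⁻¹ * (g * p)⁻¹,
        Subgroup.Normal.conj_mem inferInstance _ (inv_mem e') _⟩, ?_⟩
      rw [Subgroup.mk_smul, smul_cosetFace, cosetFace_eq_iff]
      have : ((g * p) * (p⁻¹ * (g⁻¹ * h))⁻¹ * (g * p)⁻¹ * h)⁻¹ * g = p⁻¹ := by group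
      rw [this]
      exact inv_mem hp
    · rintro ⟨t, ht⟩
      rw [Subgroup.smul_def, smul_cosetFace, cosetFace_eq_iff] at ht
      refine ⟨_, inv_mem ht, ?_⟩
      have h1 : QuotientGroup.mk' T t = 1 := (QuotientGroup.eq_one_iff _).2 t.2
      change QuotientGroup.mk' T (((t : Γ) * h)⁻¹ * g)⁻¹ = QuotientGroup.mk' T g⁻¹ *
        QuotientGroup.mk' T h
      simp only [map_inv, map_mul, h1]
      group
  let f : CosetPoset ρ → CosetPoset σ := fun F => cosetFace σ F.1 (rep F : Γ ⧸ T)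
  have hf : ∀ j g, f (cosetFace ρ j g) = cosetFace σ j (g : Γ ⧸ T) := by
    intro j g
    refine (hiff j _ g).2 ⟨1, ?_⟩
    rw [one_smul]
    exact hrep (cosetFace ρ j g)
  have hf1 : ∀ F G, f F = f G ↔ ∃ t : T, t • G = F := by
    intro F G
    obtain ⟨g, hg⟩ := exists_eq_cosetFace F
    obtain ⟨h, hh⟩ := exists_eq_cosetFace G
    generalize F.1 = i at hg
    generalize G.1 = j at hh
    subst hg hh
    rw [hf, hf]
    constructor
    · intro e
      have hij : i = j := congrArg Sigma.fst e
      subst hij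
      exact (hiff i g h).1 e
    · rintro ⟨t, ht⟩
      have hij : j = i := congrArg Sigma.fst ht
      subst hij
      exact (hiff j g h).2 ⟨t, ht⟩
  let e : OrbitPoset T (CosetPoset ρ) → CosetPoset σ :=
    Quotient.lift f fun F G h => (hf1 F G).2 h
  have he : Function.Bijective e := by
    constructor
    · intro x y
      induction x using Quotient.inductionOn
      induction y using Quotient.inductionOn
      intro h
      exact Quotient.sound ((hf1 _ _).1 h)
    · intro F
      obtain ⟨γ, hγ⟩ := exists_eq_cosetFace F
      obtain ⟨g, rfl⟩ := QuotientGroup.mk_surjective γ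
      refine ⟨Quotient.mk _ (cosetFace ρ F.1 g), ?_⟩
      rw [hγ]
      exact hf _ _
  refine ⟨{ toEquiv := Equiv.ofBijective e he, map_rel_iff' := ?_ }⟩
  intro x y
  change e x ≤ e y ↔ x ≤ y
  constructor
  · intro hxy
    obtain ⟨hij, γ, h1, h2⟩ := le_def.1 hxy
    obtain ⟨g, rfl⟩ := QuotientGroup.mk_surjective γ
    refine ⟨cosetFace ρ (e x).1 g, cosetFace ρ (e y).1 g, he.1 ?_, he.1 ?_,
      cosetFace_le_cosetFace hij g⟩
    · exact (hf _ _).trans h1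
    · exact (hf _ _).trans h2
  · rintro ⟨F, G, rfl, rfl, hFG⟩
    change f F ≤ f G
    obtain ⟨hij, g, h1, h2⟩ := le_def.1 hFG
    rw [← h1, ← h2, hf, hf]
    exact cosetFace_le_cosetFace hij _

/-! ### The symmetry group of the 24-cell -/

/-- Twice the simple roots of the symmetry group of the `24`-cell. -/
def cellRoot : Fin 4 → Fin 4 → ℤ :=
  ![![0, 2, -2, 0], ![0, 0, 2, -2], ![0, 0, 0, 2], ![1, -1, -1, -1]]

/-- The dominant vectors dual to the simple roots. -/
def cellWeight : Fin 4 → Fin 4 → ℤ :=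
  ![![1, 1, 0, 0], ![2, 1, 1, 0], ![3, 1, 1, 1], ![2, 0, 0, 0]]

/-- Twice the roots of the symmetry group of the `24`-cell. -/
def IsCellRoot (z : Fin 4 → ℤ) : Prop :=
  (∀ k, -2 ≤ z k ∧ z k ≤ 2) ∧
    (z ⬝ᵥ z = 4 ∧ (∀ k, 2 ∣ z k - z 0) ∨ z ⬝ᵥ z = 8 ∧ ∀ k, 2 ∣ z k)

instance : DecidablePred IsCellRoot := fun z => by unfold IsCellRoot; infer_instance

-- The roots form the system F₄; they are doubled to make the coordinates integral. Norm 4 with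
-- equal parities gives the doubles of ±eᵢ and of (±1,±1,±1,±1)/2, and norm 8 gives the doubles of
-- ±eᵢ ± eⱼ. At most 5⁴ cases remain, and (10,3,2,1) is interior to the chamber.
set_option maxRecDepth 100000 in
theorem cellRoot_check : ∀ a b c d : Fin 5,
    let z : Fin 4 → ℤ := ![(a : ℤ) - 2, (b : ℤ) - 2, (c : ℤ) - 2, (d : ℤ) - 2]
    (z ⬝ᵥ z = 4 ∧ (∀ k, 2 ∣ z k - z 0) ∨ z ⬝ᵥ z = 8 ∧ ∀ k, 2 ∣ z k) →
      ∀ i, cellRoot i ⬝ᵥ cellRoot i ∣ 2 * (cellRoot i ⬝ᵥ z) ∧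
      IsCellRoot (intReflection (cellRoot i) z) ∧
      (0 < z ⬝ᵥ ![10, 3, 2, 1] →
        (z ≠ cellRoot i → 0 < intReflection (cellRoot i) z ⬝ᵥ ![10, 3, 2, 1]) ∧
        0 ≤ z ⬝ᵥ cellWeight i) := by
  decide

theorem cell_isRootDatum : IsRootDatum cellRoot IsCellRoot ![10, 3, 2, 1] cellWeight := by
  have key : ∀ z, IsCellRoot z → ∀ i, cellRoot i ⬝ᵥ cellRoot i ∣ 2 * (cellRoot i ⬝ᵥ z) ∧
      IsCellRoot (intReflection (cellRoot i) z) ∧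
      (0 < z ⬝ᵥ ![10, 3, 2, 1] →
        (z ≠ cellRoot i → 0 < intReflection (cellRoot i) z ⬝ᵥ ![10, 3, 2, 1]) ∧
        0 ≤ z ⬝ᵥ cellWeight i) := by
    intro z ⟨hz1, hz2⟩
    have hf : ∀ k, ∃ f : Fin 5, z k = (f : ℤ) - 2 := by
      intro k
      obtain ⟨h1, h2⟩ := hz1 k
      refine ⟨⟨(z k + 2).toNat, by omega⟩, ?_⟩
      simp only
      omega
    choose f hf using hf
    have hz : z = ![(f 0 : ℤ) - 2, (f 1 : ℤ) - 2, (f 2 : ℤ) - 2, (f 3 : ℤ) - 2] := by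
      ext k
      fin_cases k <;> exact hf _
    rw [hz] at hz2 ⊢
    exact cellRoot_check _ _ _ _ hz2
  exact
    { root := by decide
      root_pos := by decide
      norm_pos := by decide
      dvd := fun z hz i => (key z hz i).1
      closed := fun z hz i => (key z hz i).2.1
      simple := fun z hz hc i => ((key z hz i).2.2 hc).1
      dominant := fun z hz hc i => ((key z hz i).2.2 hc).2
      dual := by decide }

theorem mirror_castSucc (i : Fin 4) :
    mirror i.castSucc = hyperplaneReflection ((1 / 2 : ℝ) • castVec (cellRoot i)) 0 := by
  fin_cases i <;> simp only [mirror, cellRoot] <;>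
    refine congrArg (hyperplaneReflection · 0) ?_ <;> ext k <;> fin_cases k <;>
    simp [castVec] <;> norm_num

/-! ### The symmetry group of the tessellation `{3,4,3,3}` -/

theorem mirror_apply (i : Fin 5) (x : Fin 4 → ℝ) : mirror i x =
    ![![x 0, x 2, x 1, x 3], ![x 0, x 1, x 3, x 2], ![x 0, x 1, x 2, -x 3],
      ![x 0 - (x 0 - x 1 - x 2 - x 3) / 2, x 1 + (x 0 - x 1 - x 2 - x 3) / 2,
        x 2 + (x 0 - x 1 - x 2 - x 3) / 2, x 3 + (x 0 - x 1 - x 2 - x 3) / 2],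
      ![1 - x 0, x 1, x 2, x 3]] i := by
  ext k
  fin_cases i <;> fin_cases k <;>
    simp [mirror, hyperplaneReflection_apply, dotProduct, Fin.sum_univ_four] <;> ring

theorem mirror_mul_self (i : Fin 5) : mirror i * mirror i = 1 := by
  fin_cases i <;> exact hyperplaneReflection_mul_self _ _

/-- The linear part of a generator of `[3,4,3,3]`. -/
theorem mirror_apply_add (i : Fin 5) (x t : Fin 4 → ℝ) :
    mirror i (x + t) = mirror i x + (mirror i t - mirror i 0) := by
  ext k
  fin_cases i <;> fin_cases k <;> simp [mirror_apply] <;> ring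

theorem exists_isLinearIsometry_of_mem {g : Equiv.Perm (Fin 4 → ℝ)} (hg : g ∈ G3433) :
    ∃ w : Equiv.Perm (Fin 4 → ℝ), IsLinearIsometry w ∧ ∃ t, ∀ x, g x = w x + t := by
  have hrefl : ∀ a c, ∃ w : Equiv.Perm (Fin 4 → ℝ), IsLinearIsometry w ∧
      ∃ t, ∀ x, hyperplaneReflection a c x = w x + t := by
    intro a c
    refine ⟨hyperplaneReflection a 0, IsLinearIsometry.hyperplaneReflection a,
      (2 * c / (a ⬝ᵥ a)) • a, fun x => ?_⟩
    rw [hyperplaneReflection_apply, hyperplaneReflection_apply]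
    module
  induction hg using Subgroup.closure_induction with
  | mem x hx =>
    obtain ⟨i, rfl⟩ := hx
    fin_cases i <;> exact hrefl _ _
  | one => exact ⟨1, IsLinearIsometry.one, 0, fun x => by simp⟩
  | mul x y _ _ hx hy =>
    obtain ⟨w, hw, t, ht⟩ := hx
    obtain ⟨w', hw', t', ht'⟩ := hy
    refine ⟨w * w', hw.mul hw', w t' + t, fun z => ?_⟩
    have := hw.map_add_smul (w' z) t' 1
    rw [one_smul, one_smul] at this
    rw [Equiv.Perm.mul_apply, ht, ht', this, Equiv.Perm.mul_apply, add_assoc]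
  | inv x _ hx =>
    obtain ⟨w, hw, t, ht⟩ := hx
    refine ⟨w⁻¹, hw.inv, -w⁻¹ t, fun z => ?_⟩
    rw [Equiv.Perm.inv_eq_iff_eq, ht, ← sub_eq_add_neg]
    have := hw.map_sub_smul (w⁻¹ z) (w⁻¹ t) 1
    rw [one_smul, one_smul] at this
    rw [this]
    simp

theorem isLinearIsometry_of_mem_of_apply_zero {g : Equiv.Perm (Fin 4 → ℝ)} (hg : g ∈ G3433)
    (h0 : g 0 = 0) : IsLinearIsometry g := by
  obtain ⟨w, hw, t, ht⟩ := exists_isLinearIsometry_of_mem hg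
  have : t = 0 := by
    rw [ht, hw.map_zero, zero_add] at h0
    exact h0
  have e : g = w := by
    ext x : 1
    rw [ht, this, add_zero]
  rwa [e]

/-- The triangle inequality, squared. It turns congruence modulo a lattice without short vectors
into equality. -/
theorem IsLinearIsometry.dotProduct_sub_le {n : ℕ} {g : Equiv.Perm (Fin n → ℝ)}
    (hg : IsLinearIsometry g) (x : Fin n → ℝ) : (g x - x) ⬝ᵥ (g x - x) ≤ 4 * (x ⬝ᵥ x) := by
  have h1 : 0 ≤ (g x + x) ⬝ᵥ (g x + x) := Finset.sum_nonneg fun i _ => mul_self_nonneg _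
  have h2 := hg.map_dotProduct x x
  simp only [add_dotProduct, dotProduct_add, sub_dotProduct, dotProduct_sub, h2,
    dotProduct_comm x (g x)] at *
  linarith

/-! ### Translations in normal subgroups of the tessellation group. -/

/-- The vectors `t` such that the translation by `t` belongs to `N`. -/
def translations (N : Subgroup G3433) : AddSubgroup (Fin 4 → ℝ) where
  carrier := {t | ∃ g ∈ N, (g : Equiv.Perm (Fin 4 → ℝ)) = Equiv.addRight t}
  zero_mem' := ⟨1, one_mem _, by ext; simp⟩
  add_mem' := by
    rintro s t ⟨g, hg, eg⟩ ⟨h, hh, eh⟩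
    refine ⟨h * g, mul_mem hh hg, ?_⟩
    rw [Subgroup.coe_mul, eg, eh]
    ext x : 1
    simp [add_assoc]
  neg_mem' := by
    rintro t ⟨g, hg, eg⟩
    refine ⟨g⁻¹, inv_mem hg, ?_⟩
    rw [Subgroup.coe_inv, eg]
    ext x : 1
    rw [Equiv.Perm.inv_eq_iff_eq]
    simp

/-- Conjugating a translation by an isometry applies the linear part of the isometry to the
translation vector; subtracting the image of 0 extracts the linear part of an affine reflection. -/
theorem mirror_mem_translations {N : Subgroup G3433} [hN : N.Normal] {t : Fin 4 → ℝ}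
    (ht : t ∈ translations N) (i : Fin 5) : mirror i t - mirror i 0 ∈ translations N := by
  obtain ⟨g, hg, eg⟩ := ht
  refine ⟨gen3433 i * g * (gen3433 i)⁻¹, hN.conj_mem g hg _, ?_⟩
  have h1 : (gen3433 i)⁻¹ = gen3433 i :=
    inv_eq_of_mul_eq_one_left (Subtype.ext (mirror_mul_self i))
  rw [h1, Subgroup.coe_mul, Subgroup.coe_mul, eg]
  ext x : 1
  change mirror i (mirror i x + t) = x + _
  rw [mirror_apply_add]
  have h2 : mirror i (mirror i x) = x := by
    rw [← Equiv.Perm.mul_apply, mirror_mul_self, Equiv.Perm.one_apply]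
  rw [h2]
  rfl

theorem single_mem_translations {N : Subgroup G3433} [hN : N.Normal] {c : ℝ}
    (h : ![c, 0, 0, 0] ∈ translations N) : ![c / 2, c / 2, c / 2, c / 2] ∈ translations N ∧
      ![0, c, 0, 0] ∈ translations N ∧ ![0, 0, c, 0] ∈ translations N ∧
      ![0, 0, 0, c] ∈ translations N := by
  have h1 : ![c / 2, c / 2, c / 2, c / 2] ∈ translations N := by
    convert mirror_mem_translations h 3 using 1
    ext k
    fin_cases k <;> simp [mirror_apply]
    ring
  have h2 : ![0, 0, 0, c] ∈ translations N := by
    convert sub_mem h1 (mirror_mem_translations h1 2) using 1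
    ext k
    fin_cases k <;> simp [mirror_apply]
  have h3 : ![0, 0, c, 0] ∈ translations N := by
    convert mirror_mem_translations h2 1 using 1
    ext k
    fin_cases k <;> simp [mirror_apply]
  have h4 : ![0, c, 0, 0] ∈ translations N := by
    convert mirror_mem_translations h3 0 using 1
    ext k
    fin_cases k <;> simp [mirror_apply]
  exact ⟨h1, h4, h3, h2⟩

/-- With s = diag(1,-1,-1,-1), the conjugate of the fourth reflection by s has root (1,1,1,1)/2.
Conjugating it by the fourth reflection yields the reflection x₀ ↦ -x₀. Followed by the last
generator, x₀ ↦ 1 - x₀, this is the unit translation. -/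
theorem unit_mem_translations : ![1, 0, 0, 0] ∈ translations ⊤ := by
  obtain ⟨s, hs⟩ : ∃ s : G3433, ∀ x, s.1 x = ![x 0, -x 1, -x 2, -x 3] := by
    refine ⟨gen3433 0 * gen3433 1 * gen3433 2 * gen3433 1 * gen3433 0 *
      (gen3433 1 * gen3433 2 * gen3433 1) * gen3433 2, fun x => ?_⟩
    simp only [Subgroup.coe_mul, Equiv.Perm.mul_apply, gen3433]
    simp [mirror_apply]
  refine ⟨gen3433 4 * gen3433 3 * s * gen3433 3 * s * gen3433 3, Subgroup.mem_top _, ?_⟩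
  ext x : 1
  simp only [Subgroup.coe_mul, Equiv.Perm.mul_apply, gen3433, hs]
  ext k
  fin_cases k <;> simp [mirror_apply] <;> ring

theorem natCast_mem_translations (d : ℕ) : ![(d : ℝ), 0, 0, 0] ∈ translations ⊤ := by
  convert nsmul_mem unit_mem_translations d using 1
  ext k
  fin_cases k <;> simp

theorem mem_translations_translationSubgroup {q : Fin 4 → ℝ} (h : q ∈ translations ⊤) :
    q ∈ translations (translationSubgroup q) := by
  obtain ⟨g, -, hg⟩ := h
  exact ⟨g, Subgroup.subset_normalClosure hg, hg⟩

/-! ### A linear group that contains both symmetry groups -/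

/-- The images of a vector under six reflections that generate a hyperbolic reflection group, which
preserves the quadratic form `y₀² + ⋯ + y₄² - y₅²`. -/
noncomputable def lorentzMap (i : Fin 6) (y : Fin 6 → ℝ) : Fin 6 → ℝ :=
  ![fun k => y k + (y 0 + y 1 + y 2 + y 3 + y 4 + y 5) / 2 * ![-1, -1, -1, -1, -1, 1] k,
    ![-y 0, y 1, y 2, y 3, y 4, y 5], ![y 1, y 0, y 2, y 3, y 4, y 5],
    ![y 0, y 2, y 1, y 3, y 4, y 5], ![y 0, y 1, y 3, y 2, y 4, y 5],
    ![y 0, y 1, y 2, y 4, y 3, y 5]] i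

theorem lorentzMap_involutive (i : Fin 6) : Function.Involutive (lorentzMap i) := by
  intro y
  ext k
  fin_cases i <;> fin_cases k <;> simp [lorentzMap] <;> ring

/-- The generating reflections of the hyperbolic reflection group. -/
noncomputable def lorentzGen (i : Fin 6) : (Fin 6 → ℝ) ≃ₗ[ℝ] (Fin 6 → ℝ) :=
  LinearEquiv.ofInvolutive
    { toFun := lorentzMap i
      map_add' := by
        intro x y
        ext k
        fin_cases i <;> fin_cases k <;> simp [lorentzMap] <;> ring
      map_smul' := by
        intro c y
        ext k
        fin_cases i <;> fin_cases k <;> simp [lorentzMap] <;> ring } (lorentzMap_involutive i)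

theorem lorentzGen_apply (i : Fin 6) (y : Fin 6 → ℝ) : lorentzGen i y = lorentzMap i y := rfl

theorem commute_lorentzGen : Commute (lorentzGen 0) (lorentzGen 5) := by
  ext y k
  simp only [LinearEquiv.mul_apply, lorentzGen_apply]
  fin_cases k <;> simp [lorentzMap] <;> ring

/-- The horospherical embedding of Euclidean `4`-space. -/
def horosphere (x : Fin 4 → ℝ) : Fin 6 → ℝ :=
  ![x 2 - x 3, x 2 + x 3, x 0 - x 1, 1 - x 0 - x 1, x ⬝ᵥ x - x 0 - x 1,
    -1 - x ⬝ᵥ x + x 0 + x 1]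

/-- The vectors `horosphere x` are null vectors with y₄ + y₅ = -1. The first five reflections fix
the null vector (0,0,0,0,-1,1), so they preserve this horosphere and act on it by Euclidean
isometries. -/
theorem lorentzGen_horosphere (i : Fin 5) (x : Fin 4 → ℝ) :
    lorentzGen i.castSucc (horosphere x) = horosphere (mirror i x) := by
  ext k
  rw [lorentzGen_apply]
  fin_cases i <;> fin_cases k <;>
    simp [lorentzMap, horosphere, mirror_apply, dotProduct, Fin.sum_univ_four] <;> ring

/-- Six points of the horosphere already span, so a linear map is determined by what it does on the
horosphere. -/
theorem eq_sum_horosphere (y : Fin 6 → ℝ) : ∃ a b c e f h : ℝ, y = a • horosphere ![1, 0, 0, 0] +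
    b • horosphere ![0, 1, 0, 0] + c • horosphere ![0, 0, 1, 0] + e • horosphere ![0, 0, 0, 1] +
    f • horosphere ![0, 0, 0, -1] + h • horosphere ![0, 0, 0, 0] := by
  refine ⟨(y 2 - y 3 - y 4 - y 5) / 2, (-(y 4 + y 5) - y 3 - y 2) / 2, (y 0 + y 1) / 2,
    (y 4 - y 0) / 2, (y 4 - y 1) / 2, -y 4 + y 3, ?_⟩
  ext k
  fin_cases k <;> simp [horosphere, dotProduct, Fin.sum_univ_four] <;> ring

theorem span_horosphere : Submodule.span ℝ (Set.range horosphere) = ⊤ := by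
  rw [eq_top_iff]
  intro y _
  have hx : ∀ (c : ℝ) x, c • horosphere x ∈ Submodule.span ℝ (Set.range horosphere) := fun c x =>
    Submodule.smul_mem _ _ (Submodule.subset_span ⟨x, rfl⟩)
  obtain ⟨a, b, c, e, f, h, hy⟩ := eq_sum_horosphere y
  rw [hy]
  exact add_mem (add_mem (add_mem (add_mem (add_mem (hx _ _) (hx _ _)) (hx _ _)) (hx _ _))
    (hx _ _)) (hx _ _)

/-- The linear map that extends a translation of the horosphere. -/
theorem apply_sub_self_of_horosphere {q : Fin 4 → ℝ} (γ : (Fin 6 → ℝ) ≃ₗ[ℝ] (Fin 6 → ℝ))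
    (hγ : ∀ x, γ (horosphere x) = horosphere (x + q)) (y : Fin 6 → ℝ) : ∃ h m : ℝ,
    h = -(y 4 + y 5) ∧
    m = q 0 * (y 2 - y 3) - q 1 * (y 2 + y 3) + q 2 * (y 0 + y 1) + q 3 * (y 1 - y 0) +
      h * (q ⬝ᵥ q) ∧
    γ y - y = ![h * (q 2 - q 3), h * (q 2 + q 3), h * (q 0 - q 1), -(h * (q 0 + q 1)), m, -m] := by
  refine ⟨_, _, rfl, rfl, ?_⟩
  obtain ⟨a, b, c, e, f, h, rfl⟩ := eq_sum_horosphere y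
  simp only [map_add, map_smul, hγ]
  ext k
  fin_cases k <;> simp [horosphere, dotProduct, Fin.sum_univ_four] <;> ring

/-- The embedding of Euclidean `5`-space as the affine hyperplane `y₅ = 1`. -/
def affineChart (x : Fin 5 → ℝ) : Fin 6 → ℝ := ![x 0, x 1, x 2, x 3, x 4, 1]

theorem lorentzGen_affineChart (i : Fin 5) (x : Fin 5 → ℝ) :
    lorentzGen i.succ (affineChart x) = affineChart (cubeMirror i x) := by
  ext k
  rw [lorentzGen_apply]
  fin_cases i <;> fin_cases k <;> simp [lorentzMap, affineChart, cubeMirror_apply]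

theorem span_affineChart : Submodule.span ℝ (Set.range affineChart) = ⊤ := by
  rw [eq_top_iff]
  intro y _
  have hx : ∀ (c : ℝ) x, c • affineChart x ∈ Submodule.span ℝ (Set.range affineChart) := fun c x =>
    Submodule.smul_mem _ _ (Submodule.subset_span ⟨x, rfl⟩)
  have hy : y = y 0 • affineChart ![1, 0, 0, 0, 0] + y 1 • affineChart ![0, 1, 0, 0, 0] +
      y 2 • affineChart ![0, 0, 1, 0, 0] + y 3 • affineChart ![0, 0, 0, 1, 0] +
      y 4 • affineChart ![0, 0, 0, 0, 1] +
      (y 5 - y 0 - y 1 - y 2 - y 3 - y 4) • affineChart ![0, 0, 0, 0, 0] := by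
    ext k
    fin_cases k <;> simp [affineChart]
  rw [hy]
  exact add_mem (add_mem (add_mem (add_mem (add_mem (hx _ _) (hx _ _)) (hx _ _)) (hx _ _))
    (hx _ _)) (hx _ _)

/-! ### Linear representations and congruence quotients. -/

/-- A group of permutations of `X` acts linearly on `V` if its generators do so compatibly with a map
from `X` to `V` whose image spans `V`. -/
theorem exists_linear_representation {X V ι : Type*} [AddCommGroup V] [Module ℝ V]
    (s : ι → Equiv.Perm X) (Γ : Subgroup (V ≃ₗ[ℝ] V)) (ρ : ι → Γ) (f : X → V)
    (hf : Submodule.span ℝ (Set.range f) = ⊤) (h : ∀ i x, (ρ i).1 (f x) = f (s i x)) :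
    ∃ L : Subgroup.closure (Set.range s) →* Γ,
      (∀ i, L ⟨s i, Subgroup.subset_closure ⟨i, rfl⟩⟩ = ρ i) ∧
      ∀ g x, (L g).1 (f x) = f (g.1 x) := by
  let α : ι → Subgroup.closure (Set.range s) := fun i => ⟨s i, Subgroup.subset_closure ⟨i, rfl⟩⟩
  have hα := closure_range_codRestrict s
  have hw : ∀ (w : FreeGroup ι) (x : X),
      (FreeGroup.lift ρ w).1 (f x) = f ((FreeGroup.lift α w).1 x) := by
    intro w
    induction w using FreeGroup.induction_on with
    | C1 => intro x; simp
    | of i => intro x; simpa using h i x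
    | inv_of i hi =>
      intro x
      have h1 := hi ((α i)⁻¹.1 x)
      simp only [FreeGroup.lift_apply_of, map_inv] at h1 ⊢
      have h2 : (α i).1 ((α i)⁻¹.1 x) = x := by simp
      rw [h2] at h1
      rw [← h1, ← LinearEquiv.mul_apply, ← Subgroup.coe_mul, inv_mul_cancel]
      rfl
    | mul v w hv hw =>
      intro x
      rw [map_mul, map_mul, Subgroup.coe_mul, Subgroup.coe_mul, LinearEquiv.mul_apply, hw, hv,
        Equiv.Perm.mul_apply]
  -- A word that is trivial on X fixes the image of f pointwise, and this image spans V; so every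
  -- relation holds in the linear group.
  obtain ⟨L, hL⟩ := exists_monoidHom_of_lift α ρ hα (by
    intro w h1
    apply Subtype.ext
    apply LinearEquiv.toLinearMap_injective
    refine LinearMap.ext_on_range hf fun x => ?_
    change (FreeGroup.lift ρ w).1 (f x) = f x
    rw [hw, h1]
    rfl)
  refine ⟨L, hL, fun g => ?_⟩
  have hs : Function.Surjective (FreeGroup.lift α) := by
    rw [← MonoidHom.range_eq_top, FreeGroup.range_lift_eq_closure, hα]
  obtain ⟨w, rfl⟩ := hs g
  have h2 : L.comp (FreeGroup.lift α) = FreeGroup.lift ρ := by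
    ext i
    simp [hL]
  intro x
  rw [← MonoidHom.comp_apply, h2, hw]

/-- The linear automorphisms that preserve two lattices. -/
def latticeStabilizer {V : Type*} [AddCommGroup V] [Module ℝ V] (Λ₁ Λ₂ : AddSubgroup V) :
    Subgroup (V ≃ₗ[ℝ] V) where
  carrier := {γ | (∀ y, γ y ∈ Λ₁ ↔ y ∈ Λ₁) ∧ ∀ y, γ y ∈ Λ₂ ↔ y ∈ Λ₂}
  one_mem' := ⟨fun _ => Iff.rfl, fun _ => Iff.rfl⟩
  mul_mem' := by
    rintro γ δ ⟨h1, h2⟩ ⟨h3, h4⟩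
    exact ⟨fun y => (h1 _).trans (h3 y), fun y => (h2 _).trans (h4 y)⟩
  inv_mem' := by
    rintro γ ⟨h1, h2⟩
    have e : ∀ y, γ (γ⁻¹ y) = y := fun y => by
      rw [← LinearEquiv.mul_apply, mul_inv_cancel]
      rfl
    exact ⟨fun y => by rw [← h1, e], fun y => by rw [← h2, e]⟩

/-- The automorphisms in `latticeStabilizer Λ₁ Λ₂` that are congruent to the identity on `Λ₁` modulo
`Λ₂`. -/
def latticeKernel {V : Type*} [AddCommGroup V] [Module ℝ V] (Λ₁ Λ₂ : AddSubgroup V) :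
    Subgroup (latticeStabilizer Λ₁ Λ₂) where
  carrier := {γ | ∀ y ∈ Λ₁, γ.1 y - y ∈ Λ₂}
  one_mem' := fun y _ => by simp
  mul_mem' := by
    intro γ δ hγ hδ y hy
    have := add_mem (hγ (δ.1 y) ((δ.2.1 y).2 hy)) (hδ y hy)
    rwa [sub_add_sub_cancel] at this
  inv_mem' := by
    intro γ hγ y hy
    have e : γ.1 (γ⁻¹.1 y) = y := by
      rw [← LinearEquiv.mul_apply, ← Subgroup.coe_mul, mul_inv_cancel]
      rfl
    have h1 := neg_mem (hγ (γ⁻¹.1 y) ((γ⁻¹.2.1 y).2 hy))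
    rwa [e, neg_sub] at h1

instance {V : Type*} [AddCommGroup V] [Module ℝ V] (Λ₁ Λ₂ : AddSubgroup V) :
    (latticeKernel Λ₁ Λ₂).Normal where
  conj_mem := by
    intro γ hγ δ y hy
    have e : δ.1 (δ⁻¹.1 y) = y := by
      rw [← LinearEquiv.mul_apply, ← Subgroup.coe_mul, mul_inv_cancel]
      rfl
    have h1 := (δ.2.2 _).2 (hγ (δ⁻¹.1 y) ((δ⁻¹.2.1 y).2 hy))
    rwa [map_sub, e] at h1

theorem lorentzGen_mem_latticeStabilizer {Λ₁ Λ₂ : AddSubgroup (Fin 6 → ℝ)}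
    (h₁ : ∀ i, ∀ y ∈ Λ₁, lorentzMap i y ∈ Λ₁) (h₂ : ∀ i, ∀ y ∈ Λ₂, lorentzMap i y ∈ Λ₂) (i : Fin 6) :
    lorentzGen i ∈ latticeStabilizer Λ₁ Λ₂ := by
  constructor
  · intro y
    refine ⟨fun h => ?_, h₁ i y⟩
    have := h₁ i _ h
    rwa [lorentzGen_apply, lorentzMap_involutive] at this
  · intro y
    refine ⟨fun h => ?_, h₂ i y⟩
    have := h₂ i _ h
    rwa [lorentzGen_apply, lorentzMap_involutive] at this

/-! ### The intersection property for the toroids -/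

theorem parabolic_mirror {S : Set ℕ} (hS : ∀ k ∈ S, k < 5) : parabolic mirror S =
    parabolic (fun i : Fin 4 => hyperplaneReflection ((1 / 2 : ℝ) • castVec (cellRoot i)) 0) S := by
  apply le_antisymm
  · apply Subgroup.closure_mono
    rintro _ ⟨i, hi, rfl⟩
    have := hS _ hi
    exact ⟨⟨i, by omega⟩, hi, (mirror_castSucc ⟨i, by omega⟩).symm⟩
  · apply Subgroup.closure_mono
    rintro _ ⟨i, hi, rfl⟩
    exact ⟨i.castSucc, hi, mirror_castSucc i⟩

/-- The base vertex of the tessellation `{3,4,3,3}`. -/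
noncomputable def baseVertex : Fin 4 → ℝ := ![1 / 2, 1 / 2, 0, 0]

theorem baseVertex_eq : baseVertex = (1 / 2 : ℝ) • castVec (cellWeight 0) := by
  ext k
  fin_cases k <;> simp [baseVertex, castVec, cellWeight]

theorem apply_baseVertex_of_mem {g : G3433} (hg : g ∈ parabolic gen3433 (Set.Ioi 1)) :
    g.1 baseVertex = baseVertex := by
  induction hg using Subgroup.closure_induction with
  | mem x hx =>
    obtain ⟨i, hi, rfl⟩ := hx
    change mirror i baseVertex = baseVertex
    ext k
    fin_cases i <;> fin_cases k <;> simp [mirror_apply, baseVertex] at hi ⊢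
    all_goals norm_num
  | one => rfl
  | mul x y _ _ hx hy => rw [Subgroup.coe_mul, Equiv.Perm.mul_apply, hy, hx]
  | inv x _ hx => rw [Subgroup.coe_inv, Equiv.Perm.inv_eq_iff_eq, hx]

theorem isLinearIsometry_of_mem_parabolic {j : ℕ} (hj : j ≤ 5) {g : G3433}
    (hg : g ∈ parabolic gen3433 (Set.Iio j)) : IsLinearIsometry g.1 := by
  have h1 := Subgroup.mem_map_of_mem G3433.subtype hg
  rw [map_parabolic] at h1
  change g.1 ∈ parabolic mirror (Set.Iio j) at h1
  rw [parabolic_mirror (S := Set.Iio j) (fun k hk => lt_of_lt_of_le hk hj)] at h1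
  refine IsLinearIsometry.of_mem_closure ?_ h1
  rintro _ ⟨i, -, rfl⟩
  exact IsLinearIsometry.hyperplaneReflection _

/-- The base vertex is half the first dominant vector, which lies on every wall through the origin
except the first. Its stabilizer among the generators that fix the origin therefore omits only the
first one, and intersecting with the indices below j is the property of the finite group. -/
theorem mem_parabolic_of_apply_baseVertex {j : ℕ} (hj : j ≤ 5) {g : G3433}
    (hg : g ∈ parabolic gen3433 (Set.Iio j)) (h : g.1 baseVertex = baseVertex) :
    g ∈ parabolic gen3433 (Set.Ioo 1 j) := by
  have h1 := Subgroup.mem_map_of_mem G3433.subtype hg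
  rw [map_parabolic] at h1
  change g.1 ∈ parabolic mirror (Set.Iio j) at h1
  rw [parabolic_mirror (S := Set.Iio j) (fun k hk => lt_of_lt_of_le hk hj)] at h1
  have h2 := cell_isRootDatum.mem_closure (t := 1 / 2) (by norm_num) baseVertex (by
    intro z hz hc
    rw [baseVertex_eq, dotProduct_smul, castVec_dotProduct, smul_eq_mul]
    have : (0 : ℝ) ≤ ((z ⬝ᵥ cellWeight 0 : ℤ) : ℝ) := by
      exact_mod_cast cell_isRootDatum.dominant z hz hc 0
    positivity) g.1 (Subgroup.closure_mono (by
      rintro _ ⟨i, -, rfl⟩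
      exact ⟨i, rfl⟩) h1) h
  have h3 : g.1 ∈ parabolic
      (fun i : Fin 4 => hyperplaneReflection ((1 / 2 : ℝ) • castVec (cellRoot i)) 0)
      (Set.Ioi 1) := by
    refine Subgroup.closure_mono ?_ h2
    rintro _ ⟨i, hi, rfl⟩
    refine ⟨i, ?_, rfl⟩
    rw [baseVertex_eq, dotProduct_smul, castVec_dotProduct, smul_eq_mul] at hi
    have h4 : cellRoot i ⬝ᵥ cellWeight 0 = 0 := by
      have : ((cellRoot i ⬝ᵥ cellWeight 0 : ℤ) : ℝ) = 0 := by linarith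
      exact_mod_cast this
    have h5 := (cell_isRootDatum.dual i 0).1 h4
    simp only [Set.mem_Ioi]
    have : (i : ℕ) ≠ 0 := fun h => h5 (Fin.ext h)
    omega
  have h4 := cell_isRootDatum.parabolic_inf (t := 1 / 2) (by norm_num) _ _
    (Subgroup.mem_inf.2 ⟨h1, h3⟩)
  have h5 : g.1 ∈ (parabolic gen3433 (Set.Ioo 1 j)).map G3433.subtype := by
    rw [map_parabolic]
    change g.1 ∈ parabolic mirror (Set.Ioo 1 j)
    rw [parabolic_mirror (S := Set.Ioo 1 j) (fun k hk => lt_of_lt_of_le hk.2 hj)]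
    refine parabolic_mono _ ?_ h4
    intro k _ _ hk
    exact ⟨hk.2, hk.1⟩
  obtain ⟨g', hg', e⟩ := h5
  rwa [← Subtype.ext e]

/-- The intersection property for a quotient of `[3,4,3,3]` by a group of translations without short
vectors. -/
theorem parabolic_inf_of_translations (T : Subgroup G3433) [T.Normal]
    (hT : ∀ g ∈ T, ∃ t, g.1 = Equiv.addRight t ∧ (t ⬝ᵥ t ≤ 2 → t = 0)) {j : ℕ} (hj : j ≤ 5) :
    parabolic (fun i => (gen3433 i : G3433 ⧸ T)) (Set.Iio j) ⊓
      parabolic (fun i => (gen3433 i : G3433 ⧸ T)) (Set.Ioi 1) ≤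
      parabolic (fun i => (gen3433 i : G3433 ⧸ T)) (Set.Ioo 1 j) := by
  have hmap := map_parabolic (QuotientGroup.mk' T) gen3433
  intro x hx
  obtain ⟨hx1, hx2⟩ := Subgroup.mem_inf.1 hx
  obtain ⟨g, hg, rfl⟩ := (SetLike.ext_iff.1 (hmap (Set.Iio j)) x).2 hx1
  obtain ⟨h, hh, e⟩ := (SetLike.ext_iff.1 (hmap (Set.Ioi 1)) _).2 hx2
  have h1 : g⁻¹ * h ∈ T := QuotientGroup.eq.1 e.symm
  -- Representatives g and h of the same class differ by a translation t. As h fixes the base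
  -- vertex, g⁻¹ moves it by t; since g is linear and the vertex has squared norm 1/2, the squared
  -- norm of t is at most 2. Hence t = 0 and g fixes the vertex.
  obtain ⟨t, ht, ht'⟩ := hT _ h1
  have hlin := (isLinearIsometry_of_mem_parabolic hj hg).inv
  have h2 : g.1⁻¹ baseVertex = baseVertex + t := by
    have h3 : (g⁻¹ * h).1 baseVertex = baseVertex + t := by
      rw [ht]
      rfl
    rw [← h3, Subgroup.coe_mul, Subgroup.coe_inv, Equiv.Perm.mul_apply,
      apply_baseVertex_of_mem hh]
  have h3 := hlin.dotProduct_sub_le baseVertex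
  rw [h2, add_sub_cancel_left] at h3
  have h4 : t = 0 := by
    apply ht'
    refine h3.trans ?_
    simp [baseVertex, dotProduct, Fin.sum_univ_four]
    norm_num
  rw [h4, add_zero, Equiv.Perm.inv_eq_iff_eq] at h2
  have h5 := Subgroup.mem_map_of_mem (QuotientGroup.mk' T)
    (mem_parabolic_of_apply_baseVertex hj hg h2.symm)
  exact (SetLike.ext_iff.1 (hmap (Set.Ioo 1 j)) _).1 h5

/-! ### The universal polytopes -/

/-- The linear part of the horospherical embedding. -/
def horosphereLinear (x : Fin 4 → ℝ) : Fin 6 → ℝ :=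
  ![x 2 - x 3, x 2 + x 3, x 0 - x 1, -x 0 - x 1, -x 0 - x 1, x 0 + x 1]

theorem horosphereLinear_eq (x : Fin 4 → ℝ) :
    horosphereLinear x = (1 / 2 : ℝ) • (horosphere x - horosphere (-x)) := by
  ext k
  fin_cases k <;> simp [horosphere, horosphereLinear] <;> ring

theorem closure_range_gen3433 : Subgroup.closure (Set.range gen3433) = ⊤ :=
  closure_range_codRestrict mirror

theorem commute_gen3433 {i j : Fin 5} (h : (i : ℕ) + 2 ≤ j) :
    Commute (gen3433 i) (gen3433 j) := by
  apply Subtype.ext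
  change Commute (mirror i) (mirror j)
  fin_cases i <;> fin_cases j <;> simp at h <;> refine commute_hyperplaneReflection ?_ _ _ <;>
    simp [dotProduct, Fin.sum_univ_four]

/-- The universal polytope with toroidal facets exists if there are lattices on which the two groups
act suitably. -/
theorem universalExists_toroid {q : Fin 4 → ℝ} {Λ₁ Λ₂ : AddSubgroup (Fin 6 → ℝ)}
    {M : Set (Fin 4 → ℝ)}
    (h₁ : ∀ i, ∀ y ∈ Λ₁, lorentzMap i y ∈ Λ₁) (h₂ : ∀ i, ∀ y ∈ Λ₂, lorentzMap i y ∈ Λ₂)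
    (hcube : ∀ i, affineChart (castVec (-Pi.single i 1)) ∈ Λ₁)
    (hcube' : ∀ (z : Fin 5 → ℤ) (i : Fin 5), z ⬝ᵥ z = 1 →
      affineChart (castVec z) - affineChart (castVec (-Pi.single i 1)) ∈ Λ₂ → z = -Pi.single i 1)
    (hzero : horosphere 0 ∈ Λ₁)
    (hq : ∀ γ : (Fin 6 → ℝ) ≃ₗ[ℝ] (Fin 6 → ℝ), (∀ x, γ (horosphere x) = horosphere (x + q)) →
      ∀ y ∈ Λ₁, γ y - y ∈ Λ₂)
    (hM : ∀ t n, ![t 2 - t 3, t 2 + t 3, t 0 - t 1, -t 0 - t 1, n, -n] ∈ Λ₂ → t ∈ M)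
    (hMT : ∀ t ∈ M, t ∈ translations (translationSubgroup q))
    (hfix : ∀ w : Equiv.Perm (Fin 4 → ℝ), IsLinearIsometry w →
      (∀ x, horosphereLinear x ∈ Λ₁ → w x - x ∈ M) → w = 1)
    (hmin : ∀ t ∈ M, t ⬝ᵥ t ≤ 2 → t = 0) :
    UniversalExists.{u} 5 (Toroid3433 q) (Cube 5) := by
  set Γ := latticeStabilizer Λ₁ Λ₂
  set K := latticeKernel Λ₁ Λ₂ with hK
  set T := translationSubgroup q with hT
  have : T.Normal := Subgroup.normalClosure_normal
  let ρ : Fin 6 → Γ := fun i => ⟨lorentzGen i, lorentzGen_mem_latticeStabilizer h₁ h₂ i⟩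
  obtain ⟨L₄, hL₄, hL₄'⟩ : ∃ L : G3433 →* Γ, (∀ i, L (gen3433 i) = ρ i.castSucc) ∧
      ∀ g x, (L g).1 (horosphere x) = horosphere (g.1 x) :=
    exists_linear_representation mirror Γ (fun i => ρ i.castSucc) horosphere span_horosphere
      lorentzGen_horosphere
  obtain ⟨L₅, hL₅, hL₅'⟩ : ∃ L : cubeGroup →* Γ, (∀ i, L (cubeGen i) = ρ i.succ) ∧
      ∀ g x, (L g).1 (affineChart x) = affineChart (g.1 x) :=
    exists_linear_representation cubeMirror Γ (fun i => ρ i.succ) affineChart span_affineChart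
      lorentzGen_affineChart
  have hTK : T ≤ K.comap L₄ := by
    apply Subgroup.normalClosure_le_normal
    intro g hg
    refine hq (L₄ g).1 fun x => ?_
    rw [hL₄', show (g : Equiv.Perm (Fin 4 → ℝ)) = Equiv.addRight q from hg]
    rfl
  have hlin : ∀ g x, IsLinearIsometry g.1 →
      (L₄ g).1 (horosphereLinear x) = horosphereLinear (g.1 x) := by
    intro g x hg
    rw [horosphereLinear_eq, horosphereLinear_eq, map_smul, map_sub, hL₄', hL₄', hg.map_neg]
  -- An element of the kernel moves the origin by a vector of M. After removal of that translation,
  -- which lies in T, a linear isometry in the kernel remains; it is trivial by `hfix`. So the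
  -- kernel is exactly T.
  have hker : ∀ g, L₄ g ∈ K → g ∈ T ∧ ∃ t ∈ M, g.1 = Equiv.addRight t := by
    intro g hg
    have ht : g.1 0 ∈ M := by
      apply hM (g.1 0) (g.1 0 ⬝ᵥ g.1 0 - g.1 0 0 - g.1 0 1)
      have := hg _ hzero
      rw [hL₄'] at this
      convert this using 1
      ext k
      fin_cases k <;> simp [horosphere] <;> ring
    obtain ⟨τ, hτ, eτ⟩ := hMT _ ht
    have hg' : L₄ (τ⁻¹ * g) ∈ K := by
      rw [map_mul, map_inv]
      exact mul_mem (inv_mem (hTK hτ)) hg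
    have h0 : (τ⁻¹ * g).1 0 = 0 := by
      rw [Subgroup.coe_mul, Subgroup.coe_inv, Equiv.Perm.mul_apply, Equiv.Perm.inv_eq_iff_eq, eτ]
      simp
    have hl := isLinearIsometry_of_mem_of_apply_zero (τ⁻¹ * g).2 h0
    have h1 := hfix _ hl (by
      intro x hx
      apply hM _ (-((τ⁻¹ * g).1 x - x) 0 - ((τ⁻¹ * g).1 x - x) 1)
      have := hg' _ hx
      rw [hlin _ _ hl] at this
      convert this using 1
      ext k
      fin_cases k <;> simp [horosphereLinear] <;> ring)
    have h2 : g = τ := by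
      have h3 : τ⁻¹ * g = 1 := Subtype.ext h1
      rw [inv_mul_eq_one] at h3
      exact h3.symm
    rw [h2]
    exact ⟨hτ, _, ht, eτ⟩
  have hKT : K.comap L₄ ≤ T := fun g hg => (hker g hg).1
  have htrans : ∀ g ∈ T, ∃ t, g.1 = Equiv.addRight t ∧ (t ⬝ᵥ t ≤ 2 → t = 0) := by
    intro g hg
    obtain ⟨t, ht, e⟩ := (hker g (hTK hg)).2
    exact ⟨t, e, hmin t ht⟩
  -- The image of -eᵢ under the cube group is an integral unit vector; by `hcube'` the only such
  -- vector congruent to -eᵢ is -eᵢ itself.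
  have hcubefix : ∀ (b : cubeGroup) (i : Fin 5),
      (L₅ b).1 (affineChart (castVec (-Pi.single i 1))) - affineChart (castVec (-Pi.single i 1)) ∈ Λ₂ →
      b.1 (castVec (Pi.single i 1)) = castVec (Pi.single i 1) := by
    intro b i h
    obtain ⟨z, hz⟩ := exists_castVec_of_mem_cubeGroup b.2 (-Pi.single i 1)
    have hl := cubeGroup_isLinearIsometry b.2
    rw [hL₅', hz] at h
    have hn : z ⬝ᵥ z = 1 := by
      have := hl.map_dotProduct (castVec (-Pi.single i 1)) (castVec (-Pi.single i 1))
      rw [hz, castVec_dotProduct, castVec_dotProduct] at this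
      have h1 : z ⬝ᵥ z = -Pi.single i 1 ⬝ᵥ -Pi.single i 1 := by exact_mod_cast this
      rw [h1]
      simp
    rw [hcube' z i hn h] at hz
    have hneg : castVec (-Pi.single i 1 : Fin 5 → ℤ) = -castVec (Pi.single i 1) := by
      ext k
      simp [castVec]
    rw [hneg, hl.map_neg] at hz
    exact neg_injective hz
  let fA : G3433 ⧸ T →* Γ ⧸ K := QuotientGroup.map T K L₄ hTK
  have hfA : Function.Injective fA := by
    rw [injective_iff_map_eq_one]
    intro a
    induction a using QuotientGroup.induction_on with
    | H g =>
      intro h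
      rw [QuotientGroup.map_mk, QuotientGroup.eq_one_iff] at h
      exact (QuotientGroup.eq_one_iff _).2 (hKT h)
  let fB : cubeGroup →* Γ ⧸ K := (QuotientGroup.mk' K).comp L₅
  have hfB : Function.Injective fB := by
    rw [injective_iff_map_eq_one]
    intro b hb
    have h1 : L₅ b ∈ K := (QuotientGroup.eq_one_iff _).1 hb
    have h2 := fun i => hcubefix b i (h1 _ (hcube i))
    have hl := cubeGroup_isLinearIsometry b.2
    apply Subtype.ext
    ext x k
    have h3 := hl.map_dotProduct (castVec (Pi.single k 1)) x
    rw [h2] at h3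
    have h4 : (castVec (Pi.single k 1) : Fin 5 → ℝ) = Pi.single k 1 := by
      ext l
      simp [castVec, Pi.single_apply]
    simpa [h4] using h3
  -- This is the null vector (0,0,0,0,-1,1), the ideal point at which the horosphere is based.
  have hu : ∀ g, (L₄ g).1 (affineChart (castVec (-Pi.single 4 1))) =
      affineChart (castVec (-Pi.single 4 1)) := by
    intro g
    have hg : g ∈ Subgroup.closure (Set.range gen3433) := by
      rw [closure_range_gen3433]
      exact Subgroup.mem_top _
    induction hg using Subgroup.closure_induction with
    | mem x hx =>
      obtain ⟨i, rfl⟩ := hx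
      rw [hL₄]
      change lorentzMap i.castSucc _ = _
      ext k
      fin_cases i <;> fin_cases k <;> simp [lorentzMap, affineChart, castVec]
    | one => simp
    | mul x y _ _ hx hy => rw [map_mul, Subgroup.coe_mul, LinearEquiv.mul_apply, hy, hx]
    | inv x _ hx =>
      conv_lhs => rw [← hx]
      rw [map_inv, ← LinearEquiv.mul_apply, ← Subgroup.coe_mul, inv_mul_cancel]
      rfl
  obtain ⟨eK⟩ := nonempty_orbitPoset_orderIso gen3433 T
  obtain ⟨eM⟩ := nonempty_cube_orderIso
  refine universalExists_of_amalgam (by norm_num) (fun i => (gen3433 i : G3433 ⧸ T)) cubeGen eK eM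
    ?_ ?_ ?_ ?_ ?_ (fun i => (ρ i : Γ ⧸ K)) ?_ fA ?_ hfA fB ?_ hfB ?_
  · have := congrArg (Subgroup.map (QuotientGroup.mk' T)) closure_range_gen3433
    rw [MonoidHom.map_closure, ← Set.range_comp, Subgroup.map_top_of_surjective _
      (QuotientGroup.mk'_surjective T)] at this
    exact this
  · intro i
    exact congrArg (QuotientGroup.mk' T) (Subtype.ext (mirror_mul_self i))
  -- A generator that is trivial modulo T would be a translation; being an involution, it would be
  -- the identity, but every generator moves (1,2,3,4).
  · intro i hi
    obtain ⟨t, ht, -⟩ := htrans _ ((QuotientGroup.eq_one_iff _).1 hi)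
    have e : mirror i = Equiv.addRight t := ht
    have h1 := congrArg (fun g => g (0 : Fin 4 → ℝ)) (mirror_mul_self i)
    simp only [e, Equiv.Perm.mul_apply] at h1
    have h2 : t = 0 := by
      have h3 : t + t = 0 := by simpa using h1
      rwa [← two_smul ℝ, smul_eq_zero_iff_right two_ne_zero] at h3
    have h4 := congrArg (fun g => g (![1, 2, 3, 4] : Fin 4 → ℝ)) e
    simp only [h2, mirror_apply] at h4
    fin_cases i
    · simpa using congrFun h4 1
    · simpa using congrFun h4 2
    · have := congrFun h4 3
      simp at this
      norm_num at this
    · have := congrFun h4 0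
      simp at this
      norm_num at this
    · simpa using congrFun h4 0
  · intro i j hij
    exact (commute_gen3433 hij).map (QuotientGroup.mk' T)
  · intro j hj
    exact parabolic_inf_of_translations T htrans hj
  · have : Commute (ρ 0) (ρ 5) := Subtype.ext commute_lorentzGen
    exact this.map (QuotientGroup.mk' K)
  · intro i
    exact congrArg (QuotientGroup.mk' K) (hL₄ i)
  · intro i
    exact congrArg (QuotientGroup.mk' K) (hL₅ i)
  -- Since a fixes the null vector, b fixes it modulo Λ₂ and hence fixes e₄, the centre of the base
  -- facet of the cube. Its stabilizer is generated by the first four generators of the cube group,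
  -- which are the shared ones.
  · intro a b hab
    have h1 : b ∈ parabolic cubeGen {k | k ≠ 5} := by
      have hb : b.1 (castVec (Pi.single 4 1)) = castVec (Pi.single 4 1) := by
        apply hcubefix
        induction a using QuotientGroup.induction_on with
        | H g =>
          have h2 : (L₄ g)⁻¹ * L₅ b ∈ K := QuotientGroup.eq.1 hab
          have h3 := ((L₄ g).2.2 _).2 (h2 _ (hcube 4))
          rwa [map_sub, hu, Subgroup.coe_mul, LinearEquiv.mul_apply, ← LinearEquiv.mul_apply,
            ← Subgroup.coe_mul, mul_inv_cancel] at h3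
      have hc : cubeCentre 5 = Pi.single 4 1 := by decide
      have h2 := (cubeGroup_apply_cubeCentre_eq_iff (j := 5) (by decide) 1 b).1 (by
        rw [hc, hb]
        rfl)
      rw [cosetFace_eq_iff, inv_one, one_mul] at h2
      exact h2
    have h2 := Subgroup.mem_map_of_mem fB h1
    have h3 : (parabolic cubeGen {k | k ≠ 5}).map fB ≤
        (parabolic (fun i => (gen3433 i : G3433 ⧸ T)) (Set.Ioi 1)).map fA := by
      rw [map_parabolic, parabolic, Subgroup.closure_le]
      rintro _ ⟨i, hi, rfl⟩
      have hi' : (i : ℕ) + 1 < 5 := by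
        have : (i : ℕ) + 1 ≠ 5 := hi
        omega
      refine ⟨(gen3433 ⟨i + 1, hi'⟩ : G3433 ⧸ T), mem_parabolic _ (by simp), ?_⟩
      exact congrArg (QuotientGroup.mk' K) ((hL₄ ⟨i + 1, hi'⟩).trans (hL₅ i).symm)
    obtain ⟨a', ha', e⟩ := h3 h2
    rw [← hab] at e
    rwa [← hfA e]

/-! ### Multiples of the lattice D₆ and of its dual. -/

/-- The multiples by `c` of the integral vectors with even coordinate sum. -/
def evenLattice (c : ℝ) : AddSubgroup (Fin 6 → ℝ) where
  carrier := {y | ∃ z : Fin 6 → ℤ, (∀ k, y k = c * z k) ∧ 2 ∣ z 0 + z 1 + z 2 + z 3 + z 4 + z 5}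
  zero_mem' := ⟨0, by simp, by simp⟩
  add_mem' := by
    rintro x y ⟨z, hz, h⟩ ⟨z', hz', h'⟩
    refine ⟨z + z', fun k => ?_, ?_⟩
    · rw [Pi.add_apply, hz, hz', Pi.add_apply]
      push_cast
      ring
    · simp only [Pi.add_apply]
      omega
  neg_mem' := by
    rintro x ⟨z, hz, h⟩
    refine ⟨-z, fun k => ?_, ?_⟩
    · rw [Pi.neg_apply, hz, Pi.neg_apply]
      push_cast
      ring
    · simp only [Pi.neg_apply]
      omega

/-- The multiples by `c` of the integral vectors all of whose coordinates have the same parity. -/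
def parityLattice (c : ℝ) : AddSubgroup (Fin 6 → ℝ) where
  carrier := {y | ∃ (z : Fin 6 → ℤ) (s : ℤ), ∀ k, y k = c * (2 * z k + s)}
  zero_mem' := ⟨0, 0, by simp⟩
  add_mem' := by
    rintro x y ⟨z, s, hz⟩ ⟨z', s', hz'⟩
    refine ⟨z + z', s + s', fun k => ?_⟩
    rw [Pi.add_apply, hz, hz', Pi.add_apply]
    push_cast
    ring
  neg_mem' := by
    rintro x ⟨z, s, hz⟩
    refine ⟨-z, -s, fun k => ?_⟩
    rw [Pi.neg_apply, hz, Pi.neg_apply]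
    push_cast
    ring

/-- An even coordinate sum 2m makes the half-sum in the first reflection an integral multiple of c,
and that reflection changes the sum by -4m. The other generators permute coordinates or change one
sign. -/
theorem lorentzMap_mem_evenLattice {c : ℝ} (i : Fin 6) {y : Fin 6 → ℝ} (hy : y ∈ evenLattice c) :
    lorentzMap i y ∈ evenLattice c := by
  obtain ⟨z, hz, m, hm⟩ := hy
  have hm' : (z 0 + z 1 + z 2 + z 3 + z 4 + z 5 : ℝ) = 2 * m := by exact_mod_cast hm
  have hs : (y 0 + y 1 + y 2 + y 3 + y 4 + y 5) / 2 = c * m := by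
    simp only [hz]
    linear_combination c / 2 * hm'
  refine ⟨![fun k => z k + m * ![-1, -1, -1, -1, -1, 1] k,
    ![-z 0, z 1, z 2, z 3, z 4, z 5], ![z 1, z 0, z 2, z 3, z 4, z 5],
    ![z 0, z 2, z 1, z 3, z 4, z 5], ![z 0, z 1, z 3, z 2, z 4, z 5],
    ![z 0, z 1, z 2, z 4, z 3, z 5]] i, ?_, ?_⟩
  · intro k
    rw [lorentzMap, hs]
    fin_cases i <;> fin_cases k <;> simp [hz] <;> ring
  · fin_cases i <;> simp <;> omega

/-- The common parity s occurs six times, so the half-sum is the integral multiple c·m; adding or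
subtracting it changes the parity of all coordinates alike. -/
theorem lorentzMap_mem_parityLattice {c : ℝ} (i : Fin 6) {y : Fin 6 → ℝ}
    (hy : y ∈ parityLattice c) : lorentzMap i y ∈ parityLattice c := by
  obtain ⟨z, s, hz⟩ := hy
  let m := z 0 + z 1 + z 2 + z 3 + z 4 + z 5 + 3 * s
  have hs : (y 0 + y 1 + y 2 + y 3 + y 4 + y 5) / 2 = c * m := by
    simp only [hz, m]
    push_cast
    ring
  refine ⟨![![z 0 - m, z 1 - m, z 2 - m, z 3 - m, z 4 - m, z 5],
    ![-z 0 - s, z 1, z 2, z 3, z 4, z 5], ![z 1, z 0, z 2, z 3, z 4, z 5],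
    ![z 0, z 2, z 1, z 3, z 4, z 5], ![z 0, z 1, z 3, z 2, z 4, z 5],
    ![z 0, z 1, z 2, z 4, z 3, z 5]] i, ![s + m, s, s, s, s, s] i, ?_⟩
  intro k
  rw [lorentzMap, hs]
  fin_cases i <;> fin_cases k <;> simp [hz] <;> ring

/-- An integral unit vector that is congruent to `-eᵢ` modulo `d` is `-eᵢ`, unless it is `eᵢ`. -/
theorem eq_neg_single_of_eq_mul {d : ℤ} (hd : 2 ≤ d) (z n : Fin 5 → ℤ) (i : Fin 5)
    (hz : z ⬝ᵥ z = 1) (h : ∀ k, z k + (Pi.single i 1 : Fin 5 → ℤ) k = d * n k)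
    (hn : (∀ k ≠ i, n k = 0) → n i ≠ 1) : z = -Pi.single i 1 := by
  have hle : ∀ k, z k * z k ≤ 1 := by
    intro k
    rw [← hz]
    exact Finset.single_le_sum (f := fun k => z k * z k) (fun k _ => mul_self_nonneg (z k))
      (Finset.mem_univ k)
  have hb : ∀ k, -1 ≤ z k ∧ z k ≤ 1 := by
    intro k
    have := hle k
    constructor <;> nlinarith
  have h0 : ∀ k ≠ i, n k = 0 := by
    intro k hk
    have h1 := h k
    rw [Pi.single_eq_of_ne hk, add_zero] at h1
    have h2 := hb k
    by_contra h3
    rcases lt_or_gt_of_ne h3 with h4 | h4 <;> nlinarith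
  have hni := hn h0
  have h1 := h i
  rw [Pi.single_eq_same] at h1
  have h2 := hb i
  -- Here d·nᵢ = zᵢ + 1 lies between 0 and 2, so nᵢ is 0 or 1. The value 1 would mean d = 2 and z =
  -- eᵢ, which the last hypothesis excludes.
  have h3 : n i = 0 := by
    have h4 : n i < 2 := by
      by_contra h5
      nlinarith
    have h5 : -1 < n i := by
      by_contra h5
      nlinarith
    omega
  ext k
  rw [Pi.neg_apply]
  by_cases hk : k = i
  · subst hk
    rw [Pi.single_eq_same]
    rw [h3] at h1
    omega
  · have h4 := h k
    rw [Pi.single_eq_of_ne hk, h0 k hk] at h4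
    rw [Pi.single_eq_of_ne hk]
    omega

theorem affineChart_sub_apply (z : Fin 5 → ℤ) (i k : Fin 5) :
    (affineChart (castVec z) - affineChart (castVec (-Pi.single i 1))) k.castSucc =
      ((z k + (Pi.single i 1 : Fin 5 → ℤ) k : ℤ) : ℝ) := by
  fin_cases k <;> simp [affineChart, castVec]

theorem affineChart_sub_apply_last (z : Fin 5 → ℤ) (i : Fin 5) :
    (affineChart (castVec z) - affineChart (castVec (-Pi.single i 1))) (Fin.last 5) = 0 := by
  simp [affineChart]

/-- The displacement of any vector under an isometry is orthogonal to every fixed vector, so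
spanning fixed vectors suffice. -/
theorem eq_one_of_forall_sub_dotProduct {w : Equiv.Perm (Fin 4 → ℝ)} (hw : IsLinearIsometry w)
    (h : ∀ v : Fin 4 → ℝ, (∀ p, w p = p → v ⬝ᵥ p = 0) → v = 0) : w = 1 := by
  ext x : 1
  refine sub_eq_zero.1 (h _ fun p hp => ?_)
  have := hw.map_dotProduct x p
  rw [hp] at this
  rw [sub_dotProduct, this, Equiv.Perm.one_apply, sub_self]

/-- The vectors of `d` times the lattice generated by the tile centres are long. -/
theorem eq_zero_of_dotProduct_le_two {d : ℕ} (hd : 2 ≤ d) {t : Fin 4 → ℝ} {z : Fin 4 → ℤ} {s : ℤ}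
    (ht : ∀ k, t k = d / 2 * (2 * z k + s)) (h : t ⬝ᵥ t ≤ 2) : t = 0 := by
  let n : Fin 4 → ℤ := fun k => 2 * z k + s
  have htn : ∀ k, t k = d / 2 * n k := by
    intro k
    rw [ht]
    simp [n]
  have hd' : (2 : ℝ) ≤ d := by exact_mod_cast hd
  have hsum : n 0 * n 0 + n 1 * n 1 + n 2 * n 2 + n 3 * n 3 ≤ 2 := by
    have h1 : ((n 0 * n 0 + n 1 * n 1 + n 2 * n 2 + n 3 * n 3 : ℤ) : ℝ) ≤ 2 := by
      simp only [dotProduct, Fin.sum_univ_four, htn] at h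
      push_cast
      have h2 : (1 : ℝ) ≤ d / 2 * (d / 2) := by nlinarith
      have h3 : (0 : ℝ) ≤ n 0 * n 0 + n 1 * n 1 + n 2 * n 2 + n 3 * n 3 := by
        have := fun k => mul_self_nonneg (n k : ℝ)
        linarith [this 0, this 1, this 2, this 3]
      nlinarith
    exact_mod_cast h1
  have hsq : ∀ k, n k * n k ≤ 2 := by
    have h1 := fun k => mul_self_nonneg (n k)
    intro k
    fin_cases k <;> simp only [Fin.mk_zero, Fin.mk_one, Fin.reduceFinMk] <;>
      linarith [h1 0, h1 1, h1 2, h1 3]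
  have hb : ∀ k, -1 ≤ n k ∧ n k ≤ 1 := by
    intro k
    have := hsq k
    constructor <;> nlinarith
  -- All entries of n have the parity of s. Even entries of absolute value at most 1 vanish; four
  -- odd squares add up to at least 4.
  rcases Int.even_or_odd' s with ⟨m, hm | hm⟩
  · have h0 : ∀ k, n k = 0 := by
      intro k
      have := hb k
      simp only [n] at *
      omega
    ext k
    rw [htn, h0]
    simp
  · exfalso
    have h1 : ∀ k, 1 ≤ n k * n k := by
      intro k
      have h2 := hb k
      have h3 : n k = 1 ∨ n k = -1 := by
        simp only [n] at *
        omega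
      rcases h3 with h3 | h3 <;> rw [h3] <;> norm_num
    linarith [h1 0, h1 1, h1 2, h1 3]

/-- The vectors of `d` times the lattice `D₄` are long. -/
theorem eq_zero_of_dotProduct_le_four {d : ℕ} (hd : 2 ≤ d) {t : Fin 4 → ℝ} {z : Fin 4 → ℤ}
    (ht : ∀ k, t k = d * z k) (hz : 2 ∣ z 0 + z 1 + z 2 + z 3) (h : t ⬝ᵥ t ≤ 4) : t = 0 := by
  have hd' : (2 : ℝ) ≤ d := by exact_mod_cast hd
  have hsum : z 0 * z 0 + z 1 * z 1 + z 2 * z 2 + z 3 * z 3 ≤ 1 := by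
    have h1 : ((z 0 * z 0 + z 1 * z 1 + z 2 * z 2 + z 3 * z 3 : ℤ) : ℝ) ≤ 1 := by
      simp only [dotProduct, Fin.sum_univ_four, ht] at h
      push_cast
      have h2 : (4 : ℝ) ≤ d * d := by nlinarith
      have h3 : (0 : ℝ) ≤ z 0 * z 0 + z 1 * z 1 + z 2 * z 2 + z 3 * z 3 := by
        have := fun k => mul_self_nonneg (z k : ℝ)
        linarith [this 0, this 1, this 2, this 3]
      nlinarith
    exact_mod_cast h1
  have hnn := fun k => mul_self_nonneg (z k)
  -- Squares have the parity of their roots, so the sum of squares is even; being at most 1, it is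
  -- 0.
  have hpar : ∀ k, ∃ m, z k * z k = z k + (m + m) := by
    intro k
    obtain ⟨m, hm⟩ := Int.even_mul_pred_self (z k)
    exact ⟨m, by linarith⟩
  obtain ⟨m0, e0⟩ := hpar 0
  obtain ⟨m1, e1⟩ := hpar 1
  obtain ⟨m2, e2⟩ := hpar 2
  obtain ⟨m3, e3⟩ := hpar 3
  have n0 := hnn 0
  have n1 := hnn 1
  have n2 := hnn 2
  have n3 := hnn 3
  have h0 : ∀ k, z k * z k = 0 := by
    intro k
    fin_cases k <;> simp only [Fin.mk_zero, Fin.mk_one, Fin.reduceFinMk] <;> omega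
  ext k
  rw [ht, mul_self_eq_zero.1 (h0 k)]
  simp

/-- Here Λ₁ is D₆* and Λ₂ is d·D₆. The translations visible in this quotient form M, which is d
times the lattice of tile centres, precisely the lattice generated by the conjugates of (d,0,0,0);
its nonzero vectors have squared norm at least d² ≥ 4. -/
theorem universalExists_axis {d : ℕ} (hd : 2 ≤ d) :
    UniversalExists.{u} 5 (Toroid3433 ![(d : ℝ), 0, 0, 0]) (Cube 5) := by
  have hd0 : (d : ℝ) ≠ 0 := by positivity
  have hmin : ∀ t : Fin 4 → ℝ, (∃ (z : Fin 4 → ℤ) (s : ℤ), ∀ k, t k = d / 2 * (2 * z k + s)) →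
      t ⬝ᵥ t ≤ 2 → t = 0 := by
    rintro t ⟨z, s, ht⟩ h
    exact eq_zero_of_dotProduct_le_two hd ht h
  refine universalExists_toroid (Λ₁ := parityLattice (1 / 2)) (Λ₂ := evenLattice d)
    (M := {t | ∃ (z : Fin 4 → ℤ) (s : ℤ), ∀ k, t k = d / 2 * (2 * z k + s)})
    (fun i y => lorentzMap_mem_parityLattice i) (fun i y => lorentzMap_mem_evenLattice i)
    ?_ ?_ ?_ ?_ ?_ ?_ ?_ hmin
  · intro i
    let w : Fin 5 → ℤ := -Pi.single i 1
    refine ⟨![w 0, w 1, w 2, w 3, w 4, 1], 0, fun k => ?_⟩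
    fin_cases k <;> simp [affineChart, castVec, w]
  · rintro z i hz ⟨n, hn, hs⟩
    refine eq_neg_single_of_eq_mul (d := d) (by exact_mod_cast hd) z (fun k => n k.castSucc) i hz
      (fun k => ?_) fun h0 h1 => ?_
    · have := hn k.castSucc
      rw [affineChart_sub_apply] at this
      exact_mod_cast this
    -- The exceptional case d = 2, z = eᵢ would give a vector n with coordinate sum 1, which is not
    -- even.
    · have h5 := hn (Fin.last 5)
      rw [affineChart_sub_apply_last, eq_comm, mul_eq_zero, or_iff_right hd0] at h5
      have h5' : n 5 = 0 := by exact_mod_cast h5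
      have h6 : n 0 + n 1 + n 2 + n 3 + n 4 = 1 := by
        have e : ∑ k : Fin 5, n k.castSucc = n i.castSucc :=
          Finset.sum_eq_single i (fun k _ hk => h0 k hk) (by simp)
        rw [Fin.sum_univ_five, h1] at e
        exact e
      omega
  · refine ⟨![0, 0, 0, 1, 0, -1], 0, fun k => ?_⟩
    fin_cases k <;> simp [horosphere]
  · rintro γ hγ y ⟨z, s, hy⟩
    obtain ⟨h, m, hh, hm, e⟩ := apply_sub_self_of_horosphere γ hγ y
    rw [e]
    refine ⟨![0, 0, -(z 4 + z 5 + s), z 4 + z 5 + s, z 2 - z 3 - (z 4 + z 5 + s) * d,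
      -(z 2 - z 3 - (z 4 + z 5 + s) * d)], fun k => ?_, ?_⟩
    · simp only [dotProduct, Fin.sum_univ_four] at hm
      fin_cases k <;> simp [hm, hh, hy] <;> ring
    · refine ⟨0, ?_⟩
      simp
      ring
  · rintro t n ⟨z, hz, m, hm⟩
    have h0 := hz 0
    have h1 := hz 1
    have h2 := hz 2
    have h3 := hz 3
    have h4 := hz 4
    have h5 := hz 5
    simp at h0 h1 h2 h3 h4 h5
    have h45 : (z 4 + z 5 : ℝ) = 0 := by
      have : (d : ℝ) * (z 4 + z 5) = 0 := by linarith
      exact (mul_eq_zero.1 this).resolve_left hd0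
    have hm' : (z 0 + z 1 + z 2 + z 3 : ℝ) = 2 * m := by
      have : (z 0 + z 1 + z 2 + z 3 + z 4 + z 5 : ℝ) = 2 * m := by exact_mod_cast hm
      linarith
    -- Solving the first four coordinates for t gives 2t₀ = d(z₂ - z₃); normalizing the first
    -- integral coordinate to 0 fixes s, and the even coordinate sum makes the remaining entries
    -- integral.
    refine ⟨![0, -z 2, m - z 2, m - z 2 - z 0], z 2 - z 3, fun k => ?_⟩
    fin_cases k <;> simp
    · linear_combination (h2 - h3) / 2
    · linear_combination (-h2 - h3) / 2
    · linear_combination (h0 + h1) / 2 + d / 2 * hm'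
    · linear_combination (h1 - h0) / 2 + d / 2 * hm'
  · rintro t ⟨z, s, ht⟩
    have hq := mem_translations_translationSubgroup (natCast_mem_translations d)
    have : (translationSubgroup ![(d : ℝ), 0, 0, 0]).Normal := Subgroup.normalClosure_normal
    obtain ⟨a, b, c, e⟩ := single_mem_translations hq
    convert add_mem (add_mem (add_mem (add_mem (zsmul_mem hq (z 0)) (zsmul_mem b (z 1)))
      (zsmul_mem c (z 2))) (zsmul_mem e (z 3))) (zsmul_mem a s) using 1
    ext k
    rw [ht]
    fin_cases k <;> simp <;> ring
  · intro w hw hx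
    refine eq_one_of_forall_sub_dotProduct hw fun v hv => ?_
    have hp : ∀ p : Fin 4 → ℝ, p ⬝ᵥ p = 1 / 2 → horosphereLinear p ∈ parityLattice (1 / 2) →
        v ⬝ᵥ p = 0 := by
      intro p hp hp'
      refine hv p (sub_eq_zero.1 (hmin _ (hx p hp') ?_))
      have := hw.dotProduct_sub_le p
      rw [hp] at this
      linarith
    -- Four orthogonal vectors of squared norm 1/2 with image in Λ₁: each is displaced by squared
    -- length at most 2, below the minimum of M, so all are fixed.
    have h0 := hp ![1 / 2, 1 / 2, 0, 0]
      (by simp [dotProduct, Fin.sum_univ_four]; norm_num)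
      ⟨![0, 0, 0, -1, -1, 1], 0, fun k => by
        fin_cases k <;> simp [horosphereLinear] <;> norm_num⟩
    have h1 := hp ![1 / 2, -1 / 2, 0, 0]
      (by simp [dotProduct, Fin.sum_univ_four]; norm_num)
      ⟨![0, 0, 1, 0, 0, 0], 0, fun k => by
        fin_cases k <;> simp [horosphereLinear] <;> norm_num⟩
    have h2 := hp ![0, 0, 1 / 2, 1 / 2]
      (by simp [dotProduct, Fin.sum_univ_four]; norm_num)
      ⟨![0, 1, 0, 0, 0, 0], 0, fun k => by
        fin_cases k <;> simp [horosphereLinear]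
        norm_num⟩
    have h3 := hp ![0, 0, 1 / 2, -1 / 2]
      (by simp [dotProduct, Fin.sum_univ_four]; norm_num)
      ⟨![1, 0, 0, 0, 0, 0], 0, fun k => by
        fin_cases k <;> simp [horosphereLinear] <;> norm_num⟩
    simp [dotProduct, Fin.sum_univ_four] at h0 h1 h2 h3
    ext k
    fin_cases k <;> (simp; linarith)

/-- The lattices exchange roles: Λ₁ is D₆ and Λ₂ is 2d·D₆*. Now M is d·D₄, generated by the
conjugates of (d,d,0,0), with minimal squared norm 2d². -/
theorem universalExists_diagonal {d : ℕ} (hd : 2 ≤ d) :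
    UniversalExists.{u} 5 (Toroid3433 ![(d : ℝ), d, 0, 0]) (Cube 5) := by
  have hd0 : (d : ℝ) ≠ 0 := by positivity
  have hmin : ∀ t : Fin 4 → ℝ,
      (∃ z : Fin 4 → ℤ, (∀ k, t k = d * z k) ∧ 2 ∣ z 0 + z 1 + z 2 + z 3) →
      t ⬝ᵥ t ≤ 4 → t = 0 := by
    rintro t ⟨z, ht, hz⟩ h
    exact eq_zero_of_dotProduct_le_four hd ht hz h
  refine universalExists_toroid (Λ₁ := evenLattice 1) (Λ₂ := parityLattice d)
    (M := {t | ∃ z : Fin 4 → ℤ, (∀ k, t k = d * z k) ∧ 2 ∣ z 0 + z 1 + z 2 + z 3})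
    (fun i y => lorentzMap_mem_evenLattice i) (fun i y => lorentzMap_mem_parityLattice i)
    ?_ ?_ ?_ ?_ ?_ ?_ ?_ (fun t ht h => hmin t ht (by linarith))
  · intro i
    let w : Fin 5 → ℤ := -Pi.single i 1
    refine ⟨![w 0, w 1, w 2, w 3, w 4, 1], fun k => ?_, ?_⟩
    · fin_cases k <;> simp [affineChart, castVec, w]
    · fin_cases i <;> simp [w]
  · rintro z i hz ⟨n, s, hn⟩
    refine eq_neg_single_of_eq_mul (d := d) (by exact_mod_cast hd) z
      (fun k => 2 * n k.castSucc + s) i hz (fun k => ?_) fun h0 h1 => ?_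
    · have := hn k.castSucc
      rw [affineChart_sub_apply] at this
      exact_mod_cast this
    -- The last coordinate of the difference vanishes, so s is even and every quotient by d is even,
    -- in particular not 1.
    · have h5 := hn (Fin.last 5)
      rw [affineChart_sub_apply_last, eq_comm, mul_eq_zero, or_iff_right hd0] at h5
      have h5' : 2 * n (Fin.last 5) + s = 0 := by exact_mod_cast h5
      omega
  · refine ⟨![0, 0, 0, 1, 0, -1], fun k => ?_, by simp⟩
    fin_cases k <;> simp [horosphere]
  · rintro γ hγ y ⟨z, hy, -⟩
    obtain ⟨h, m, hh, hm, e⟩ := apply_sub_self_of_horosphere γ hγ y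
    rw [e]
    refine ⟨![0, 0, 0, z 4 + z 5, -z 3 - (z 4 + z 5) * d, z 3 + (z 4 + z 5) * d], 0, fun k => ?_⟩
    simp only [dotProduct, Fin.sum_univ_four] at hm
    fin_cases k <;> simp [hm, hh, hy] <;> ring
  · rintro t n ⟨z, s, hz⟩
    have h0 := hz 0
    have h1 := hz 1
    have h2 := hz 2
    have h3 := hz 3
    simp at h0 h1 h2 h3
    refine ⟨![z 2 - z 3, -z 2 - z 3 - s, z 0 + z 1 + s, z 1 - z 0], fun k => ?_, ?_⟩
    · fin_cases k <;> simp
      · linear_combination (h2 - h3) / 2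
      · linear_combination (-h2 - h3) / 2
      · linear_combination (h0 + h1) / 2
      · linear_combination (h1 - h0) / 2
    · simp
      omega
  · rintro t ⟨z, ht, m, hm⟩
    have hq : ![(d : ℝ), d, 0, 0] ∈ translations (translationSubgroup ![(d : ℝ), d, 0, 0]) := by
      apply mem_translations_translationSubgroup
      convert add_mem (natCast_mem_translations d)
        (single_mem_translations (natCast_mem_translations d)).2.1 using 1
      simp
    have : (translationSubgroup ![(d : ℝ), d, 0, 0]).Normal := Subgroup.normalClosure_normal
    have h1 : ![(d : ℝ), 0, d, 0] ∈ translations (translationSubgroup ![(d : ℝ), d, 0, 0]) := by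
      convert mirror_mem_translations hq 0 using 1
      simp [mirror_apply]
    have h2 : ![(d : ℝ), 0, 0, d] ∈ translations (translationSubgroup ![(d : ℝ), d, 0, 0]) := by
      convert mirror_mem_translations h1 1 using 1
      simp [mirror_apply]
    have h3 : ![(d : ℝ), 0, 0, -d] ∈ translations (translationSubgroup ![(d : ℝ), d, 0, 0]) := by
      convert mirror_mem_translations h2 2 using 1
      simp [mirror_apply]
    have hm' : (z 0 + z 1 + z 2 + z 3 : ℝ) = 2 * m := by exact_mod_cast hm
    -- The coefficients of (d,d,0,0) and (d,0,d,0) are forced by the two middle coordinates; those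
    -- of (d,0,0,±d) are then determined by the last and the first, using that the coordinate sum is
    -- 2m.
    convert add_mem (add_mem (add_mem (zsmul_mem hq (z 1)) (zsmul_mem h1 (z 2)))
      (zsmul_mem h2 (m - z 1 - z 2))) (zsmul_mem h3 (m - z 1 - z 2 - z 3)) using 1
    ext k
    rw [ht]
    fin_cases k <;> simp
    · linear_combination d * hm'
    all_goals ring
  · intro w hw hx
    refine eq_one_of_forall_sub_dotProduct hw fun v hv => ?_
    have hp : ∀ p : Fin 4 → ℝ, p ⬝ᵥ p = 1 → horosphereLinear p ∈ evenLattice 1 →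
        v ⬝ᵥ p = 0 := by
      intro p hp hp'
      refine hv p (sub_eq_zero.1 (hmin _ (hx p hp') ?_))
      have := hw.dotProduct_sub_le p
      rw [hp] at this
      linarith
    -- The unit vectors have image in D₆ and are displaced by squared length at most 4, below the
    -- minimum 2d² of M; so each of them is fixed.
    have h0 := hp ![1, 0, 0, 0] (by simp [dotProduct, Fin.sum_univ_four])
      ⟨![0, 0, 1, -1, -1, 1], fun k => by fin_cases k <;> simp [horosphereLinear], by simp⟩
    have h1 := hp ![0, 1, 0, 0] (by simp [dotProduct, Fin.sum_univ_four])
      ⟨![0, 0, -1, -1, -1, 1], fun k => by fin_cases k <;> simp [horosphereLinear], by simp⟩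
    have h2 := hp ![0, 0, 1, 0] (by simp [dotProduct, Fin.sum_univ_four])
      ⟨![1, 1, 0, 0, 0, 0], fun k => by fin_cases k <;> simp [horosphereLinear], by simp⟩
    have h3 := hp ![0, 0, 0, 1] (by simp [dotProduct, Fin.sum_univ_four])
      ⟨![-1, 1, 0, 0, 0, 0], fun k => by fin_cases k <;> simp [horosphereLinear], by simp⟩
    simp [dotProduct, Fin.sum_univ_four] at h0 h1 h2 h3
    ext k
    fin_cases k <;> simp [h0, h1, h2, h3]

end AbstractPolytope

theorem mainTheorem2 (d : ℕ) (hd : 2 ≤ d) :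
    AbstractPolytope.UniversalExists.{u} 5
      (AbstractPolytope.Toroid3433 ![(d : ℝ), 0, 0, 0]) (AbstractPolytope.Cube 5) ∧
    AbstractPolytope.UniversalExists.{u} 5
      (AbstractPolytope.Toroid3433 ![(d : ℝ), (d : ℝ), 0, 0]) (AbstractPolytope.Cube 5) :=
  ⟨AbstractPolytope.universalExists_axis hd, AbstractPolytope.universalExists_diagonal hd⟩
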